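/- Let $M$ be a $C^\infty$ manifold (finite-dimensional, possibly with boundary) and let $F$ be a $C^\infty$ vector field on $M$, tangent to $\partial M$. Let $\mathbf F:\mathrm{dom}(F)\to M$, $\mathrm{dom}(F)\subset M\times\mathbb R$, be its local flow (defined on maximal intervals of existence) and $\Sigma_F=\{z: F(z)=0\}$. All vector fields are $C^\infty$ and tangent to $\partial M$. For an open set $V\subset M$ use the following notions. - $\mathrm{func}(F,V)$ is the set of $\alpha\in C^\infty(V,\mathbb R)$ with $(x,\alpha(x))\in\mathrm{dom}(F)$ for all $x\in V$. The shift map is $\varphi_V:\mathrm{func}(F,V)\to C^\infty(V,M)$, $\varphi_V(\alpha)(x)=\mathbf F(x,\alpha(x))$, and $Sh(F,V)$ is its image. - $\mathcal E(F,V)$ is the set of $C^\infty$ maps $h:V\to M$ such that $h(\omega\cap V)\subset\omega$ for every orbit $\omega$ of $F$ and $h$ is a local diffeomorphism at every point of $\Sigma_F\cap V$. $\mathcal E_{\mathrm{id}}(F,V)^0$ is the set of $h$ for which there is a continuous homotopy $H:V\times[0,1]\to M$ from the inclusion $V\subset M$ to $h$ with $H_t\in\mathcal E(F,V)$ for all $t$.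 - $\varphi_V$ satisfies the smooth path-lifting condition if $\Sigma_F$ is nowhere dense in $V$ and, for every $C^\infty$ homotopy $H:V\times[0,1]\to M$ and every $\alpha_0\in\mathrm{func}(F,V)$ with $H_0=\varphi_V(\alpha_0)$ and $H_t\in Sh(F,V)$ for all $t$, the (unique) function $\Lambda:(V\setminus\Sigma_F)\times[0,1]\to\mathbb R$, $C^\infty$ and such that $\Lambda(x,0)=\alpha_0(x)$ and $H(x,t)=\mathbf F(x,\Lambda(x,t))$, extends to a $C^\infty$ function on $V\times[0,1]$. - $F$ is parameter rigid if for every vector field $G$ on $M$ each of whose orbits is contained in an orbit of $F$ there is a $C^\infty$ function $\alpha:M\to\mathbb R$ with $G=\alpha F$. - $F|_V$ is a regular extension of a non-zero linear vector field if there are $m\ge1$, a non-zero real $m\times m$ matrix $A$, a smooth manifold $N$ (possibly with boundary) and a diffeomorphism $\eta:V\to\mathbb R^m\times N$ such that the vector field that $\eta$ induces from $F|_V$ on $\mathbb R^m\times N$ has the form $(y,n)\mapsto(Ay,\,H(y,n))$ with $H:\mathbb R^m\times N\to TN$ smooth and $H(y,n)\in T_nN$. **Corollary.** (1) If $V\subset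 M$ is open and $F|_V$ is a regular extension of a non-zero linear vector field, then $Sh(F,V)=\mathcal E_{\mathrm{id}}(F,V)^0$ and $\varphi_V$ satisfies the smooth path-lifting condition. (2) If every $z\in\Sigma_F$ has an open neighbourhood $V$ such that $F|_V$ is a regular extension of a non-zero linear vector field, then $F$ is parameter rigid. -/

import Mathlib

open Set Manifold TopologicalSpace
open scoped ContDiff Topology

universe u v w x

noncomputable section

/-- The model `I` is a model for manifolds with (possibly empty) boundary: its range is either the
whole vector space or a closed half-space. -/
def IsBoundaryModel {E : Type u} [NormedAddCommGroup E] [NormedSpace ℝ E]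
    {H : Type v} [TopologicalSpace H] (I : ModelWithCorners ℝ E H) : Prop :=
  range I = univ ∨ ∃ l : E →L[ℝ] ℝ, l ≠ 0 ∧ range I = {y | 0 ≤ l y}

section Flow

variable {E : Type u} [NormedAddCommGroup E] [NormedSpace ℝ E]
  {H : Type v} [TopologicalSpace H] (I : ModelWithCorners ℝ E H)
  {M : Type w} [TopologicalSpace M] [ChartedSpace H M]

/-- `F` is a `C^∞` vector field on `M` tangent to the boundary of `M`: at every boundary point the
component of `F` normal to the boundary (in the chart at that point) vanishes. -/
structure IsSmoothField [IsManifold I ∞ M] (F : ∀ p : M, TangentSpace I p) : Prop where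
  smooth : ContMDiff I I.tangent ∞ (fun p => (⟨p, F p⟩ : TangentBundle I M))
  tangent : ∀ p ∈ I.boundary M, ∀ l : E →L[ℝ] ℝ, range I = {y | 0 ≤ l y} → l (F p) = 0

variable {I}

/-- `γ` is an integral curve of `F` with `γ 0 = p`, on some open interval containing `0` and `t`. -/
def IsSolutionTo (F : ∀ p : M, TangentSpace I p) (p : M) (t : ℝ) (γ : ℝ → M) : Prop :=
  ∃ a b : ℝ, a < 0 ∧ 0 < b ∧ t ∈ Ioo a b ∧ γ 0 = p ∧ IsMIntegralCurveOn γ F (Ioo a b)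

/-- The domain of the local flow of `F`: the pairs `(p, t)` such that `t` lies in the maximal
interval of existence of the integral curve of `F` starting at `p`. -/
def flowDomain (F : ∀ p : M, TangentSpace I p) : Set (M × ℝ) :=
  {q | ∃ γ : ℝ → M, IsSolutionTo F q.1 q.2 γ}

open Classical in
/-- The local flow of `F`: the value at time `t` of the integral curve of `F` starting at `p`
(and the value `p` off the domain of the flow). -/
def flow (F : ∀ p : M, TangentSpace I p) (p : M) (t : ℝ) : M :=
  if h : (p, t) ∈ flowDomain F then Classical.choose h t else p

/-- The orbit of `p`, i.e. the image of the maximal integral curve of `F` starting at `p`. -/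
def orbit (F : ∀ p : M, TangentSpace I p) (p : M) : Set M :=
  {q | ∃ t : ℝ, (p, t) ∈ flowDomain F ∧ q = flow F p t}

/-- The `C^∞` functions on `V` whose graph lies in the domain of the local flow of `F`. -/
def shiftFunctions (F : ∀ p : M, TangentSpace I p) (V : Opens M) : Set (V → ℝ) :=
  {α | ContMDiff I 𝓘(ℝ, ℝ) ∞ α ∧ ∀ p : V, ((p : M), α p) ∈ flowDomain F}

/-- The shift map of `F` on `V`; it is used on `shiftFunctions F V` only. -/
def shiftMap (F : ∀ p : M, TangentSpace I p) (V : Opens M) (α : V → ℝ) : V → M :=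
  fun p => flow F p (α p)

/-- The image of the shift map of `F` on `V`. -/
def shiftImage (F : ∀ p : M, TangentSpace I p) (V : Opens M) : Set (V → M) :=
  shiftMap F V '' shiftFunctions F V

/-- The set `E(F,V)` of the `C^∞` maps `V → M` that send every orbit of `F` to itself and are local
diffeomorphisms at the singular points of `F` in `V`. -/
def orbitMaps (F : ∀ p : M, TangentSpace I p) (V : Opens M) : Set (V → M) :=
  {h | ContMDiff I I ∞ h ∧
    (∀ q : M, ∀ p : V, (p : M) ∈ orbit F q → h p ∈ orbit F q) ∧
    ∀ z : V, F z = 0 → IsLocalDiffeomorphAt I I ∞ h z}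

/-- The set `E_id(F,V)^0`: the maps in `E(F,V)` that can be joined to the inclusion of `V` by a
homotopy `V × [0,1] → M`, continuous in both variables, which consists of maps in `E(F,V)`. -/
def orbitMapsId (F : ∀ p : M, TangentSpace I p) (V : Opens M) : Set (V → M) :=
  {h | ∃ K : V × ℝ → M, ContinuousOn K (univ ×ˢ Icc (0 : ℝ) 1) ∧
    (∀ t ∈ Icc (0 : ℝ) 1, (fun p : V => K (p, t)) ∈ orbitMaps F V) ∧
    (∀ p : V, K (p, 0) = p) ∧ ∀ p : V, K (p, 1) = h p}

/-- The smooth path-lifting condition for the shift map of `F` on `V`: the singular set is nowhere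
dense in `V`, and for every `C^∞` homotopy `K : V × [0,1] → M` inside the image of the shift map
with `K(·,0)` the shift via `α₀`, the shift function of `K` on the regular points of `V`
that starts at `α₀` extends to a `C^∞` function on `V × [0,1]`. (Over the regular points a continuous
shift function of `K` that starts at `α₀` is unique.) -/
def SmoothPathLifting (F : ∀ p : M, TangentSpace I p) (V : Opens M) : Prop :=
  IsNowhereDense {p : V | F p = 0} ∧
  ∀ (K : V × ℝ → M) (α₀ : V → ℝ),
    ContMDiffOn (I.prod 𝓘(ℝ, ℝ)) I ∞ K (univ ×ˢ Icc (0 : ℝ) 1) →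
    α₀ ∈ shiftFunctions F V →
    (∀ p : V, K (p, 0) = shiftMap F V α₀ p) →
    (∀ t ∈ Icc (0 : ℝ) 1, (fun p : V => K (p, t)) ∈ shiftImage F V) →
    ∃ L : V × ℝ → ℝ,
      ContMDiffOn (I.prod 𝓘(ℝ, ℝ)) 𝓘(ℝ, ℝ) ∞ L (univ ×ˢ Icc (0 : ℝ) 1) ∧
      ∀ p : V, F p ≠ 0 → L (p, 0) = α₀ p ∧
        ∀ t ∈ Icc (0 : ℝ) 1, ((p : M), L (p, t)) ∈ flowDomain F ∧ K (p, t) = flow F p (L (p, t))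

/-- `F` is parameter rigid: every vector field `G` on `M` whose orbits are contained in orbits of
`F` is of the form `G = α F` with a `C^∞` function `α`. -/
def ParameterRigid [IsManifold I ∞ M] (F : ∀ p : M, TangentSpace I p) : Prop :=
  ∀ G : ∀ p : M, TangentSpace I p, IsSmoothField I G →
    (∀ p : M, ∃ q : M, orbit G p ⊆ orbit F q) →
    ∃ α : M → ℝ, ContMDiff I 𝓘(ℝ, ℝ) ∞ α ∧ ∀ p : M, G p = α p • F p

end Flow

/-- The vector field `F` on `M × N` is a regular extension of the vector field `G` on `M`:
`F (p, q) = (G p, h (p, q))` with a `C^∞` map `h : M × N → T N`, `h (p, q) ∈ T_q N`. -/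
def IsRegularExtension
    {E : Type*} [NormedAddCommGroup E] [NormedSpace ℝ E]
    {H : Type*} [TopologicalSpace H] {I : ModelWithCorners ℝ E H}
    {M : Type*} [TopologicalSpace M] [ChartedSpace H M]
    {E' : Type*} [NormedAddCommGroup E'] [NormedSpace ℝ E']
    {H' : Type*} [TopologicalSpace H'] {J : ModelWithCorners ℝ E' H'}
    {N : Type*} [TopologicalSpace N] [ChartedSpace H' N] [IsManifold J ∞ N]
    (F : ∀ r : M × N, TangentSpace (I.prod J) r) (G : ∀ p : M, TangentSpace I p) : Prop :=
  ∃ h : ∀ r : M × N, TangentSpace J r.2,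
    ContMDiff (I.prod J) J.tangent ∞ (fun r => (⟨r.2, h r⟩ : TangentBundle J N)) ∧
    ∀ r : M × N, F r = (G r.1, h r)

/-- The linear vector field `y ↦ A y` on `ℝ^m`. -/
def linearField {m : ℕ} (A : Matrix (Fin m) (Fin m) ℝ) (y : EuclideanSpace ℝ (Fin m)) :
    TangentSpace 𝓘(ℝ, EuclideanSpace ℝ (Fin m)) y :=
  (WithLp.toLp 2 (A.mulVec (WithLp.ofLp y)) : EuclideanSpace ℝ (Fin m))

/-- The restriction of `F` to `V` is a regular extension of a non-zero linear vector field: for some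
non-zero matrix `A`, manifold `N` (with or without boundary) and diffeomorphism
`η : V → ℝ^m × N`, the vector field that `η` induces on `ℝ^m × N` is a regular extension of
`y ↦ A y`. -/
def IsLinearExtensionOn
    {E : Type u} [NormedAddCommGroup E] [NormedSpace ℝ E]
    {H : Type v} [TopologicalSpace H] {I : ModelWithCorners ℝ E H}
    {M : Type w} [TopologicalSpace M] [ChartedSpace H M]
    (F : ∀ p : M, TangentSpace I p) (V : Opens M) : Prop :=
  ∃ (m k : ℕ) (A : Matrix (Fin m) (Fin m) ℝ) (H' : Type) (_ : TopologicalSpace H')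
    (J : ModelWithCorners ℝ (EuclideanSpace ℝ (Fin k)) H')
    (N : Type x) (_ : TopologicalSpace N) (_ : ChartedSpace H' N) (_ : IsManifold J ∞ N)
    (η : V ≃ₘ^∞⟮I, 𝓘(ℝ, EuclideanSpace ℝ (Fin m)).prod J⟯ (EuclideanSpace ℝ (Fin m) × N)),
    A ≠ 0 ∧ IsBoundaryModel J ∧
    IsRegularExtension
      (VectorField.mpullback (𝓘(ℝ, EuclideanSpace ℝ (Fin m)).prod J) I
        (fun r => (η.symm r : M)) F)
      (linearField A)

end

/-! The core is a division problem. Let `Y` be the ℝ^m-component of the given diffeomorphism of `V`;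
along orbit segments inside `V` it solves `y' = A y`. If `h` preserves orbits and `h x = flow F x (Λ
x)` at regular points, then `Y (h x) = exp (Λ x A) (Y x)`. The function `Λ` is smooth at regular
points, and one has to extend it smoothly over the zeros of `F`.

As `A ≠ 0`, it has a dual vector `ξ` of one of three kinds (`exists_dual_eigenvector`). For a real
eigenvalue `l ≠ 0`, `ξ (Y h) = exp (l Λ) ξ (Y)`. Hadamard's lemma divides by `ξ (Y)`, the quotient
is nonzero at the zero because `h` is a local diffeomorphism there, and `Λ` is its logarithm over
`l`. If `A` is nilpotent, some `ξ` has `ξ A ≠ 0` and `ξ A² = 0`; then `ξ (Y h) - ξ (Y) = Λ ξ (A Y)`,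
and Hadamard's lemma gives `Λ` directly. For a complex eigenvector put `w = ξ (Y)` and `W = ξ (Y h)
= exp (l Λ) w`. Hadamard's lemma yields only `W = w a + w̄ b`. Because `Λ` is real, `∂̄Λ` can be
eliminated from `∂̄W` and `∂̄W̄`; the resulting identity forces `a b = 0` on `w = 0`. There `a = 0 ≠
b` is excluded by a winding number, since `W / w` has a continuous logarithm. So `b = 0` on `w = 0`,
and iteration gives `W = w a_j + w̄^(j+1) b_j` for every `j`. As `w̄^(n+2) / w` is `C^n`, the
quotient `W / w` is smooth. The three cases are joined in `exists_extension_of_linear_flow`.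

For (1), a shift by `α` is joined to the inclusion by the shifts by `t α`, and is a local
diffeomorphism at zeros by the implicit function theorem. Conversely, a homotopy through
orbit-preserving maps lifts continuously over the regular points (`exists_plaque_time`,
`exists_lift`); lifts are unique because a regular orbit passes through a given point at countably
many times only. The lift is smooth there and extends by the division theorem. Path lifting is the
same argument with `t` as a further parameter. That the orbit segments involved stay in `V` near a
zero follows from the intermediate value theorem along the homotopy.

For (2), `G = a F` at regular points and `G = 0` at zeros, so `dY (G) = a A (Y)`, and Hadamard's
lemma for a nonzero functional of the form `ζ A` extends `a`.

All this needs smooth flows on manifolds with boundary. In a half-space the field is composed with a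
retraction, tangency keeps solutions inside, and smooth dependence on the initial point is proved by
induction through the variational equation. -/

noncomputable section

/-! ### Smooth local flows of tangent vector fields on half-spaces -/

section HalfSpaceODE

open Metric Filter
open scoped NNReal

/-- The set `K` is the whole space or a closed half-space, and in the latter case the vector field
`f` is tangent to the boundary of `K` at the points of `w`. -/
def TangentOn {E : Type u} [NormedAddCommGroup E] [NormedSpace ℝ E] (K w : Set E) (f : E → E) :
    Prop :=
  K = univ ∨ ∃ (l : E →L[ℝ] ℝ) (e : E), l e = 1 ∧ K = {y | 0 ≤ l y} ∧
    ∀ y ∈ K ∩ w, l y = 0 → l (f y) = 0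

variable {E : Type u} [NormedAddCommGroup E] [NormedSpace ℝ E] {K w : Set E} {f : E → E}

theorem TangentOn.convex (h : TangentOn K w f) : Convex ℝ K := by
  rcases h with rfl | ⟨l, e, he, rfl, -⟩
  · exact convex_univ
  · exact convex_halfSpace_ge (f := l) l.isLinear 0

theorem TangentOn.interior_nonempty (h : TangentOn K w f) : (interior K).Nonempty := by
  rcases h with rfl | ⟨l, e, he, rfl, -⟩
  · simp
  · refine ⟨e, mem_interior.2 ⟨{y | 0 < l y}, fun y hy => (show 0 < l y from hy).le, ?_, ?_⟩⟩
    · exact isOpen_lt continuous_const l.continuous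
    · simp [he]

theorem TangentOn.uniqueDiffOn (h : TangentOn K w f) : UniqueDiffOn ℝ K :=
  uniqueDiffOn_convex h.convex h.interior_nonempty

theorem TangentOn.prod {F : Type u} [NormedAddCommGroup F] [NormedSpace ℝ F]
    (h : TangentOn K w f) (g : E × F → F) :
    TangentOn (K ×ˢ (univ : Set F)) (w ×ˢ univ) (fun q => (f q.1, g q)) := by
  rcases h with rfl | ⟨l, e, he, rfl, ht⟩
  · exact .inl univ_prod_univ
  · refine .inr ⟨l.comp (ContinuousLinearMap.fst ℝ E F), (e, 0), by simpa using he, ?_, ?_⟩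
    · ext; simp
    · rintro ⟨y, z⟩ hy h0
      exact ht y ⟨hy.1.1, hy.2.1⟩ h0

/-- A Lipschitz retraction onto `K` that sends the complement of `K` to the boundary of `K`. -/
theorem TangentOn.exists_retraction (h : TangentOn K w f) :
    ∃ (ρ : E → E) (C : ℝ≥0), LipschitzWith C ρ ∧ (∀ y, ρ y ∈ K) ∧ (∀ y ∈ K, ρ y = y) ∧
      (K = univ ∨ ∃ l : E →L[ℝ] ℝ, K = {y | 0 ≤ l y} ∧
        ∀ y, ρ y ∈ w → l y < 0 → l (f (ρ y)) = 0) := by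
  rcases h with rfl | ⟨l, e, he, rfl, ht⟩
  · exact ⟨id, 1, LipschitzWith.id, fun _ => trivial, fun _ _ => rfl, .inl rfl⟩
  · have hK : ∀ y, y - min (l y) 0 • e ∈ {y | 0 ≤ l y} := by
      intro y
      rcases le_total (l y) 0 with h | h <;> simp [h, he]
    refine ⟨fun y => y - min (l y) 0 • e, _, LipschitzWith.id.sub
      ((ContinuousLinearMap.toSpanSingleton ℝ e).lipschitz.comp (l.lipschitz.min_const 0)), hK, ?_,
      .inr ⟨l, rfl, fun y hy hlt => ht _ ⟨hK y, hy⟩ ?_⟩⟩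
    · intro y hy
      simp [min_eq_right (show (0 : ℝ) ≤ l y from hy)]
    · simp [min_eq_left hlt.le, he]

/-- The negative part is not differentiable at `0`, but its square is. This turns invariance of a
half-space into constancy of a function with zero derivative. -/
theorem hasDerivAt_min_zero_sq (x : ℝ) :
    HasDerivAt (fun x : ℝ => min x 0 ^ 2) (2 * min x 0) x := by
  rcases lt_trichotomy x 0 with h | rfl | h
  · rw [min_eq_left h.le]
    have h1 : HasDerivAt (fun x : ℝ => x ^ 2) (2 * x) x := by simpa using hasDerivAt_pow 2 x
    refine h1.congr_of_eventuallyEq ?_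
    filter_upwards [gt_mem_nhds h] with y hy
    rw [min_eq_left (le_of_lt hy)]
  · have : HasDerivAt (fun x : ℝ => min x 0 ^ 2) 0 0 := by
      rw [hasDerivAt_iff_isLittleO]
      simp only [min_self, sub_zero, smul_zero, ne_eq, OfNat.ofNat_ne_zero, not_false_eq_true,
        zero_pow]
      have h2 : (fun x : ℝ => min x 0 ^ 2) =O[𝓝 0] fun x : ℝ => x ^ 2 := by
        refine Asymptotics.IsBigO.of_bound 1 (Eventually.of_forall fun x => ?_)
        simp only [norm_pow, Real.norm_eq_abs, sq_abs, one_mul]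
        rcases le_total x 0 with h | h <;> simp [h]
      refine h2.trans_isLittleO ?_
      simpa using Asymptotics.isLittleO_pow_id (𝕜 := ℝ) (n := 2) (by norm_num)
    simpa using this
  · rw [min_eq_right h.le]
    simp only [mul_zero]
    refine (hasDerivAt_const x (0 : ℝ)).congr_of_eventuallyEq ?_
    filter_upwards [lt_mem_nhds h] with y hy
    simp [min_eq_right (le_of_lt hy)]

/-- A real function on an interval whose derivative vanishes wherever the function is negative
stays non-negative if it is non-negative at one point. -/
theorem nonneg_of_deriv_eq_zero {u u' : ℝ → ℝ} {a b t₀ : ℝ} (h₀ : t₀ ∈ Ioo a b) (hu₀ : 0 ≤ u t₀)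
    (hu : ∀ t ∈ Ioo a b, HasDerivAt u (u' t) t) (hu' : ∀ t ∈ Ioo a b, u t < 0 → u' t = 0) :
    ∀ t ∈ Ioo a b, 0 ≤ u t := by
  have hg : ∀ t ∈ Ioo a b, HasDerivAt (fun t => min (u t) 0 ^ 2) 0 t := by
    intro t ht
    have h1 := (hasDerivAt_min_zero_sq (u t)).comp t (hu t ht)
    refine h1.congr_deriv ?_
    rcases lt_or_ge (u t) 0 with h | h
    · rw [hu' t ht h, mul_zero]
    · simp [min_eq_right h]
  intro t ht
  have h2 : min (u t) 0 ^ 2 = min (u t₀) 0 ^ 2 :=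
    isOpen_Ioo.is_const_of_deriv_eq_zero isPreconnected_Ioo
      (fun s hs => (hg s hs).differentiableAt.differentiableWithinAt)
      (fun s hs => (hg s hs).deriv) ht h₀
  rw [min_eq_right hu₀] at h2
  by_contra hlt
  rw [min_eq_left (not_le.1 hlt).le] at h2
  have : u t = 0 := by simpa using h2
  exact hlt this.ge

/-- Local existence for a vector field on a half-space that is tangent to the boundary. -/
theorem exists_lipschitz_flow [CompleteSpace E] {x₀ : E} (hT : TangentOn K w f) (hx₀ : x₀ ∈ K)
    (hw : w ∈ 𝓝 x₀) (hf : ContDiffWithinAt ℝ 1 f K x₀) :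
    ∃ r > 0, ∃ ε > 0, ∃ φ : E → ℝ → E,
      (∀ x ∈ K ∩ ball x₀ r, φ x 0 = x ∧ ∀ t ∈ Ioo (-ε) ε, φ x t ∈ K ∩ w ∧
        HasDerivAt (φ x) (f (φ x t)) t) ∧
      ∃ C : ℝ≥0, ∀ t ∈ Ioo (-ε) ε, LipschitzOnWith C (fun x => φ x t) (K ∩ ball x₀ r) := by
  -- The field `f ∘ ρ` is defined on both sides of the boundary, so Picard–Lindelöf applies to it.
  -- Solutions that start in `K` turn out to stay in `K`, where `ρ` is the identity.
  obtain ⟨ρ, Cρ, hρ, hρK, hρid, hρl⟩ := hT.exists_retraction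
  obtain ⟨Cf, s, hs, hlip⟩ := hf.exists_lipschitzOnWith hT.convex
  obtain ⟨r₁, hr₁, hsub⟩ : ∃ r₁ > 0, ball x₀ r₁ ∩ K ⊆ s ∩ w := by
    obtain ⟨r₁, hr₁, h⟩ := mem_nhdsWithin_iff.1 (inter_mem hs (mem_nhdsWithin_of_mem_nhds hw))
    exact ⟨r₁, hr₁, h⟩
  have hρx₀ := hρid x₀ hx₀
  obtain ⟨a, ha, hball⟩ : ∃ a : ℝ≥0, 0 < a ∧ ∀ y ∈ closedBall x₀ a, ρ y ∈ s ∩ w := by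
    have h1 : ρ ⁻¹' (ball x₀ r₁) ∈ 𝓝 x₀ :=
      hρ.continuous.continuousAt (by rw [hρx₀]; exact ball_mem_nhds _ hr₁)
    obtain ⟨a, ha, h2⟩ := nhds_basis_closedBall.mem_iff.1 h1
    exact ⟨⟨a, ha.le⟩, ha, fun y hy => hsub ⟨h2 hy, hρK y⟩⟩
  have hlip' : LipschitzOnWith (Cf * Cρ) (f ∘ ρ) (closedBall x₀ a) :=
    hlip.comp hρ.lipschitzOnWith fun y hy => (hball y hy).1
  set L : ℝ≥0 := Cf * Cρ * a + ‖f x₀‖₊ + 1 with hL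
  have hb : ∀ x ∈ closedBall x₀ a, ‖(f ∘ ρ) x‖ ≤ L := by
    intro x hx
    have h1 := hlip'.norm_sub_le hx (mem_closedBall_self a.2)
    have h2 : ‖x - x₀‖ ≤ a := by rwa [← mem_closedBall_iff_norm]
    have h3 : (f ∘ ρ) x₀ = f x₀ := by simp [hρx₀]
    rw [h3] at h1
    have h4 := norm_le_norm_sub_add ((f ∘ ρ) x) (f x₀)
    have h5 : ((Cf * Cρ : ℝ≥0) : ℝ) * ‖x - x₀‖ ≤ (Cf * Cρ : ℝ≥0) * a := by gcongr
    simp only [hL, NNReal.coe_add, NNReal.coe_mul, coe_nnnorm, NNReal.coe_one] at *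
    linarith
  have hL0 : (0 : ℝ) < L := by
    simp only [hL, NNReal.coe_add, NNReal.coe_mul, coe_nnnorm, NNReal.coe_one]; positivity
  -- `L` bounds the field on the ball of radius `a`. In time `δ` a solution moves by at most `L * δ
  -- = a / 2`, the room left to initial points within `a / 2` of `x₀`.
  set δ : ℝ := a / (2 * L) with hδ
  have ha' : (0 : ℝ) < a := ha
  have hδ0 : 0 < δ := by positivity
  have hPL : IsPicardLindelof (fun _ => f ∘ ρ) (tmin := -δ) (tmax := δ)
      ⟨0, by constructor <;> linarith⟩ x₀ a (a / 2) L (Cf * Cρ) := by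
    refine IsPicardLindelof.of_time_independent hb hlip' ?_
    simp only [sub_zero, zero_sub, neg_neg, max_self, hδ, NNReal.coe_div, NNReal.coe_ofNat]
    field_simp
    norm_num
  obtain ⟨φ, hφ, C, hC⟩ := hPL.exists_forall_mem_closedBall_eq_hasDerivWithinAt_lipschitzOnWith
  have hx₀m : x₀ ∈ closedBall x₀ ((a / 2 : ℝ≥0) : ℝ) := mem_closedBall_self (a / 2).2
  have hcont : ∀ᶠ t in 𝓝[Icc (-δ) δ] 0, φ x₀ t ∈ ball x₀ (a / 2) := by
    have h1 := ((hφ x₀ hx₀m).2 0 (by constructor <;> linarith)).continuousWithinAt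
    refine h1 ?_
    have := (hφ x₀ hx₀m).1
    simp only at this
    rw [this]
    exact ball_mem_nhds _ (by positivity)
  obtain ⟨ε₁, hε₁, h1⟩ := mem_nhdsWithin_iff.1 hcont
  set ε := min ε₁ δ with hε
  have hε0 : 0 < ε := lt_min hε₁ hδ0
  have hεI : Ioo (-ε) ε ⊆ Icc (-δ) δ := fun t ht =>
    ⟨by linarith [ht.1, min_le_right ε₁ δ], by linarith [ht.2, min_le_right ε₁ δ]⟩
  -- Up to time `ε` the solution from `x₀` stays within `a / 2` of `x₀`. By the second bound on `r`
  -- and the Lipschitz constant `C`, the other solutions stay within `a / 2` of that one.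
  set r : ℝ := min (a / 2) (a / (2 * (C + 1))) with hr
  have hr0 : 0 < r := lt_min (by positivity) (by positivity)
  have hrsub : ball x₀ r ⊆ closedBall x₀ ((a / 2 : ℝ≥0) : ℝ) := by
    refine ball_subset_closedBall.trans (closedBall_subset_closedBall ?_)
    rw [NNReal.coe_div, NNReal.coe_ofNat]
    exact min_le_left _ _
  have hderiv : ∀ x ∈ ball x₀ r, ∀ t ∈ Ioo (-ε) ε, HasDerivAt (φ x) (f (ρ (φ x t))) t := by
    intro x hx t ht
    refine ((hφ x (hrsub hx)).2 t (hεI ht)).hasDerivAt (Icc_mem_nhds ?_ ?_)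
    · linarith [ht.1, min_le_right ε₁ δ]
    · linarith [ht.2, min_le_right ε₁ δ]
  have hin : ∀ x ∈ ball x₀ r, ∀ t ∈ Ioo (-ε) ε, φ x t ∈ closedBall x₀ a := by
    intro x hx t ht
    have h2 : φ x₀ t ∈ ball x₀ (a / 2) := h1 ⟨by
      rw [mem_ball, Real.dist_eq, sub_zero, abs_lt]
      exact ⟨by linarith [ht.1, min_le_left ε₁ δ], by linarith [ht.2, min_le_left ε₁ δ]⟩, hεI ht⟩
    have h3 := (hC t (hεI ht)).dist_le_mul x (hrsub hx) x₀ hx₀m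
    have h4 : dist x x₀ ≤ a / (2 * (C + 1)) := (mem_ball.1 hx).le.trans (min_le_right _ _)
    have h5 : (C : ℝ) * dist x x₀ ≤ a / 2 := by
      calc (C : ℝ) * dist x x₀ ≤ (C + 1) * (a / (2 * (C + 1))) := by gcongr; linarith
        _ = a / 2 := by field_simp
    rw [mem_closedBall]
    have h6 := dist_triangle (φ x t) (φ x₀ t) x₀
    have h7 := mem_ball.1 h2
    linarith
  -- Where `l (φ x t) < 0`, the point `ρ (φ x t)` lies on the boundary, so by tangency the
  -- derivative of `l (φ x t)` vanishes.
  have hK : ∀ x ∈ K ∩ ball x₀ r, ∀ t ∈ Ioo (-ε) ε, φ x t ∈ K := by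
    intro x hx
    rcases hρl with rfl | ⟨l, rfl, ht⟩
    · exact fun _ _ => trivial
    · refine nonneg_of_deriv_eq_zero (u := fun t => l (φ x t)) (t₀ := (0 : ℝ))
        ⟨by linarith, hε0⟩ ?_
        (fun t ht => l.hasFDerivAt.comp_hasDerivAt t (hderiv x hx.2 t ht))
        fun t htt hneg => ht _ (hball _ (hin x hx.2 t htt)).2 hneg
      have := (hφ x (hrsub hx.2)).1
      simp only at this
      simpa [this] using hx.1
  refine ⟨r, hr0, ε, hε0, φ, fun x hx => ⟨(hφ x (hrsub hx.2)).1, fun t ht => ⟨⟨hK x hx t ht, ?_⟩, ?_⟩⟩,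
    C, fun t ht => (hC t (hεI ht)).mono (inter_subset_right.trans hrsub)⟩
  · have := (hball _ (hin x hx.2 t ht)).2
    rwa [hρid _ (hK x hx t ht)] at this
  · have := hderiv x hx.2 t ht
    rwa [hρid _ (hK x hx t ht)] at this

/-- Grönwall's inequality, weakened to a bound linear in `c` with a factor independent of `t`. In
the application `c` is quadratic in the displacement of the initial point. -/
theorem norm_le_of_norm_deriv_le_forward {η η' : ℝ → E} {L c ε : ℝ} (hL : 0 < L) (hc : 0 ≤ c)
    (hη : ∀ t ∈ Ioo (-ε) ε, HasDerivAt η (η' t) t) (h0 : η 0 = 0)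
    (hb : ∀ t ∈ Ioo (-ε) ε, ‖η' t‖ ≤ L * ‖η t‖ + c) {t : ℝ} (ht : t ∈ Ico 0 ε) :
    ‖η t‖ ≤ c * (Real.exp (L * ε) / L) := by
  have hsub : Icc 0 t ⊆ Ioo (-ε) ε := fun s hs => ⟨by linarith [hs.1, ht.1, ht.2], by
    linarith [hs.2, ht.2]⟩
  have h1 := norm_le_gronwallBound_of_norm_deriv_right_le (δ := 0) (K := L) (ε := c)
    (fun s hs => (hη s (hsub hs)).continuousAt.continuousWithinAt)
    (fun s hs => (hη s (hsub (Ico_subset_Icc_self hs))).hasDerivWithinAt) (by simp [h0])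
    (fun s hs => hb s (hsub (Ico_subset_Icc_self hs))) t ⟨ht.1, le_rfl⟩
  rw [gronwallBound_of_K_ne_0 hL.ne'] at h1
  simp only [zero_mul, zero_add, sub_zero] at h1
  have h2 : Real.exp (L * t) ≤ Real.exp (L * ε) :=
    Real.exp_le_exp.2 (mul_le_mul_of_nonneg_left ht.2.le hL.le)
  calc ‖η t‖ ≤ c / L * (Real.exp (L * t) - 1) := h1
    _ ≤ c / L * Real.exp (L * ε) := by gcongr; linarith
    _ = c * (Real.exp (L * ε) / L) := by ring

theorem norm_le_of_norm_deriv_le {η η' : ℝ → E} {L c ε : ℝ} (hL : 0 < L) (hc : 0 ≤ c)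
    (hη : ∀ t ∈ Ioo (-ε) ε, HasDerivAt η (η' t) t) (h0 : η 0 = 0)
    (hb : ∀ t ∈ Ioo (-ε) ε, ‖η' t‖ ≤ L * ‖η t‖ + c) {t : ℝ} (ht : t ∈ Ioo (-ε) ε) :
    ‖η t‖ ≤ c * (Real.exp (L * ε) / L) := by
  rcases le_total 0 t with h | h
  · exact norm_le_of_norm_deriv_le_forward hL hc hη h0 hb ⟨h, ht.2⟩
  · have hneg : ∀ s ∈ Ioo (-ε) ε, -s ∈ Ioo (-ε) ε := fun s hs =>
      ⟨by linarith [hs.2], by linarith [hs.1]⟩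
    have := norm_le_of_norm_deriv_le_forward (η := fun s => η (-s)) (η' := fun s => -η' (-s)) hL hc
      (fun s hs => by
        simpa [Function.comp_def] using (hη (-s) (hneg s hs)).scomp s (hasDerivAt_neg s))
      (by simpa using h0) (fun s hs => by simpa using hb (-s) (hneg s hs)) (t := -t)
      ⟨by linarith, by linarith [ht.1]⟩
    simpa using this

/-- The solutions of the variational equation are the derivatives of a Lipschitz local flow with
respect to the initial point. -/
theorem hasFDerivWithinAt_flow {S U : Set E} {D : E → E →L[ℝ] E} {φ : E → ℝ → E}
    {Y : E → ℝ → E →L[ℝ] E} {M C : ℝ≥0} {L ε : ℝ} (hS : Convex ℝ S)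
    (hD : ∀ y ∈ S, HasFDerivWithinAt f (D y) S y) (hM : LipschitzOnWith M D S)
    (hL : ∀ y ∈ S, ‖D y‖ ≤ L) (hφ0 : ∀ x ∈ U, φ x 0 = x)
    (hφ : ∀ x ∈ U, ∀ t ∈ Ioo (-ε) ε, φ x t ∈ S ∧ HasDerivAt (φ x) (f (φ x t)) t)
    (hC : ∀ t ∈ Ioo (-ε) ε, LipschitzOnWith C (fun x => φ x t) U)
    (hY0 : ∀ x ∈ U, Y x 0 = ContinuousLinearMap.id ℝ E)
    (hY : ∀ x ∈ U, ∀ t ∈ Ioo (-ε) ε, HasDerivAt (Y x) ((D (φ x t)).comp (Y x t)) t)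
    {x : E} (hx : x ∈ U) {t : ℝ} (ht : t ∈ Ioo (-ε) ε) :
    HasFDerivWithinAt (fun x => φ x t) (Y x t) U x := by
  -- Taylor's estimate: on the part of `S` within `‖b - a‖` of `a`, the Lipschitz map `D` differs
  -- from `D a` by at most `M * ‖b - a‖`.
  have hquad : ∀ a ∈ S, ∀ b ∈ S, ‖f b - f a - D a (b - a)‖ ≤ M * ‖b - a‖ ^ 2 := by
    intro a ha b hb
    have hconv : Convex ℝ (S ∩ closedBall a ‖b - a‖) := hS.inter (convex_closedBall _ _)
    have := hconv.norm_image_sub_le_of_norm_hasFDerivWithin_le' (f := f) (f' := D) (φ := D a)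
      (C := M * ‖b - a‖) (fun y hy => (hD y hy.1).mono inter_subset_left)
      (fun y hy => (hM.norm_sub_le hy.1 ha).trans (by
        gcongr; rw [← mem_closedBall_iff_norm]; exact hy.2))
      ⟨ha, mem_closedBall_self (norm_nonneg _)⟩ ⟨hb, by rw [mem_closedBall, dist_eq_norm]⟩
    calc _ ≤ _ := this
      _ = _ := by ring
  -- The error `η = φ x' - φ x - Y x (x' - x)` satisfies `η' = D η + R` with `η 0 = 0`, where `R` is
  -- quadratic in `x' - x` by `hquad`. Grönwall's inequality makes `η` quadratic as well.
  have hmain : ∀ x' ∈ U, ‖φ x' t - φ x t - Y x t (x' - x)‖ ≤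
      (M * C ^ 2 * (Real.exp ((|L| + 1) * ε) / (|L| + 1))) * ‖x' - x‖ ^ 2 := by
    intro x' hx'
    have := norm_le_of_norm_deriv_le (η := fun t => φ x' t - φ x t - Y x t (x' - x))
      (η' := fun t => f (φ x' t) - f (φ x t) - (D (φ x t)) (Y x t (x' - x)))
      (L := |L| + 1) (c := M * (C * ‖x' - x‖) ^ 2) (ε := ε) (by positivity) (by positivity) ?_ ?_ ?_ ht
    · calc _ ≤ _ := this
        _ = _ := by ring
    · intro s hs
      have h1 := ((hφ x' hx' s hs).2.sub (hφ x hx s hs).2).sub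
        ((hY x hx s hs).clm_apply (hasDerivAt_const s (x' - x)))
      refine h1.congr_deriv ?_
      simp
    · simp [hφ0 x hx, hφ0 x' hx', hY0 x hx]
    · intro s hs
      have h1 := hquad _ (hφ x hx s hs).1 _ (hφ x' hx' s hs).1
      have h2 := (hC s hs).norm_sub_le hx' hx
      have h3 : f (φ x' s) - f (φ x s) - (D (φ x s)) (Y x s (x' - x)) =
          D (φ x s) (φ x' s - φ x s - Y x s (x' - x)) +
          (f (φ x' s) - f (φ x s) - D (φ x s) (φ x' s - φ x s)) := by
        simp only [map_sub]; abel
      rw [h3]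
      refine (norm_add_le _ _).trans (add_le_add ?_ (h1.trans ?_))
      · refine (ContinuousLinearMap.le_opNorm _ _).trans ?_
        gcongr
        exact ((hL _ (hφ x hx s hs).1).trans (le_abs_self L)).trans (by linarith)
      · gcongr
  rw [hasFDerivWithinAt_iff_isLittleO]
  refine (Asymptotics.IsBigO.of_bound (g := fun x' => ‖x' - x‖ ^ 2)
    (M * C ^ 2 * (Real.exp ((|L| + 1) * ε) / (|L| + 1))) ?_).trans_isLittleO ?_
  · filter_upwards [self_mem_nhdsWithin] with x' hx'
    simpa using hmain x' hx'
  · refine Asymptotics.IsLittleO.mono ?_ nhdsWithin_le_nhds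
    have h1 : (fun v : E => ‖v‖ ^ 2) =o[𝓝 0] fun v => v :=
      Asymptotics.isLittleO_norm_pow_id (by norm_num)
    have h2 : Tendsto (fun x' => x' - x) (𝓝 x) (𝓝 0) := by
      simpa using (continuous_id.sub continuous_const).tendsto (f := fun x' : E => x' - x) x
    exact h1.comp_tendsto h2

/-- A local flow that is jointly continuous and differentiable in the initial point is jointly
differentiable. -/
theorem hasFDerivWithinAt_flow_uncurry {U : Set E} {φ : E → ℝ → E} {T : E →L[ℝ] E} {ε : ℝ}
    (hφ : ∀ x ∈ U, ∀ t ∈ Ioo (-ε) ε, HasDerivAt (φ x) (f (φ x t)) t)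
    (hc : ContinuousOn (fun q : E × ℝ => f (φ q.1 q.2)) (U ×ˢ Ioo (-ε) ε))
    {x : E} (hx : x ∈ U) {t : ℝ} (ht : t ∈ Ioo (-ε) ε)
    (hT : HasFDerivWithinAt (fun x => φ x t) T U x) :
    HasFDerivWithinAt (fun q : E × ℝ => φ q.1 q.2)
      (T.coprod (ContinuousLinearMap.toSpanSingleton ℝ (f (φ x t)))) (U ×ˢ Ioo (-ε) ε) (x, t) := by
  have h1 : HasFDerivWithinAt (fun q : E × ℝ => φ q.1 t)
      (T.comp (ContinuousLinearMap.fst ℝ E ℝ)) (U ×ˢ Ioo (-ε) ε) (x, t) :=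
    HasFDerivWithinAt.comp (x, t) (f := Prod.fst) hT hasFDerivWithinAt_fst fun q hq => hq.1
  -- The increment is split into one in the initial point at fixed time and one in time. The latter
  -- is handled by the mean value inequality in `t`, uniformly in the initial point because `f ∘ φ`
  -- is jointly continuous.
  have h2 : HasFDerivWithinAt (fun q : E × ℝ => φ q.1 q.2 - φ q.1 t)
      ((ContinuousLinearMap.toSpanSingleton ℝ (f (φ x t))).comp (ContinuousLinearMap.snd ℝ E ℝ))
      (U ×ˢ Ioo (-ε) ε) (x, t) := by
    rw [hasFDerivWithinAt_iff_isLittleO, Asymptotics.isLittleO_iff]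
    intro c hc0
    have h3 := (hc (x, t) ⟨hx, ht⟩).eventually (ball_mem_nhds _ hc0)
    obtain ⟨δ, hδ, h4⟩ := mem_nhdsWithin_iff.1 h3
    filter_upwards [inter_mem_nhdsWithin _ (ball_mem_nhds (x, t) hδ)] with q hq
    have h5 : dist q.1 x < δ ∧ dist q.2 t < δ := by
      have := mem_ball.1 hq.2
      rwa [Prod.dist_eq, max_lt_iff] at this
    have hconv : Convex ℝ (Ioo (-ε) ε ∩ ball t δ) := (convex_Ioo _ _).inter (convex_ball _ _)
    have h6 := hconv.norm_image_sub_le_of_norm_hasFDerivWithin_le' (f := φ q.1)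
      (f' := fun s => ContinuousLinearMap.toSpanSingleton ℝ (f (φ q.1 s)))
      (φ := ContinuousLinearMap.toSpanSingleton ℝ (f (φ x t)))
      (C := c) (fun s hs => (hφ q.1 hq.1.1 s hs.1).hasFDerivAt.hasFDerivWithinAt)
      (fun s hs => by
        have h7 := h4 (show (q.1, s) ∈ _ from ⟨by
          rw [mem_ball, Prod.dist_eq, max_lt_iff]; exact ⟨h5.1, hs.2⟩, hq.1.1, hs.1⟩)
        have h8 : ContinuousLinearMap.toSpanSingleton ℝ (f (φ q.1 s)) -
            ContinuousLinearMap.toSpanSingleton ℝ (f (φ x t)) =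
            ContinuousLinearMap.toSpanSingleton ℝ (f (φ q.1 s) - f (φ x t)) := by
          ext; simp
        rw [h8, ContinuousLinearMap.norm_toSpanSingleton, ← dist_eq_norm]
        exact (mem_ball.1 h7).le)
      (x := t) (y := q.2) ⟨ht, mem_ball_self hδ⟩ ⟨hq.1.2, h5.2⟩
    have h8 : ‖q.2 - t‖ ≤ ‖q - (x, t)‖ := norm_snd_le (q - (x, t))
    simp only [sub_self, sub_zero, ContinuousLinearMap.comp_apply, ContinuousLinearMap.coe_snd']
    exact h6.trans (by gcongr)
  have h3 := h1.add h2
  refine (h3.congr_fderiv ?_).congr_of_eventuallyEq ?_ ?_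
  · ext <;> simp
  · exact Eventually.of_forall fun q => by simp
  · simp

/-- Smooth local flows on half-spaces: for every `n` a smooth vector field on a half-space that is
tangent to the boundary has a local flow of class `C^n`. -/
theorem exists_contDiff_flow (n : ℕ) : ∀ {E : Type u} [NormedAddCommGroup E] [NormedSpace ℝ E]
    [CompleteSpace E] {K w : Set E} {f : E → E} {x₀ : E}, TangentOn K w f → x₀ ∈ K → w ∈ 𝓝 x₀ →
    ContDiffOn ℝ ∞ f (K ∩ w) →
    ∃ r > 0, ∃ ε > 0, ∃ φ : E → ℝ → E,
      (∀ x ∈ K ∩ ball x₀ r, φ x 0 = x ∧ ∀ t ∈ Ioo (-ε) ε, φ x t ∈ K ∩ w ∧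
        HasDerivAt (φ x) (f (φ x t)) t) ∧
      (∃ C : ℝ≥0, ∀ t ∈ Ioo (-ε) ε, LipschitzOnWith C (fun x => φ x t) (K ∩ ball x₀ r)) ∧
      ContDiffOn ℝ n (fun q : E × ℝ => φ q.1 q.2) ((K ∩ ball x₀ r) ×ˢ Ioo (-ε) ε) := by
  induction n with
  | zero =>
    intro E _ _ _ K w f x₀ hT hx₀ hw hf
    have hf1 : ContDiffWithinAt ℝ 1 f K x₀ := by
      have := (hf x₀ ⟨hx₀, mem_of_mem_nhds hw⟩).of_le (m := 1) (by exact_mod_cast le_top)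
      rwa [contDiffWithinAt_inter hw] at this
    obtain ⟨r, hr, ε, hε, φ, hφ, C, hC⟩ := exists_lipschitz_flow hT hx₀ hw hf1
    refine ⟨r, hr, ε, hε, φ, hφ, ⟨C, hC⟩, ?_⟩
    simp only [Nat.cast_zero, contDiffOn_zero]
    exact continuousOn_prod_of_continuousOn_lipschitzOnWith _ C
      (fun x hx t ht => ((hφ x hx).2 t ht).2.continuousAt.continuousWithinAt) hC
  | succ n ih =>
    intro E _ _ _ K w f x₀ hT hx₀ hw hf
    set D : E → E →L[ℝ] E := fderivWithin ℝ f (K ∩ interior w) with hDdef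
    have hK := hT.uniqueDiffOn
    have hU : UniqueDiffOn ℝ (K ∩ interior w) := hK.inter isOpen_interior
    have hf' : ContDiffOn ℝ ∞ f (K ∩ interior w) :=
      hf.mono (inter_subset_inter_right _ interior_subset)
    have hDs : ContDiffOn ℝ ∞ D (K ∩ interior w) :=
      hf'.fderivWithin hU (by norm_cast)
    have hxw : x₀ ∈ interior w := mem_interior_iff_mem_nhds.2 hw
    have hD1 : ContDiffWithinAt ℝ 1 D K x₀ := by
      have := (hDs x₀ ⟨hx₀, hxw⟩).of_le (m := 1) (by exact_mod_cast le_top)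
      rwa [contDiffWithinAt_inter (isOpen_interior.mem_nhds hxw)] at this
    obtain ⟨M, s, hs, hlip⟩ := hD1.exists_lipschitzOnWith hT.convex
    obtain ⟨a, ha, hsub⟩ : ∃ a > 0, ball x₀ a ∩ K ⊆ s ∩ interior w :=
      mem_nhdsWithin_iff.1 (inter_mem hs
        (mem_nhdsWithin_of_mem_nhds (isOpen_interior.mem_nhds hxw)))
    have hsub1 : K ∩ ball x₀ a ⊆ s := fun y hy => (hsub ⟨hy.2, hy.1⟩).1
    have hsub2 : K ∩ ball x₀ a ⊆ K ∩ interior w := fun y hy => ⟨hy.1, (hsub ⟨hy.2, hy.1⟩).2⟩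
    have haw : K ∩ ball x₀ a ⊆ K ∩ w := hsub2.trans (inter_subset_inter_right _ interior_subset)
    have hT' : TangentOn K (ball x₀ a) f := by
      rcases hT with h | ⟨l, e, he, hK, ht⟩
      · exact .inl h
      · exact .inr ⟨l, e, he, hK, fun y hy => ht y (haw hy)⟩
    have hsm : ContDiffOn ℝ ∞ (fun q : E × (E →L[ℝ] E) => (f q.1, (D q.1).comp q.2))
        (K ×ˢ univ ∩ ball x₀ a ×ˢ univ) := by
      have hm : MapsTo (Prod.fst : E × (E →L[ℝ] E) → E) (K ×ˢ univ ∩ ball x₀ a ×ˢ univ)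
          (K ∩ interior w) := fun q hq => hsub2 ⟨hq.1.1, hq.2.1⟩
      exact (hf'.comp contDiffOn_fst hm).prodMk
        ((hDs.comp contDiffOn_fst hm).clm_comp contDiffOn_snd)
    -- The induction hypothesis is applied to the equation coupled with its variational equation, on
    -- `E × (E →L[ℝ] E)`, with initial values `(x, id)`; hence the quantification over `E` inside
    -- the induction. The coupled field is again tangent to the boundary.
    obtain ⟨r, hr, ε, hε, Φ, hΦ, ⟨C, hC⟩, hΦs⟩ := ih (x₀ := (x₀, ContinuousLinearMap.id ℝ E))
      (hT'.prod fun q => (D q.1).comp q.2) ⟨hx₀, trivial⟩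
      (prod_mem_nhds (ball_mem_nhds _ ha) univ_mem) hsm
    have hι : ∀ x ∈ K ∩ ball x₀ r, (x, ContinuousLinearMap.id ℝ E) ∈
        (K ×ˢ univ) ∩ ball (x₀, ContinuousLinearMap.id ℝ E) r := by
      intro x hx
      refine ⟨⟨hx.1, trivial⟩, ?_⟩
      rw [mem_ball, Prod.dist_eq, dist_self, max_eq_left dist_nonneg]
      exact hx.2
    set φ : E → ℝ → E := fun x t => (Φ (x, ContinuousLinearMap.id ℝ E) t).1 with hφdef
    set Y : E → ℝ → E →L[ℝ] E := fun x t => (Φ (x, ContinuousLinearMap.id ℝ E) t).2 with hYdef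
    have hφ : ∀ x ∈ K ∩ ball x₀ r, φ x 0 = x ∧ ∀ t ∈ Ioo (-ε) ε, φ x t ∈ K ∩ ball x₀ a ∧
        HasDerivAt (φ x) (f (φ x t)) t := by
      intro x hx
      obtain ⟨h1, h2⟩ := hΦ _ (hι x hx)
      refine ⟨by simp [hφdef, h1], fun t ht => ⟨⟨(h2 t ht).1.1.1, (h2 t ht).1.2.1⟩, ?_⟩⟩
      exact (ContinuousLinearMap.fst ℝ E (E →L[ℝ] E)).hasFDerivAt.comp_hasDerivAt t (h2 t ht).2
    have hY : ∀ x ∈ K ∩ ball x₀ r, Y x 0 = ContinuousLinearMap.id ℝ E ∧ ∀ t ∈ Ioo (-ε) ε,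
        HasDerivAt (Y x) ((D (φ x t)).comp (Y x t)) t := by
      intro x hx
      obtain ⟨h1, h2⟩ := hΦ _ (hι x hx)
      refine ⟨by simp [hYdef, h1], fun t ht => ?_⟩
      exact (ContinuousLinearMap.snd ℝ E (E →L[ℝ] E)).hasFDerivAt.comp_hasDerivAt t (h2 t ht).2
    have hlipφ : ∀ t ∈ Ioo (-ε) ε, LipschitzOnWith C (fun x => φ x t) (K ∩ ball x₀ r) := by
      intro t ht
      refine LipschitzOnWith.of_dist_le_mul fun x hx x' hx' => ?_
      have h1 := (hC t ht).dist_le_mul _ (hι x hx) _ (hι x' hx')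
      rw [Prod.dist_eq (x := (x, _)), dist_self, max_eq_left dist_nonneg] at h1
      refine le_trans ?_ h1
      rw [Prod.dist_eq]
      exact le_max_left _ _
    have hmapι : MapsTo (fun q : E × ℝ => ((q.1, ContinuousLinearMap.id ℝ E), q.2))
        ((K ∩ ball x₀ r) ×ˢ Ioo (-ε) ε)
        (((K ×ˢ univ) ∩ ball (x₀, ContinuousLinearMap.id ℝ E) r) ×ˢ Ioo (-ε) ε) :=
      fun q hq => ⟨hι _ hq.1, hq.2⟩
    have hΦι : ContDiffOn ℝ n (fun q : E × ℝ => Φ (q.1, ContinuousLinearMap.id ℝ E) q.2)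
        ((K ∩ ball x₀ r) ×ˢ Ioo (-ε) ε) :=
      hΦs.comp ((contDiffOn_fst.prodMk contDiffOn_const).prodMk contDiffOn_snd) hmapι
    have hφs : ContDiffOn ℝ n (fun q : E × ℝ => φ q.1 q.2) ((K ∩ ball x₀ r) ×ˢ Ioo (-ε) ε) :=
      hΦι.fst
    have hYs : ContDiffOn ℝ n (fun q : E × ℝ => Y q.1 q.2) ((K ∩ ball x₀ r) ×ˢ Ioo (-ε) ε) :=
      hΦι.snd
    have hfφ : ContDiffOn ℝ n (fun q : E × ℝ => f (φ q.1 q.2)) ((K ∩ ball x₀ r) ×ˢ Ioo (-ε) ε) :=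
      (hf'.of_le (by exact_mod_cast le_top)).comp hφs
        fun q hq => hsub2 (((hφ q.1 hq.1).2 q.2 hq.2).1)
    have hbound : ∀ y ∈ K ∩ ball x₀ a, ‖D y‖ ≤ ‖D x₀‖ + M * a := by
      intro y hy
      have h1 := hlip.norm_sub_le (hsub1 hy) (hsub1 ⟨hx₀, mem_ball_self ha⟩)
      have h2 : ‖y - x₀‖ ≤ a := by rw [← dist_eq_norm]; exact (mem_ball.1 hy.2).le
      have h3 := norm_le_norm_add_norm_sub' (D y) (D x₀)
      have h4 : (M : ℝ) * ‖y - x₀‖ ≤ M * a := by gcongr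
      linarith
    refine ⟨r, hr, ε, hε, φ, fun x hx => ⟨(hφ x hx).1, fun t ht =>
      ⟨haw ((hφ x hx).2 t ht).1, ((hφ x hx).2 t ht).2⟩⟩, ⟨C, hlipφ⟩, ?_⟩
    have hud : UniqueDiffOn ℝ ((K ∩ ball x₀ r) ×ˢ Ioo (-ε) ε) :=
      (hK.inter isOpen_ball).prod (uniqueDiffOn_Ioo _ _)
    push_cast
    rw [contDiffOn_succ_iff_hasFDerivWithinAt_of_uniqueDiffOn hud]
    -- The derivative of the flow is assembled from `Y` and `f ∘ φ`, both already `C^n`; so the flow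
    -- is `C^(n+1)`.
    refine ⟨fun h => absurd h (by simp), fun q => (Y q.1 q.2).coprod
      (ContinuousLinearMap.toSpanSingleton ℝ (f (φ q.1 q.2))), ?_, ?_⟩
    · have h1 : ContDiffOn ℝ n (fun q : E × ℝ => (Y q.1 q.2).comp (ContinuousLinearMap.fst ℝ E ℝ) +
          ((ContinuousLinearMap.smulRightL ℝ ℝ E 1) (f (φ q.1 q.2))).comp
            (ContinuousLinearMap.snd ℝ E ℝ)) ((K ∩ ball x₀ r) ×ˢ Ioo (-ε) ε) :=
        (hYs.clm_comp contDiffOn_const).add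
          (((ContinuousLinearMap.contDiff _).comp_contDiffOn hfφ).clm_comp contDiffOn_const)
      refine h1.congr fun q _ => ?_
      ext <;> simp
    · rintro ⟨x, t⟩ hq
      refine hasFDerivWithinAt_flow_uncurry (fun x hx t ht => ((hφ x hx).2 t ht).2)
        hfφ.continuousOn hq.1 hq.2 ?_
      refine hasFDerivWithinAt_flow (f := f) (S := K ∩ ball x₀ a) (D := D) (M := M)
        (hT.convex.inter (convex_ball _ _))
        (fun y hy => ?_) (hlip.mono hsub1) hbound (fun x hx => (hφ x hx).1) (fun x hx => (hφ x hx).2)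
        hlipφ (fun x hx => (hY x hx).1) (fun x hx => (hY x hx).2) hq.1 hq.2
      exact ((hf' y (hsub2 hy)).differentiableWithinAt (by simp)).hasFDerivWithinAt.mono hsub2

end HalfSpaceODE

/-! ### Flows of tangent vector fields on manifolds with boundary -/

section ManifoldFlow

open Metric Filter
open scoped NNReal

variable {E : Type u} [NormedAddCommGroup E] [NormedSpace ℝ E]
  {H : Type v} [TopologicalSpace H] {I : ModelWithCorners ℝ E H}
  {M : Type w} [TopologicalSpace M] [ChartedSpace H M] [IsManifold I ∞ M]
  {F : ∀ p : M, TangentSpace I p}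

/-- The vector field `F` in the chart at `p`. -/
def chartField (F : ∀ p : M, TangentSpace I p) (p : M) (u : E) : E :=
  tangentCoordChange I ((extChartAt I p).symm u) p ((extChartAt I p).symm u)
    (F ((extChartAt I p).symm u))

theorem chartField_extChartAt {p q : M} (hq : q ∈ (extChartAt I p).source) :
    chartField F p (extChartAt I p q) = tangentCoordChange I q p q (F q) := by
  rw [chartField, (extChartAt I p).left_inv hq]

theorem chartField_self (p : M) : chartField F p (extChartAt I p p) = F p := by
  rw [chartField_extChartAt (mem_extChartAt_source p)]
  exact tangentCoordChange_self (mem_extChartAt_source p)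

theorem IsSmoothField.contDiffOn_chartField (hF : IsSmoothField I F) (p : M) :
    ContDiffOn ℝ ∞ (chartField F p) (extChartAt I p).target := by
  have h := ((contMDiff_iff.1 hF.smooth).2 p (⟨p, F p⟩ : TangentBundle I M)).snd
  refine h.mono fun u hu => ⟨hu, ?_⟩
  have hs := (extChartAt I p).map_target hu
  simpa [mfld_simps] using hs

theorem lt_of_mem_interior_halfSpace {l : E →L[ℝ] ℝ} (hl : l ≠ 0) {u : E}
    (hu : u ∈ interior {y | 0 ≤ l y}) : 0 < l u := by
  obtain ⟨e, he⟩ : ∃ e, l e ≠ 0 := by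
    by_contra h
    push Not at h
    exact hl (ContinuousLinearMap.ext h)
  have h0 : 0 ≤ l u := interior_subset (s := {y | 0 ≤ l y}) hu
  refine lt_of_le_of_ne h0 fun h => ?_
  have hc : Tendsto (fun s : ℝ => u - (s * l e) • e) (𝓝 0) (𝓝 u) := by
    have : Continuous fun s : ℝ => u - (s * l e) • e := by fun_prop
    simpa using this.tendsto 0
  have h1 : ∀ᶠ s in 𝓝[>] (0 : ℝ), 0 ≤ l (u - (s * l e) • e) :=
    ((hc.eventually (isOpen_interior.mem_nhds hu)).mono fun s hs =>
      interior_subset (s := {y | 0 ≤ l y}) hs).filter_mono nhdsWithin_le_nhds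
  obtain ⟨s, hs, hs0⟩ := (h1.and self_mem_nhdsWithin).exists
  simp only [map_sub, map_smul, smul_eq_mul, ← h] at hs
  have : 0 < s * (l e * l e) := mul_pos hs0 (mul_self_pos.2 he)
  nlinarith

theorem mem_interior_halfSpace {l : E →L[ℝ] ℝ} {u : E} (hu : 0 < l u) :
    u ∈ interior {y | 0 ≤ l y} :=
  mem_interior.2 ⟨{y | 0 < l y}, fun _ hy => (show (0 : ℝ) < _ from hy).le,
    isOpen_lt continuous_const l.continuous, hu⟩

/-- In every chart a smooth field is tangent to the boundary. -/
theorem IsSmoothField.apply_chartField_eq_zero (hF : IsSmoothField I F) {l : E →L[ℝ] ℝ}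
    (hl : l ≠ 0) (hI : range I = {y | 0 ≤ l y}) (p : M) {u : E} (hu : u ∈ (extChartAt I p).target)
    (hu0 : l u = 0) : l (chartField F p u) = 0 := by
  set q := (extChartAt I p).symm u with hq
  have hqs : q ∈ (extChartAt I p).source := (extChartAt I p).map_target hu
  have hqu : extChartAt I p q = u := (extChartAt I p).right_inv hu
  have hqb : q ∈ I.boundary M := by
    rw [← I.compl_interior]
    intro hint
    have h1 := (I.isInteriorPoint_iff_of_mem_atlas (n := ∞) (by simp) (chart_mem_atlas H p)
      (by simpa using hqs)).1 hint
    have h2 : u ∈ interior (range I) := by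
      rw [← hqu]
      exact interior_mono (extChartAt_target_subset_range p) h1
    rw [hI] at h2
    exact (lt_of_mem_interior_halfSpace hl h2).ne' hu0
  have hFq := hF.tangent q hqb l hI
  have hq0 : l (extChartAt I q q) = 0 := by
    have h1 : extChartAt I q q ∈ range I := extChartAt_target_subset_range q (mem_extChartAt_target q)
    rw [hI] at h1
    by_contra h2
    have h3 : extChartAt I q q ∈ interior (range I) := by
      rw [hI]
      exact mem_interior_halfSpace (lt_of_le_of_ne h1 (Ne.symm h2))
    rw [← I.compl_interior] at hqb
    exact hqb h3
  obtain ⟨v, hv⟩ : ∃ v : E, v = F q := ⟨_, rfl⟩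
  have hlv : l v = 0 := by rw [hv]; exact hFq
  have hcv : chartField F p u = tangentCoordChange I q p q v := by rw [hv]; rfl
  -- Tangency is assumed only in the preferred chart at `q`. There the line through `q` in direction
  -- `F q` lies in the boundary hyperplane. Seen in the chart at `p`, `l` is nonnegative along its
  -- image and zero at `s = 0`, so its derivative vanishes at this minimum.
  have hcurve : ∀ s : ℝ, extChartAt I q q + s • v ∈ range I := by
    intro s
    rw [hI]
    simp only [mem_ofPred_eq, map_add, map_smul, hq0, hlv, smul_zero, add_zero]
    exact le_rfl
  have hder := hasFDerivWithinAt_tangentCoordChange (I := I) (x := q) (y := p) (z := q)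
    ⟨mem_extChartAt_source q, hqs⟩
  have hd : HasDerivAt (fun s : ℝ => l ((extChartAt I p ∘ (extChartAt I q).symm)
      (extChartAt I q q + s • v))) (l (chartField F p u)) 0 := by
    have h1 : HasDerivAt (fun s : ℝ => extChartAt I q q + s • v) v 0 := by
      simpa using ((hasDerivAt_id (0 : ℝ)).smul_const v).const_add (extChartAt I q q)
    have h2 := HasFDerivWithinAt.comp_hasDerivWithinAt_of_eq (x := (0 : ℝ)) (s := univ)
      (f := fun s : ℝ => extChartAt I q q + s • v) hder h1.hasDerivWithinAt
      (fun s _ => hcurve s) (by simp)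
    rw [hasDerivWithinAt_univ, ← hcv] at h2
    exact l.hasFDerivAt.comp_hasDerivAt 0 h2
  refine IsLocalMin.hasDerivAt_eq_zero (f := fun s : ℝ => l ((extChartAt I p ∘
    (extChartAt I q).symm) (extChartAt I q q + s • v))) ?_ hd
  refine Eventually.of_forall fun s => ?_
  simp only [Function.comp_apply, zero_smul, add_zero, (extChartAt I q).left_inv
    (mem_extChartAt_source q), hqu, hu0]
  have h1 : extChartAt I p ((extChartAt I q).symm (extChartAt I q q + s • v)) ∈ range I := 
    mem_range_self _
  rw [hI] at h1
  exact h1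

theorem IsSmoothField.tangentOn (hF : IsSmoothField I F) (hI : IsBoundaryModel I) (p : M)
    {w : Set E} (hw : range I ∩ w ⊆ (extChartAt I p).target) :
    TangentOn (range I) w (chartField F p) := by
  rcases hI with h | ⟨l, hl, h⟩
  · exact .inl h
  · obtain ⟨e, he⟩ : ∃ e, l e ≠ 0 := by
      by_contra h
      push Not at h
      exact hl (ContinuousLinearMap.ext h)
    refine .inr ⟨l, (l e)⁻¹ • e, by simp [he], h, fun y hy h0 => ?_⟩
    exact hF.apply_chartField_eq_zero hl h p (hw hy) h0

/-- A solution of the differential equation in a chart is an integral curve. -/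
theorem hasMFDerivAt_extChartAt_symm_comp {p : M} {c : ℝ → E} {t : ℝ}
    (hc : HasDerivAt c (chartField F p (c t)) t)
    (hct : ∀ᶠ s in 𝓝 t, c s ∈ (extChartAt I p).target) :
    HasMFDerivAt 𝓘(ℝ, ℝ) I ((extChartAt I p).symm ∘ c) t
      ((1 : ℝ →L[ℝ] ℝ).smulRight (F ((extChartAt I p).symm (c t)))) := by
  set xt : M := (extChartAt I p).symm (c t) with hxt
  have hf3 := hct.self_of_nhds
  have hft1 : xt ∈ (extChartAt I p).source := (extChartAt I p).map_target hf3
  have hft2 := mem_extChartAt_source (I := I) xt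
  suffices key : HasDerivAt (F := E) ((extChartAt I xt ∘ (extChartAt I p).symm) ∘ c) (F xt) t by
    refine ⟨(continuousAt_extChartAt_symm'' hf3).comp hc.continuousAt, ?_⟩
    have h2 := HasDerivWithinAt.hasFDerivWithinAt (F := E) (key.hasDerivWithinAt (s := univ))
    simp only [mfld_simps]
    exact h2
  have hval : tangentCoordChange I p xt xt (chartField F p (c t)) = F xt :=
    (tangentCoordChange_comp (I := I) (w := xt) (x := p) (v := F xt) ⟨⟨hft2, hft1⟩, hft2⟩).trans
      (tangentCoordChange_self hft2)
  have h := hasFDerivWithinAt_tangentCoordChange (I := I) (x := p) (y := xt) (z := xt) ⟨hft1, hft2⟩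
  rw [(extChartAt I p).right_inv hf3] at h
  have h1 : HasFDerivWithinAt (extChartAt I xt ∘ (extChartAt I p).symm)
      (tangentCoordChange I p xt xt) (extChartAt I p).target (c t) :=
    h.mono (extChartAt_target_subset_range p)
  exact (h1.comp_hasDerivAt t hc hct).congr_deriv hval

/-- The half-space flow transported by a chart. The neighbourhood and the time may shrink as `n`
grows; this is harmless, since integral curves are unique and being `C^∞` at a point can be checked
for each `n` separately. -/
theorem exists_local_flow [CompleteSpace E] (hF : IsSmoothField I F) (hI : IsBoundaryModel I) (n : ℕ)
    (p : M) : ∃ U : Set M, IsOpen U ∧ p ∈ U ∧ ∃ ε > 0, ∃ φ : M → ℝ → M,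
      (∀ x ∈ U, φ x 0 = x ∧ IsMIntegralCurveOn (φ x) F (Ioo (-ε) ε)) ∧
      ContMDiffOn (I.prod 𝓘(ℝ, ℝ)) I n (fun q : M × ℝ => φ q.1 q.2) (U ×ˢ Ioo (-ε) ε) := by
  obtain ⟨w, hw, hsub⟩ : ∃ w ∈ 𝓝 (extChartAt I p p), w ∩ range I ⊆ (extChartAt I p).target :=
    mem_nhdsWithin_iff_exists_mem_nhds_inter.1 (extChartAt_target_mem_nhdsWithin p)
  rw [inter_comm] at hsub
  obtain ⟨r, hr, ε, hε, Φ, hΦ, -, hs⟩ := exists_contDiff_flow n (hF.tangentOn hI p hsub)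
    (mem_range_self _) hw ((hF.contDiffOn_chartField p).mono hsub)
  set U : Set M := (extChartAt I p).source ∩ extChartAt I p ⁻¹' ball (extChartAt I p p) r with hU
  have hUo : IsOpen U :=
    (continuousOn_extChartAt p).isOpen_inter_preimage (isOpen_extChartAt_source p) isOpen_ball
  have hmem : ∀ x ∈ U, extChartAt I p x ∈ range I ∩ ball (extChartAt I p p) r := fun x hx =>
    ⟨mem_range_self _, hx.2⟩
  refine ⟨U, hUo, ⟨mem_extChartAt_source p, mem_ball_self hr⟩, ε, hε,
    fun x t => (extChartAt I p).symm (Φ (extChartAt I p x) t), fun x hx => ⟨?_, fun t ht => ?_⟩, ?_⟩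
  · change (extChartAt I p).symm (Φ (extChartAt I p x) 0) = x
    rw [(hΦ _ (hmem x hx)).1, (extChartAt I p).left_inv hx.1]
  · refine (hasMFDerivAt_extChartAt_symm_comp (((hΦ _ (hmem x hx)).2 t ht).2)
      ?_).hasMFDerivWithinAt
    filter_upwards [isOpen_Ioo.mem_nhds ht] with s hs
    exact hsub ((hΦ _ (hmem x hx)).2 s hs).1
  · have h1 : ContMDiffOn (I.prod 𝓘(ℝ, ℝ)) 𝓘(ℝ, E × ℝ) n
        (fun q : M × ℝ => (extChartAt I p q.1, q.2)) (U ×ˢ Ioo (-ε) ε) := by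
      refine ContMDiffOn.prodMk_space ?_ contMDiffOn_snd
      have := (contMDiffOn_extChartAt (I := I) (x := p) (n := ∞)).of_le (m := n)
        (by exact_mod_cast le_top)
      refine this.comp contMDiffOn_fst fun q hq => ?_
      simpa using hq.1.1
    have h2 : ContMDiffOn (I.prod 𝓘(ℝ, ℝ)) 𝓘(ℝ, E) n
        (fun q : M × ℝ => Φ (extChartAt I p q.1) q.2) (U ×ˢ Ioo (-ε) ε) :=
      (contMDiffOn_iff_contDiffOn.2 hs).comp h1 fun q hq => ⟨hmem _ hq.1, hq.2⟩
    refine ((contMDiffOn_extChartAt_symm (n := ∞) p).of_le (m := n)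
      (by exact_mod_cast le_top)).comp h2 fun q hq => ?_
    exact hsub ((hΦ _ (hmem _ hq.1)).2 q.2 hq.2).1

/-- Local uniqueness of integral curves, at interior and boundary points. -/
theorem IsSmoothField.eventuallyEq_of_isMIntegralCurveAt (hF : IsSmoothField I F) {γ γ' : ℝ → M}
    {t₀ : ℝ} (hγ : IsMIntegralCurveAt γ F t₀) (hγ' : IsMIntegralCurveAt γ' F t₀)
    (h : γ t₀ = γ' t₀) : γ =ᶠ[𝓝 t₀] γ' := by
  set p := γ t₀ with hp
  have hcd : ContDiffWithinAt ℝ 1 (chartField F p) (range I) (extChartAt I p p) :=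
    (((hF.contDiffOn_chartField p) _ (mem_extChartAt_target p)).of_le
      (by exact_mod_cast le_top)).mono_of_mem_nhdsWithin (extChartAt_target_mem_nhdsWithin p)
  obtain ⟨C, s, hs, hlip⟩ := hcd.exists_lipschitzOnWith I.convex_range
  have hsrc {g : ℝ → M} (hg : IsMIntegralCurveAt g F t₀) (h' : p = g t₀) :
      ∀ᶠ t in 𝓝 t₀, g t ∈ (extChartAt I p).source :=
    hg.continuousAt.eventually (by rw [← h']; exact extChartAt_source_mem_nhds p)
  have hdrv {g : ℝ → M} (hg : IsMIntegralCurveAt g F t₀) (h' : p = g t₀) : ∀ᶠ t in 𝓝 t₀,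
      HasDerivAt (extChartAt I p ∘ g) (chartField F p ((extChartAt I p ∘ g) t)) t ∧
      (extChartAt I p ∘ g) t ∈ s := by
    apply Filter.Eventually.and
    · filter_upwards [hsrc hg h', hg.eventually_hasDerivAt] with t ht1 ht2
      rw [Function.comp_apply, chartField_extChartAt ht1]
      rw [← h'] at ht2
      exact ht2
    · have h1 : Tendsto (extChartAt I p ∘ g) (𝓝 t₀) (𝓝[range I] (extChartAt I p p)) := by
        refine tendsto_nhdsWithin_iff.2 ⟨?_, Eventually.of_forall fun t => mem_range_self _⟩
        have h2 := (continuousAt_extChartAt (I := I) p)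
        rw [h'] at h2 ⊢
        exact h2.comp hg.continuousAt
      exact h1 hs
  have heq := ODE_solution_unique_of_eventually (v := fun _ => chartField F p) (s := fun _ => s)
    (.of_forall fun _ => hlip) (hdrv hγ rfl) (hdrv hγ' h)
    (by simp only [Function.comp_apply, ← h, ← hp])
  filter_upwards [heq, hsrc hγ rfl, hsrc hγ' h] with t h1 h2 h3
  exact (extChartAt I p).injOn h2 h3 h1

theorem IsSmoothField.eqOn_of_isMIntegralCurveOn [T2Space M] (hF : IsSmoothField I F)
    {γ γ' : ℝ → M} {a b t₀ : ℝ} (ht₀ : t₀ ∈ Ioo a b) (hγ : IsMIntegralCurveOn γ F (Ioo a b))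
    (hγ' : IsMIntegralCurveOn γ' F (Ioo a b)) (h : γ t₀ = γ' t₀) : EqOn γ γ' (Ioo a b) := by
  have hc := hγ.continuousOn
  have hc' := hγ'.continuousOn
  suffices hsub : Ioo a b ⊆ {t | t ∈ Ioo a b ∧ γ t = γ' t} from fun t ht => (hsub ht).2
  refine isPreconnected_Ioo.subset_of_closure_inter_subset ?_ ⟨t₀, ht₀, ht₀, h⟩ ?_
  · rw [isOpen_iff_mem_nhds]
    rintro t ⟨ht, he⟩
    have hm := isOpen_Ioo.mem_nhds ht
    filter_upwards [hm, hF.eventuallyEq_of_isMIntegralCurveAt (hγ.isMIntegralCurveAt hm)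
      (hγ'.isMIntegralCurveAt hm) he] with s h1 h2
    exact ⟨h1, h2⟩
  · rintro t ⟨htc, ht⟩
    refine ⟨ht, ?_⟩
    have hne : (𝓝[{t | t ∈ Ioo a b ∧ γ t = γ' t}] t).NeBot := mem_closure_iff_nhdsWithin_neBot.1 htc
    have h1 := ((hc.continuousAt (isOpen_Ioo.mem_nhds ht)).tendsto).mono_left
      (nhdsWithin_le_nhds (s := {t | t ∈ Ioo a b ∧ γ t = γ' t}))
    have h2 := ((hc'.continuousAt (isOpen_Ioo.mem_nhds ht)).tendsto).mono_left
      (nhdsWithin_le_nhds (s := {t | t ∈ Ioo a b ∧ γ t = γ' t}))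
    refine tendsto_nhds_unique_of_eventuallyEq h1 h2 ?_
    filter_upwards [self_mem_nhdsWithin] with s hs using hs.2

/-! ### The maximal local flow: group law, open domain, smoothness -/

section FlowAPI

variable [T2Space M]

/-- By uniqueness, the solution chosen in the definition of `flow`, a separate choice for each time,
can be replaced by any other one. All properties of `flow` come from this. -/
theorem IsSmoothField.flow_eq (hF : IsSmoothField I F) {p : M} {γ : ℝ → M} {a b t : ℝ} (ha : a < 0)
    (hb : 0 < b) (h0 : γ 0 = p) (hγ : IsMIntegralCurveOn γ F (Ioo a b)) (ht : t ∈ Ioo a b) :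
    (p, t) ∈ flowDomain F ∧ flow F p t = γ t := by
  have hdom : (p, t) ∈ flowDomain F := ⟨γ, a, b, ha, hb, ht, h0, hγ⟩
  refine ⟨hdom, ?_⟩
  rw [flow, dif_pos hdom]
  obtain ⟨a', b', ha', hb', ht', h0', hγ'⟩ := Classical.choose_spec hdom
  have hsub : Ioo (max a a') (min b b') ⊆ Ioo a b :=
    Ioo_subset_Ioo (le_max_left _ _) (min_le_left _ _)
  have hsub' : Ioo (max a a') (min b b') ⊆ Ioo a' b' :=
    Ioo_subset_Ioo (le_max_right _ _) (min_le_right _ _)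
  exact hF.eqOn_of_isMIntegralCurveOn (t₀ := 0) ⟨max_lt ha ha', lt_min hb hb'⟩ (hγ'.mono hsub')
    (hγ.mono hsub) (h0'.trans h0.symm) ⟨max_lt ht.1 ht'.1, lt_min ht.2 ht'.2⟩

theorem IsSmoothField.exists_Ioo_of_mem_flowDomain (hF : IsSmoothField I F) {p : M} {t : ℝ}
    (h : (p, t) ∈ flowDomain F) : ∃ a b, a < 0 ∧ 0 < b ∧ t ∈ Ioo a b ∧
      (∀ s ∈ Ioo a b, (p, s) ∈ flowDomain F) ∧ IsMIntegralCurveOn (flow F p) F (Ioo a b) := by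
  obtain ⟨γ, a, b, ha, hb, ht, h0, hγ⟩ := h
  refine ⟨a, b, ha, hb, ht, fun s hs => (hF.flow_eq ha hb h0 hγ hs).1, fun s hs => ?_⟩
  have h1 : ∀ s ∈ Ioo a b, flow F p s = γ s := fun s hs => (hF.flow_eq ha hb h0 hγ hs).2
  have h2 := (hγ s hs).congr_mono h1 (h1 s hs) subset_rfl
  rw [h1 s hs]
  exact h2

theorem IsSmoothField.hasMFDerivAt_flow (hF : IsSmoothField I F) {p : M} {t : ℝ}
    (h : (p, t) ∈ flowDomain F) : HasMFDerivAt 𝓘(ℝ, ℝ) I (flow F p) t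
      ((1 : ℝ →L[ℝ] ℝ).smulRight (F (flow F p t))) := by
  obtain ⟨a, b, -, -, ht, -, hc⟩ := hF.exists_Ioo_of_mem_flowDomain h
  exact (hc t ht).hasMFDerivAt (isOpen_Ioo.mem_nhds ht)

theorem IsSmoothField.exists_Ioo_of_mem_of_mem (hF : IsSmoothField I F) {p : M} {s t : ℝ}
    (hs : (p, s) ∈ flowDomain F) (ht : (p, t) ∈ flowDomain F) : ∃ a b, a < 0 ∧ 0 < b ∧ s ∈ Ioo a b ∧
      t ∈ Ioo a b ∧ (∀ r ∈ Ioo a b, (p, r) ∈ flowDomain F) ∧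
      IsMIntegralCurveOn (flow F p) F (Ioo a b) := by
  obtain ⟨a, b, ha, hb, hs, h1, -⟩ := hF.exists_Ioo_of_mem_flowDomain hs
  obtain ⟨a', b', ha', hb', ht, h1', -⟩ := hF.exists_Ioo_of_mem_flowDomain ht
  have h2 : ∀ r ∈ Ioo (min a a') (max b b'), (p, r) ∈ flowDomain F := by
    rintro r ⟨hr1, hr2⟩
    rcases min_lt_iff.1 hr1 with h | h <;> rcases lt_max_iff.1 hr2 with h' | h'
    · exact h1 r ⟨h, h'⟩
    · rcases le_total r 0 with h0 | h0
      · exact h1 r ⟨h, h0.trans_lt hb⟩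
      · exact h1' r ⟨ha'.trans_le h0, h'⟩
    · rcases le_total r 0 with h0 | h0
      · exact h1' r ⟨h, h0.trans_lt hb'⟩
      · exact h1 r ⟨ha.trans_le h0, h'⟩
    · exact h1' r ⟨h, h'⟩
  exact ⟨min a a', max b b', min_lt_of_left_lt ha, lt_max_of_lt_left hb,
    ⟨min_lt_of_left_lt hs.1, lt_max_of_lt_left hs.2⟩,
    ⟨min_lt_of_right_lt ht.1, lt_max_of_lt_right ht.2⟩, h2,
    fun r hr => (hF.hasMFDerivAt_flow (h2 r hr)).hasMFDerivWithinAt⟩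

theorem IsSmoothField.mem_flowDomain_of_mem_uIcc (hF : IsSmoothField I F) {p : M} {s t r : ℝ}
    (hs : (p, s) ∈ flowDomain F) (ht : (p, t) ∈ flowDomain F) (hr : r ∈ uIcc s t) :
    (p, r) ∈ flowDomain F := by
  obtain ⟨a, b, -, -, h1, h2, h3, -⟩ := hF.exists_Ioo_of_mem_of_mem hs ht
  exact h3 r (ordConnected_Ioo.uIcc_subset h1 h2 hr)

/-- The part of the group law that needs no gluing: a time translate of an integral curve is an
integral curve. -/
theorem IsSmoothField.flow_sub (hF : IsSmoothField I F) {p : M} {s t : ℝ}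
    (hs : (p, s) ∈ flowDomain F) (ht : (p, t) ∈ flowDomain F) :
    (flow F p s, t - s) ∈ flowDomain F ∧ flow F (flow F p s) (t - s) = flow F p t := by
  obtain ⟨a, b, -, -, h1, h2, -, h3⟩ := hF.exists_Ioo_of_mem_of_mem hs ht
  have h4 := hF.flow_eq (p := flow F p s) (γ := flow F p ∘ (· + s)) (a := a - s) (b := b - s)
    (t := t - s) (by linarith [h1.1]) (by linarith [h1.2]) (by simp)
    ((h3.comp_add s).mono fun r hr => ⟨by linarith [hr.1], by linarith [hr.2]⟩)
    ⟨by linarith [h2.1], by linarith [h2.2]⟩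
  simpa using h4

theorem IsSmoothField.flow_add (hF : IsSmoothField I F) {p : M} {s t : ℝ}
    (hs : (p, s) ∈ flowDomain F) (ht : (flow F p s, t) ∈ flowDomain F) :
    (p, s + t) ∈ flowDomain F ∧ flow F p (s + t) = flow F (flow F p s) t := by
  classical
  obtain ⟨a, b, ha, hb, hsI, hd, hc⟩ := hF.exists_Ioo_of_mem_flowDomain hs
  obtain ⟨a', b', ha', hb', htI, -, hc'⟩ := hF.exists_Ioo_of_mem_flowDomain ht
  -- Two integral curves are glued. They agree on `Ioo a b` by `flow_sub`, and the two intervals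
  -- overlap at `s`.
  set c : ℝ → M := fun r => if r ∈ Ioo a b then flow F p r else flow F (flow F p s) (r - s) with hcd
  have hc1 : ∀ r ∈ Ioo a b, c r = flow F p r := fun r hr => if_pos hr
  have hc2 : ∀ r, c r = flow F (flow F p s) (r - s) := by
    intro r
    by_cases hr : r ∈ Ioo a b
    · rw [hc1 r hr, (hF.flow_sub hs (hd r hr)).2]
    · exact if_neg hr
  have hsh : IsMIntegralCurveOn c F (Ioo (a' + s) (b' + s)) := by
    have : c = flow F (flow F p s) ∘ (· + -s) :=
      funext fun r => by rw [hc2, sub_eq_add_neg]; rfl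
    rw [this]
    exact (IsMIntegralCurveOn.comp_add hc' (-s)).mono fun r hr => ⟨by linarith [hr.1], by linarith [hr.2]⟩
  have hpc : IsMIntegralCurveOn c F (Ioo a b) := fun r hr => by
    have h2 := (hc r hr).congr_mono hc1 (hc1 r hr) subset_rfl
    rw [hc1 r hr]
    exact h2
  have hall : IsMIntegralCurveOn c F (Ioo (min a (a' + s)) (max b (b' + s))) := by
    rintro r ⟨hr1, hr2⟩
    refine HasMFDerivAt.hasMFDerivWithinAt ?_
    have h1 : r ∈ Ioo a b ∨ r ∈ Ioo (a' + s) (b' + s) := by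
      rcases min_lt_iff.1 hr1 with h | h <;> rcases lt_max_iff.1 hr2 with h' | h'
      · exact .inl ⟨h, h'⟩
      · rcases le_total r s with h0 | h0
        · exact .inl ⟨h, h0.trans_lt hsI.2⟩
        · exact .inr ⟨by linarith, h'⟩
      · rcases le_total r s with h0 | h0
        · exact .inr ⟨h, by linarith⟩
        · exact .inl ⟨hsI.1.trans_le h0, h'⟩
      · exact .inr ⟨h, h'⟩
    rcases h1 with h | h
    · exact (hpc r h).hasMFDerivAt (isOpen_Ioo.mem_nhds h)
    · exact (hsh r h).hasMFDerivAt (isOpen_Ioo.mem_nhds h)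
  have h0 : c 0 = p := by
    rw [hc1 0 ⟨ha, hb⟩]
    obtain ⟨γ, a1, b1, ha1, hb1, ht1, h01, hγ1⟩ := hd 0 ⟨ha, hb⟩
    rw [(hF.flow_eq ha1 hb1 h01 hγ1 ht1).2, h01]
  have h3 := hF.flow_eq (t := s + t) (min_lt_of_left_lt ha) (lt_max_of_lt_left hb) h0 hall
    ⟨min_lt_of_right_lt (by linarith [htI.1]), lt_max_of_lt_right (by linarith [htI.2])⟩
  refine ⟨h3.1, ?_⟩
  rw [h3.2, hc2, add_sub_cancel_left]

theorem IsSmoothField.flow_of_eq_zero (hF : IsSmoothField I F) {z : M} (hz : F z = 0) (t : ℝ) :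
    (z, t) ∈ flowDomain F ∧ flow F z t = z :=
  hF.flow_eq (γ := fun _ => z) (a := -|t| - 1) (b := |t| + 1) (by linarith [abs_nonneg t])
    (by linarith [abs_nonneg t]) rfl ((isMIntegralCurve_const hz).isMIntegralCurveOn _)
    ⟨by linarith [neg_abs_le t], by linarith [le_abs_self t]⟩

theorem IsSmoothField.flow_zero [CompleteSpace E] (hF : IsSmoothField I F) (hI : IsBoundaryModel I)
    (p : M) : (p, (0 : ℝ)) ∈ flowDomain F ∧ flow F p 0 = p := by
  obtain ⟨U, -, hp, ε, hε, φ, hφ, -⟩ := exists_local_flow hF hI 0 p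
  have h1 := hF.flow_eq (neg_lt_zero.2 hε) hε (hφ p hp).1 (hφ p hp).2 (t := 0)
    ⟨neg_lt_zero.2 hε, hε⟩
  exact ⟨h1.1, h1.2.trans (hφ p hp).1⟩

theorem IsSmoothField.flow_neg [CompleteSpace E] (hF : IsSmoothField I F) (hI : IsBoundaryModel I)
    {p : M} {s : ℝ} (hs : (p, s) ∈ flowDomain F) :
    (flow F p s, -s) ∈ flowDomain F ∧ flow F (flow F p s) (-s) = p := by
  have h := hF.flow_sub hs (hF.flow_zero hI p).1
  rw [zero_sub, (hF.flow_zero hI p).2] at h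
  exact h

theorem IsSmoothField.flow_ne_zero [CompleteSpace E] (hF : IsSmoothField I F)
    (hI : IsBoundaryModel I) {p : M} {s : ℝ} (hs : (p, s) ∈ flowDomain F) (hp : F p ≠ 0) :
    F (flow F p s) ≠ 0 := by
  intro h
  have h1 := (hF.flow_of_eq_zero h (-s)).2
  rw [(hF.flow_neg hI hs).2] at h1
  rw [← h1] at h
  exact hp h

theorem IsSmoothField.exists_flowBox [CompleteSpace E] (hF : IsSmoothField I F)
    (hI : IsBoundaryModel I) (n : ℕ) (p : M) : ∃ U : Set M, IsOpen U ∧ p ∈ U ∧ ∃ ε > 0,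
      U ×ˢ Ioo (-ε) ε ⊆ flowDomain F ∧
      ContMDiffOn (I.prod 𝓘(ℝ, ℝ)) I n (fun q : M × ℝ => flow F q.1 q.2) (U ×ˢ Ioo (-ε) ε) := by
  obtain ⟨U, hU, hp, ε, hε, φ, hφ, hs⟩ := exists_local_flow hF hI n p
  have h1 : ∀ q ∈ U ×ˢ Ioo (-ε) ε, q ∈ flowDomain F ∧ flow F q.1 q.2 = φ q.1 q.2 := fun q hq =>
    hF.flow_eq (neg_lt_zero.2 hε) hε (hφ _ hq.1).1 (hφ _ hq.1).2 hq.2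
  exact ⟨U, hU, hp, ε, hε, fun q hq => (h1 q hq).1, hs.congr fun q hq => (h1 q hq).2⟩

/-- Continuation along the orbit: the good times form an open set, which is also closed in the
interval of existence. Near a limit time `s` one takes a good time `r` close to `s` and writes the
flow as the time-`r` flow followed by the flow in a box around `flow F p s`. -/
theorem IsSmoothField.exists_isOpen_contMDiffOn_flow [CompleteSpace E] (hF : IsSmoothField I F)
    (hI : IsBoundaryModel I) (n : ℕ) {p : M} {t : ℝ} (h : (p, t) ∈ flowDomain F) :
    ∃ W : Set (M × ℝ), IsOpen W ∧ (p, t) ∈ W ∧ W ⊆ flowDomain F ∧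
      ContMDiffOn (I.prod 𝓘(ℝ, ℝ)) I n (fun q : M × ℝ => flow F q.1 q.2) W := by
  obtain ⟨a, b, ha, hb, ht, hd, hc⟩ := hF.exists_Ioo_of_mem_flowDomain h
  set A : Set ℝ := {s | ∃ W : Set (M × ℝ), IsOpen W ∧ (p, s) ∈ W ∧ W ⊆ flowDomain F ∧
      ContMDiffOn (I.prod 𝓘(ℝ, ℝ)) I n (fun q : M × ℝ => flow F q.1 q.2) W} with hA
  have hAo : IsOpen A := by
    rw [isOpen_iff_mem_nhds]
    rintro s ⟨W, hW, hs, hWd, hWs⟩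
    filter_upwards [(hW.preimage (Continuous.prodMk_right p)).mem_nhds hs] with r hr
    exact ⟨W, hW, hr, hWd, hWs⟩
  suffices Ioo a b ⊆ A from this ht
  refine isPreconnected_Ioo.subset_of_closure_inter_subset hAo ⟨0, ⟨ha, hb⟩, ?_⟩ ?_
  · obtain ⟨U, hU, hp, ε, hε, h1, h2⟩ := hF.exists_flowBox hI n p
    exact ⟨U ×ˢ Ioo (-ε) ε, hU.prod isOpen_Ioo, ⟨hp, neg_lt_zero.2 hε, hε⟩, h1, h2⟩
  · rintro s ⟨hsA, hs⟩
    obtain ⟨U, hU, hp, ε, hε, h1, h2⟩ := hF.exists_flowBox hI n (flow F p s)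
    have h3 : ∀ᶠ r in 𝓝 s, flow F p r ∈ U ∧ |s - r| < ε := by
      refine Filter.Eventually.and ?_ ?_
      · exact (hF.hasMFDerivAt_flow (hd s hs)).continuousAt.eventually (hU.mem_nhds hp)
      · have : Continuous fun r : ℝ => |s - r| := by fun_prop
        exact this.continuousAt.eventually (gt_mem_nhds (by simpa using hε))
    obtain ⟨r, ⟨hrU, hrs⟩, W, hW, hrW, hWd, hWs⟩ := mem_closure_iff_nhds.1 hsA _ h3
    have hcont : ContinuousOn (fun x => flow F x r) ((fun x => (x, r)) ⁻¹' W) :=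
      hWs.continuousOn.comp (Continuous.prodMk_left r).continuousOn fun x hx => hx
    set V : Set M := (fun x => (x, r)) ⁻¹' W ∩ (fun x => flow F x r) ⁻¹' U with hV
    have hVo : IsOpen V := hcont.isOpen_inter_preimage (hW.preimage (Continuous.prodMk_left r)) hU
    have hkey : ∀ q ∈ V ×ˢ Ioo (r - ε) (r + ε), q ∈ flowDomain F ∧
        flow F q.1 q.2 = flow F (flow F q.1 r) (q.2 - r) := by
      rintro ⟨x, t⟩ ⟨hx, ht⟩
      have h5 := hF.flow_add (t := t - r) (hWd hx.1)
        (h1 ⟨hx.2, by linarith [ht.1], by linarith [ht.2]⟩)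
      rwa [add_sub_cancel] at h5
    refine ⟨V ×ˢ Ioo (r - ε) (r + ε), hVo.prod isOpen_Ioo, ⟨⟨hrW, hrU⟩, ?_, ?_⟩,
      fun q hq => (hkey q hq).1, ContMDiffOn.congr ?_ fun q hq => (hkey q hq).2⟩
    · linarith [(abs_lt.1 hrs).1]
    · linarith [(abs_lt.1 hrs).2]
    · have h6 : ContMDiffOn (I.prod 𝓘(ℝ, ℝ)) I n (fun q : M × ℝ => flow F q.1 r)
          (V ×ˢ Ioo (r - ε) (r + ε)) :=
        hWs.comp (contMDiffOn_fst.prodMk contMDiffOn_const) fun q hq => hq.1.1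
      have h7 : ContMDiffOn (I.prod 𝓘(ℝ, ℝ)) 𝓘(ℝ, ℝ) n (fun q : M × ℝ => q.2 - r)
          (V ×ˢ Ioo (r - ε) (r + ε)) :=
        (contDiff_id.sub contDiff_const).contMDiff.comp_contMDiffOn contMDiffOn_snd
      exact h2.comp (h6.prodMk h7) fun q hq =>
        ⟨hq.1.2, by linarith [hq.2.1], by linarith [hq.2.2]⟩

theorem IsSmoothField.isOpen_flowDomain [CompleteSpace E] (hF : IsSmoothField I F)
    (hI : IsBoundaryModel I) : IsOpen (flowDomain F) := by
  rw [isOpen_iff_mem_nhds]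
  intro q hq
  obtain ⟨W, hW, hqW, hWd, -⟩ := hF.exists_isOpen_contMDiffOn_flow hI 0 hq
  exact mem_of_superset (hW.mem_nhds hqW) hWd

theorem IsSmoothField.contMDiffAt_flow [CompleteSpace E] (hF : IsSmoothField I F)
    (hI : IsBoundaryModel I) {q : M × ℝ} (hq : q ∈ flowDomain F) :
    ContMDiffAt (I.prod 𝓘(ℝ, ℝ)) I ∞ (fun q : M × ℝ => flow F q.1 q.2) q := by
  rw [contMDiffAt_infty]
  intro n
  obtain ⟨W, hW, hqW, hWd, h⟩ := hF.exists_isOpen_contMDiffOn_flow hI n hq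
  exact h.contMDiffAt (hW.mem_nhds hqW)

theorem IsSmoothField.mem_orbit_self [CompleteSpace E] (hF : IsSmoothField I F)
    (hI : IsBoundaryModel I) (p : M) : p ∈ orbit F p :=
  ⟨0, (hF.flow_zero hI p).1, (hF.flow_zero hI p).2.symm⟩

theorem IsSmoothField.flow_mem_orbit (hF : IsSmoothField I F) {p q : M} (hp : p ∈ orbit F q) {s : ℝ}
    (hs : (p, s) ∈ flowDomain F) : flow F p s ∈ orbit F q := by
  obtain ⟨t, ht, rfl⟩ := hp
  exact ⟨t + s, (hF.flow_add ht hs).1, (hF.flow_add ht hs).2.symm⟩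

end FlowAPI

end ManifoldFlow

/-! ### Parametric integrals and Hadamard's lemma on convex sets -/

section Hadamard

open Metric Filter

variable {X W P G : Type} [NormedAddCommGroup X] [NormedSpace ℝ X]
  [NormedAddCommGroup W] [NormedSpace ℝ W] [NormedAddCommGroup P] [NormedSpace ℝ P]
  [NormedAddCommGroup G] [NormedSpace ℝ G]

omit [NormedSpace ℝ X] [NormedSpace ℝ G] in
theorem eventually_forall_norm_sub_le {S : Set X} {g : X × ℝ → G}
    (hg : ContinuousOn g (S ×ˢ Icc (0 : ℝ) 1)) {x : X} (hx : x ∈ S) {ε : ℝ} (hε : 0 < ε) :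
    ∀ᶠ y in 𝓝[S] x, ∀ t ∈ Icc (0 : ℝ) 1, ‖g (y, t) - g (x, t)‖ ≤ ε := by
  obtain ⟨v, hv, h⟩ := isCompact_Icc.mem_uniformity_of_prod (f := fun x t => g (x, t)) hg hx
    (dist_mem_uniformity hε)
  filter_upwards [hv] with y hy t ht
  have := h y hy t ht
  rw [← dist_eq_norm]
  exact le_of_lt this

/-- Convexity of `S` gives the mean value inequality for each `t`. Compactness of `[0,1]` makes the
continuity of `D` at `x` uniform in `t`, so the error terms can be integrated. -/
theorem hasFDerivWithinAt_integral [CompleteSpace G] {S : Set X} (hS : Convex ℝ S)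
    {g : X × ℝ → G} {D : X × ℝ → X →L[ℝ] G} (hg : ContinuousOn g (S ×ˢ Icc (0 : ℝ) 1))
    (hD : ContinuousOn D (S ×ˢ Icc (0 : ℝ) 1))
    (h : ∀ x ∈ S, ∀ t ∈ Icc (0 : ℝ) 1, HasFDerivWithinAt (fun x => g (x, t)) (D (x, t)) S x)
    {x : X} (hx : x ∈ S) :
    HasFDerivWithinAt (fun x => ∫ t in (0 : ℝ)..1, g (x, t)) (∫ t in (0 : ℝ)..1, D (x, t)) S x := by
  have hsl : ∀ y ∈ S, ContinuousOn (fun t => g (y, t)) (uIcc (0 : ℝ) 1) := fun y hy => by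
    rw [uIcc_of_le zero_le_one]
    exact hg.comp (Continuous.prodMk_right y).continuousOn fun t ht => ⟨hy, ht⟩
  have hslD : ContinuousOn (fun t => D (x, t)) (uIcc (0 : ℝ) 1) := by
    rw [uIcc_of_le zero_le_one]
    exact hD.comp (Continuous.prodMk_right x).continuousOn fun t ht => ⟨hx, ht⟩
  rw [hasFDerivWithinAt_iff_isLittleO, Asymptotics.isLittleO_iff]
  intro c hc
  obtain ⟨δ, hδ, hsub⟩ := mem_nhdsWithin_iff.1 (eventually_forall_norm_sub_le hD hx hc)
  filter_upwards [inter_mem_nhdsWithin S (ball_mem_nhds x hδ)] with y hy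
  have hconv : Convex ℝ (S ∩ ball x δ) := hS.inter (convex_ball _ _)
  have h1 : ∀ t ∈ Icc (0 : ℝ) 1, ‖g (y, t) - g (x, t) - D (x, t) (y - x)‖ ≤ c * ‖y - x‖ :=
    fun t ht => hconv.norm_image_sub_le_of_norm_hasFDerivWithin_le' (f := fun x => g (x, t))
      (f' := fun x => D (x, t)) (fun z hz => (h z hz.1 t ht).mono inter_subset_left)
      (fun z hz => hsub ⟨hz.2, hz.1⟩ t ht) ⟨hx, mem_ball_self hδ⟩ hy
  have h2 : (∫ t in (0 : ℝ)..1, g (y, t)) - (∫ t in (0 : ℝ)..1, g (x, t)) -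
      (∫ t in (0 : ℝ)..1, D (x, t)) (y - x) =
      ∫ t in (0 : ℝ)..1, (g (y, t) - g (x, t) - D (x, t) (y - x)) := by
    rw [ContinuousLinearMap.intervalIntegral_apply hslD.intervalIntegrable,
      intervalIntegral.integral_sub, intervalIntegral.integral_sub]
    · exact (hsl y hy.1).intervalIntegrable
    · exact (hsl x hx).intervalIntegrable
    · exact ((hsl y hy.1).sub (hsl x hx)).intervalIntegrable
    · exact (hslD.clm_apply continuousOn_const).intervalIntegrable
  rw [h2]
  have h3 := intervalIntegral.norm_integral_le_of_norm_le_const (a := (0 : ℝ)) (b := 1)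
    (f := fun t => g (y, t) - g (x, t) - D (x, t) (y - x)) (C := c * ‖y - x‖) (fun t ht => h1 t (by
      rw [uIoc_of_le zero_le_one] at ht
      exact Ioc_subset_Icc_self ht))
  simpa using h3

omit [NormedSpace ℝ X] in
theorem continuousOn_integral {S : Set X} {g : X × ℝ → G}
    (hg : ContinuousOn g (S ×ˢ Icc (0 : ℝ) 1)) :
    ContinuousOn (fun x => ∫ t in (0 : ℝ)..1, g (x, t)) S := by
  have hsl : ∀ y ∈ S, ContinuousOn (fun t => g (y, t)) (uIcc (0 : ℝ) 1) := fun y hy => by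
    rw [uIcc_of_le zero_le_one]
    exact hg.comp (Continuous.prodMk_right y).continuousOn fun t ht => ⟨hy, ht⟩
  intro x hx
  rw [ContinuousWithinAt, Metric.tendsto_nhds]
  intro ε hε
  filter_upwards [eventually_forall_norm_sub_le hg hx (half_pos hε), self_mem_nhdsWithin]
    with y hy hyS
  rw [dist_eq_norm, ← intervalIntegral.integral_sub (hsl y hyS).intervalIntegrable
    (hsl x hx).intervalIntegrable]
  have h3 := intervalIntegral.norm_integral_le_of_norm_le_const (a := (0 : ℝ)) (b := 1)
    (f := fun t => g (y, t) - g (x, t)) (C := ε / 2) (fun t ht => hy t (by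
      rw [uIoc_of_le zero_le_one] at ht
      exact Ioc_subset_Icc_self ht))
  simp only [sub_zero, abs_one, mul_one] at h3
  linarith

/-- Smoothness of parametric integrals on convex sets. -/
theorem contDiffOn_integral {S : Set X} (hS : Convex ℝ S) (hSu : UniqueDiffOn ℝ S) (n : ℕ) :
    ∀ {G : Type} [NormedAddCommGroup G] [NormedSpace ℝ G] [CompleteSpace G] {g : X × ℝ → G},
    ContDiffOn ℝ ∞ g (S ×ˢ Icc (0 : ℝ) 1) →
    ContDiffOn ℝ n (fun x => ∫ t in (0 : ℝ)..1, g (x, t)) S := by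
  induction n with
  | zero =>
    intro G _ _ _ g hg
    simpa using continuousOn_integral hg.continuousOn
  | succ n ih =>
    intro G _ _ _ g hg
    have hu : UniqueDiffOn ℝ (S ×ˢ Icc (0 : ℝ) 1) := hSu.prod (uniqueDiffOn_Icc zero_lt_one)
    set D : X × ℝ → X →L[ℝ] G := fun q =>
      (fderivWithin ℝ g (S ×ˢ Icc (0 : ℝ) 1) q).comp (ContinuousLinearMap.inl ℝ X ℝ) with hDdef
    have hD : ContDiffOn ℝ ∞ D (S ×ˢ Icc (0 : ℝ) 1) :=
      (hg.fderivWithin hu (m := ∞) (by norm_cast)).clm_comp contDiffOn_const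
    push_cast
    rw [contDiffOn_succ_iff_hasFDerivWithinAt_of_uniqueDiffOn hSu]
    refine ⟨fun h => absurd h (by simp), _, ih hD, fun x hx =>
      hasFDerivWithinAt_integral hS hg.continuousOn hD.continuousOn ?_ hx⟩
    intro x hx t ht
    have h1 := ((hg (x, t) ⟨hx, ht⟩).differentiableWithinAt (by simp)).hasFDerivWithinAt
    exact h1.comp x (f := fun x => (x, t)) (hasFDerivAt_prodMk_left x t).hasFDerivWithinAt
      fun y hy => ⟨hy, ht⟩

/-- Hadamard's lemma with parameters, on products of convex sets. -/
theorem exists_hadamard [CompleteSpace G] {B : Set W} {C : Set P} (hB : Convex ℝ B)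
    (hBu : UniqueDiffOn ℝ B) (h0 : 0 ∈ B) (hC : Convex ℝ C) (hCu : UniqueDiffOn ℝ C)
    {f : W × P → G} (hf : ContDiffOn ℝ ∞ f (B ×ˢ C)) (hf0 : ∀ p ∈ C, f (0, p) = 0) :
    ∃ g : W × P → W →L[ℝ] G, ContDiffOn ℝ ∞ g (B ×ˢ C) ∧ ∀ q ∈ B ×ˢ C, f q = g q q.1 := by
  have hu : UniqueDiffOn ℝ (B ×ˢ C) := hBu.prod hCu
  set D : W × P → W →L[ℝ] G := fun q =>
    (fderivWithin ℝ f (B ×ˢ C) q).comp (ContinuousLinearMap.inl ℝ W P) with hDdef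
  have hD : ContDiffOn ℝ ∞ D (B ×ˢ C) :=
    (hf.fderivWithin hu (m := ∞) (by norm_cast)).clm_comp contDiffOn_const
  have hmaps : ∀ q ∈ B ×ˢ C, ∀ t ∈ Icc (0 : ℝ) 1, (t • q.1, q.2) ∈ B ×ˢ C := fun q hq t ht =>
    ⟨hB.smul_mem_of_zero_mem h0 hq.1 ht, hq.2⟩
  have hD' : ContDiffOn ℝ ∞ (fun r : (W × P) × ℝ => D (r.2 • r.1.1, r.1.2))
      ((B ×ˢ C) ×ˢ Icc (0 : ℝ) 1) :=
    hD.comp (by fun_prop) fun r hr => hmaps r.1 hr.1 r.2 hr.2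
  -- `f (w, p) = ∫₀¹ d/dt f (t w, p) dt`, because `f (0, p) = 0`.
  refine ⟨fun q => ∫ t in (0 : ℝ)..1, D (t • q.1, q.2),
    contDiffOn_infty.2 fun n => contDiffOn_integral (hB.prod hC) hu n hD', fun q hq => ?_⟩
  have hcont : ContinuousOn (fun t : ℝ => D (t • q.1, q.2)) (uIcc 0 1) := by
    rw [uIcc_of_le zero_le_one]
    exact hD.continuousOn.comp (by fun_prop) fun t ht => hmaps q hq t ht
  rw [ContinuousLinearMap.intervalIntegral_apply hcont.intervalIntegrable]
  have hder : ∀ t ∈ Icc (0 : ℝ) 1, HasDerivWithinAt (fun t : ℝ => f (t • q.1, q.2))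
      (D (t • q.1, q.2) q.1) (Icc 0 1) t := by
    intro t ht
    have h1 := ((hf _ (hmaps q hq t ht)).differentiableWithinAt (by simp)).hasFDerivWithinAt
    have h2 : HasDerivWithinAt (fun t : ℝ => (t • q.1, q.2)) (q.1, (0 : P)) (Icc 0 1) t := by
      refine HasDerivAt.hasDerivWithinAt ?_
      simpa using ((hasDerivAt_id t).smul_const q.1).prodMk (hasDerivAt_const t q.2)
    exact h1.comp_hasDerivWithinAt t h2 fun s hs => hmaps q hq s hs
  rw [intervalIntegral.integral_eq_sub_of_hasDeriv_right_of_le zero_le_one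
    (f := fun t : ℝ => f (t • q.1, q.2))
    (fun t ht => (hder t ht).continuousWithinAt)
    (fun t ht => ((hder t (Ioo_subset_Icc_self ht)).hasDerivAt
      (Icc_mem_nhds ht.1 ht.2)).hasDerivWithinAt)
    (hcont.clm_apply continuousOn_const).intervalIntegrable]
  simp [hf0 q.2 hq.2]

theorem exists_hadamard_real [CompleteSpace G] {B : Set ℝ} {C : Set P} (hB : Convex ℝ B)
    (hBu : UniqueDiffOn ℝ B) (h0 : 0 ∈ B) (hC : Convex ℝ C) (hCu : UniqueDiffOn ℝ C)
    {f : ℝ × P → G} (hf : ContDiffOn ℝ ∞ f (B ×ˢ C)) (hf0 : ∀ p ∈ C, f (0, p) = 0) :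
    ∃ g : ℝ × P → G, ContDiffOn ℝ ∞ g (B ×ˢ C) ∧ ∀ q ∈ B ×ˢ C, f q = q.1 • g q := by
  obtain ⟨g, hg, h⟩ := exists_hadamard hB hBu h0 hC hCu hf hf0
  refine ⟨fun q => g q 1, hg.clm_apply contDiffOn_const, fun q hq => ?_⟩
  rw [h q hq, ← map_smul, smul_eq_mul, mul_one]

/-- Hadamard's quotient is only a real-linear map of `ℂ` at each point; `a` and `b` are its
complex-linear and conjugate-linear coefficients. -/
theorem exists_hadamard_complex {B : Set ℂ} {C : Set P} (hB : Convex ℝ B)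
    (hBu : UniqueDiffOn ℝ B) (h0 : 0 ∈ B) (hC : Convex ℝ C) (hCu : UniqueDiffOn ℝ C)
    {f : ℂ × P → ℂ} (hf : ContDiffOn ℝ ∞ f (B ×ˢ C)) (hf0 : ∀ p ∈ C, f (0, p) = 0) :
    ∃ a b : ℂ × P → ℂ, ContDiffOn ℝ ∞ a (B ×ˢ C) ∧ ContDiffOn ℝ ∞ b (B ×ˢ C) ∧
      ∀ q ∈ B ×ˢ C, f q = q.1 * a q + starRingEnd ℂ q.1 * b q := by
  obtain ⟨g, hg, h⟩ := exists_hadamard hB hBu h0 hC hCu hf hf0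
  have h1 : ContDiffOn ℝ ∞ (fun q => g q 1) (B ×ˢ C) := hg.clm_apply contDiffOn_const
  have hI : ContDiffOn ℝ ∞ (fun q => g q Complex.I) (B ×ˢ C) := hg.clm_apply contDiffOn_const
  refine ⟨fun q => (g q 1 - Complex.I * g q Complex.I) / 2,
    fun q => (g q 1 + Complex.I * g q Complex.I) / 2,
    (h1.sub (contDiffOn_const.mul hI)).div_const 2, (h1.add (contDiffOn_const.mul hI)).div_const 2,
    fun q hq => ?_⟩
  have h2 : q.1 = q.1.re • (1 : ℂ) + q.1.im • Complex.I := by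
    simp
  have h3 : g q q.1 = q.1.re * g q 1 + q.1.im * g q Complex.I := by
    conv_lhs => rw [h2]
    rw [map_add, map_smul, map_smul]
    simp
  have h4 : q.1 = q.1.re + q.1.im * Complex.I := (Complex.re_add_im q.1).symm
  have h5 : starRingEnd ℂ q.1 = q.1.re - q.1.im * Complex.I := by
    apply Complex.ext <;> simp
  rw [h q hq, h3, h5]
  linear_combination (-(g q 1 - Complex.I * g q Complex.I) / 2) * h4 +
    (q.1.im * g q Complex.I) * Complex.I_sq

end Hadamard

/-! ### The operator `∂/∂w̄` with parameters -/

section Dbar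

open Metric Filter ComplexConjugate

variable {P : Type} [NormedAddCommGroup P] [NormedSpace ℝ P] {S : Set (ℂ × P)}

/-- The operator `∂/∂w̄` for functions of `(w, p)`, with derivatives taken within `S`. -/
def dbar (S : Set (ℂ × P)) (f : ℂ × P → ℂ) (q : ℂ × P) : ℂ :=
  (fderivWithin ℝ f S q (1, 0) + Complex.I * fderivWithin ℝ f S q (Complex.I, 0)) / 2

theorem contDiffOn_dbar (hS : UniqueDiffOn ℝ S) {f : ℂ × P → ℂ} (hf : ContDiffOn ℝ ∞ f S) :
    ContDiffOn ℝ ∞ (dbar S f) S := by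
  have h := hf.fderivWithin hS (m := ∞) (by norm_cast)
  exact ((h.clm_apply contDiffOn_const).add
    (contDiffOn_const.mul (h.clm_apply contDiffOn_const))).div_const 2

theorem dbar_congr {f g : ℂ × P → ℂ} (h : EqOn f g S) {q : ℂ × P} (hq : q ∈ S) :
    dbar S f q = dbar S g q := by
  simp only [dbar, fderivWithin_congr h (h hq)]

theorem HasFDerivWithinAt.dbar_eq (hS : UniqueDiffOn ℝ S) {f : ℂ × P → ℂ} {q : ℂ × P} (hq : q ∈ S)
    {T : ℂ × P →L[ℝ] ℂ} (h : HasFDerivWithinAt f T S q) :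
    dbar S f q = (T (1, 0) + Complex.I * T (Complex.I, 0)) / 2 := by
  rw [dbar, h.fderivWithin (hS q hq)]

theorem dbar_add (hS : UniqueDiffOn ℝ S) {f g : ℂ × P → ℂ} {q : ℂ × P} (hq : q ∈ S)
    (hf : DifferentiableWithinAt ℝ f S q) (hg : DifferentiableWithinAt ℝ g S q) :
    dbar S (fun q => f q + g q) q = dbar S f q + dbar S g q := by
  rw [(hf.hasFDerivWithinAt.fun_add hg.hasFDerivWithinAt).dbar_eq hS hq, dbar, dbar]
  simp only [add_apply]
  ring

theorem dbar_mul (hS : UniqueDiffOn ℝ S) {f g : ℂ × P → ℂ} {q : ℂ × P} (hq : q ∈ S)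
    (hf : DifferentiableWithinAt ℝ f S q) (hg : DifferentiableWithinAt ℝ g S q) :
    dbar S (fun q => f q * g q) q = f q * dbar S g q + g q * dbar S f q := by
  rw [(hf.hasFDerivWithinAt.fun_mul hg.hasFDerivWithinAt).dbar_eq hS hq, dbar, dbar]
  simp only [add_apply, smul_apply, smul_eq_mul]
  ring

theorem differentiableWithinAt_conj_fst {q : ℂ × P} :
    DifferentiableWithinAt ℝ (fun q : ℂ × P => conj q.1) S q :=
  (Complex.conjCLE.differentiable.comp differentiable_fst).differentiableAt.differentiableWithinAt

theorem dbar_fst (hS : UniqueDiffOn ℝ S) {q : ℂ × P} (hq : q ∈ S) :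
    dbar S (fun q => q.1) q = 0 := by
  rw [HasFDerivWithinAt.dbar_eq hS hq hasFDerivWithinAt_fst]
  simp

theorem differentiableWithinAt_conj_fst_pow {q : ℂ × P} (k : ℕ) :
    DifferentiableWithinAt ℝ (fun q : ℂ × P => conj q.1 ^ k) S q :=
  (differentiableWithinAt_conj_fst (S := S) (q := q)).fun_pow k

theorem dbar_conj_fst (hS : UniqueDiffOn ℝ S) {q : ℂ × P} (hq : q ∈ S) :
    dbar S (fun q => conj q.1) q = 1 := by
  have h : HasFDerivWithinAt (fun q : ℂ × P => conj q.1)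
      ((Complex.conjCLE : ℂ →L[ℝ] ℂ).comp (ContinuousLinearMap.fst ℝ ℂ P)) S q :=
    ((Complex.conjCLE : ℂ →L[ℝ] ℂ).comp (ContinuousLinearMap.fst ℝ ℂ P)).hasFDerivWithinAt
  rw [h.dbar_eq hS hq]
  simp

theorem dbar_conj_fst_pow (hS : UniqueDiffOn ℝ S) {q : ℂ × P} (hq : q ∈ S) (k : ℕ) :
    dbar S (fun q => conj q.1 ^ (k + 1)) q = (k + 1) * conj q.1 ^ k := by
  induction k with
  | zero =>
    simp only [zero_add, pow_one, dbar_conj_fst hS hq]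
    simp
  | succ k ih =>
    have h1 : (fun q : ℂ × P => conj q.1 ^ (k + 1 + 1)) =
        fun q => conj q.1 ^ (k + 1) * conj q.1 := by
      funext q; ring
    rw [h1, dbar_mul hS hq (differentiableWithinAt_conj_fst_pow _)
      differentiableWithinAt_conj_fst, ih, dbar_conj_fst hS hq]
    push_cast
    ring

/-- Each application of `∂̄` removes one factor `w̄` on the left and keeps the factor `w` on the
right, as `∂̄w = 0`. At `w = 0` the left coefficient is only multiplied by a positive integer, and
after `k` applications the right side makes it vanish. -/
theorem eq_zero_of_conj_pow_mul_eq (hS : UniqueDiffOn ℝ S) {p : P} (hp : ((0 : ℂ), p) ∈ S) (k : ℕ) :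
    ∀ {c d : ℂ × P → ℂ}, ContDiffOn ℝ ∞ c S → ContDiffOn ℝ ∞ d S →
    (∀ q ∈ S, conj q.1 ^ k * c q = q.1 * d q) → c (0, p) = 0 := by
  induction k with
  | zero =>
    intro c d _ _ h
    simpa using h _ hp
  | succ k ih =>
    intro c d hc hd h
    have hdiff {f : ℂ × P → ℂ} (hf : ContDiffOn ℝ ∞ f S) {q} (hq : q ∈ S) :
      DifferentiableWithinAt ℝ f S q := (hf q hq).differentiableWithinAt (by simp)
    have h1 : ∀ q ∈ S, conj q.1 ^ k * ((k + 1) * c q + conj q.1 * dbar S c q) =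
        q.1 * dbar S d q := by
      intro q hq
      have h2 := dbar_congr h hq
      rw [dbar_mul hS hq (differentiableWithinAt_conj_fst_pow _) (hdiff hc hq),
        dbar_mul hS hq differentiableWithinAt_fst (hdiff hd hq), dbar_conj_fst_pow hS hq,
        dbar_fst hS hq] at h2
      linear_combination h2
    have hcj : ContDiffOn ℝ ∞ (fun q : ℂ × P => conj q.1) S :=
      Complex.conjCLE.contDiff.comp_contDiffOn contDiffOn_fst
    have h3 := ih ((contDiffOn_const.mul hc).add (hcj.mul (contDiffOn_dbar hS hc)))
      (contDiffOn_dbar hS hd) h1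
    simp only [map_zero, zero_mul, add_zero, mul_eq_zero] at h3
    refine h3.resolve_left ?_
    exact_mod_cast k.succ_ne_zero

theorem norm_conj_pow_mul_inv_pow_le {k i : ℕ} (hk : i ≤ k) (w : ℂ) :
    ‖conj w ^ k * w⁻¹ ^ i‖ ≤ ‖w‖ ^ (k - i) := by
  rw [norm_mul, norm_pow, norm_pow, norm_inv, RCLike.norm_conj]
  rcases eq_or_ne w 0 with rfl | hw
  · rcases Nat.eq_zero_or_pos i with rfl | hi
    · simp
    · rw [norm_zero, inv_zero, zero_pow hi.ne', mul_zero]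
      positivity
  · have : ‖w‖ ≠ 0 := norm_ne_zero_iff.2 hw
    rw [inv_pow, ← pow_sub₀ _ this hk]

/-- The function has size `|w|^(k - i)` near `0`, and its derivative is a combination of functions
of the same form with exponents `(k - 1, i)` and `(k, i + 1)`, so each differentiation costs one
order. Only `i = 1` is needed later; general `i` serves the induction. -/
theorem contDiff_conj_pow_mul_inv_pow (n : ℕ) : ∀ {k i : ℕ}, i + n + 1 ≤ k →
    ContDiff ℝ n (fun w : ℂ => conj w ^ k * w⁻¹ ^ i) := by
  induction n with
  | zero =>
    intro k i hk
    rw [Nat.cast_zero, contDiff_zero, continuous_iff_continuousAt]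
    intro w
    rcases eq_or_ne w 0 with rfl | hw
    · have h1 : Tendsto (fun w : ℂ => ‖w‖ ^ (k - i)) (𝓝 0) (𝓝 0) := by
        have : Continuous fun w : ℂ => ‖w‖ ^ (k - i) := by fun_prop
        have h2 := this.tendsto 0
        rwa [norm_zero, zero_pow (by omega)] at h2
      have h3 := squeeze_zero_norm (fun w => norm_conj_pow_mul_inv_pow_le (by omega) w) h1
      rw [ContinuousAt, map_zero, zero_pow (by omega), zero_mul]
      exact h3
    · exact ((Complex.continuous_conj.pow k).continuousAt).mul ((continuousAt_inv₀ hw).pow i)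
  | succ n ih =>
    intro k i hk
    have hd : ∀ w : ℂ, HasFDerivAt (fun w : ℂ => conj w ^ k * w⁻¹ ^ i)
        ((k * (conj w ^ (k - 1) * w⁻¹ ^ i)) • (Complex.conjCLE : ℂ →L[ℝ] ℂ) -
          (i * (conj w ^ k * w⁻¹ ^ (i + 1))) • ContinuousLinearMap.id ℝ ℂ) w := by
      intro w
      rcases eq_or_ne w 0 with rfl | hw
      · have h0 : ((k * (conj (0 : ℂ) ^ (k - 1) * (0 : ℂ)⁻¹ ^ i)) • (Complex.conjCLE : ℂ →L[ℝ] ℂ) -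
          (i * (conj (0 : ℂ) ^ k * (0 : ℂ)⁻¹ ^ (i + 1))) • ContinuousLinearMap.id ℝ ℂ) = 0 := by
          rw [map_zero, zero_pow (by omega : k - 1 ≠ 0), zero_pow (by omega : k ≠ 0), zero_mul, mul_zero,
            zero_mul, mul_zero]
          ext v
          simp
        rw [h0, hasFDerivAt_iff_isLittleO]
        simp only [map_zero, sub_zero, zero_apply]
        rw [zero_pow (by omega : k ≠ 0), zero_mul]
        simp only [sub_zero]
        have h2 : (fun w : ℂ => conj w ^ k * w⁻¹ ^ i) =O[𝓝 0] fun w : ℂ => ‖w‖ ^ (k - i) :=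
          Asymptotics.IsBigO.of_bound 1 (Eventually.of_forall fun w => by
            rw [one_mul, norm_pow, norm_norm]
            exact norm_conj_pow_mul_inv_pow_le (by omega) w)
        exact h2.trans_isLittleO (Asymptotics.isLittleO_norm_pow_id (by omega))
      · have h1 : HasFDerivAt (fun w : ℂ => conj w ^ k)
            ((k * conj w ^ (k - 1)) • (Complex.conjCLE : ℂ →L[ℝ] ℂ)) w := by
          have := (Complex.conjCLE : ℂ →L[ℝ] ℂ).hasFDerivAt (x := w) |>.pow k
          simpa [nsmul_eq_mul, smul_smul] using this
        have h2 : HasFDerivAt (fun w : ℂ => w⁻¹ ^ i)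
            ((-(i * w⁻¹ ^ (i + 1))) • ContinuousLinearMap.id ℝ ℂ) w := by
          have h3 : HasDerivAt (fun w : ℂ => w⁻¹ ^ i) (-(i * w⁻¹ ^ (i + 1))) w := by
            have := (hasDerivAt_inv hw).pow i
            refine this.congr_deriv ?_
            rcases Nat.eq_zero_or_pos i with rfl | hi
            · simp
            · obtain ⟨i, rfl⟩ : ∃ j, i = j + 1 := ⟨i - 1, by omega⟩
              simp only [Nat.add_sub_cancel, inv_pow]
              field_simp
              ring
          have h4 := h3.hasFDerivAt.restrictScalars ℝ
          refine h4.congr_fderiv ?_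
          ext v
          simp [mul_comm]
        refine (h1.mul h2).congr_fderiv ?_
        ext v
        simp
        ring
    have hn : ((n + 1 : ℕ) : WithTop ℕ∞) = (n : WithTop ℕ∞) + 1 := by push_cast; rfl
    rw [hn, contDiff_succ_iff_hasFDerivAt]
    refine ⟨_, ?_, hd⟩
    exact ((contDiff_const.mul (ih (k := k - 1) (i := i) (by omega))).smul contDiff_const).sub
      ((contDiff_const.mul (ih (k := k) (i := i + 1) (by omega))).smul contDiff_const)

end Dbar

/-! ### Division in the case of a complex eigenvalue -/

section ComplexDivision

open Metric Filter ComplexConjugate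

theorem Complex.countable_setOf_exp_eq (c : ℂ) : {z : ℂ | Complex.exp z = c}.Countable := by
  rcases eq_empty_or_nonempty {z : ℂ | Complex.exp z = c} with h | ⟨z₀, h₀⟩
  · rw [h]
    exact countable_empty
  · refine (countable_range fun n : ℤ => z₀ + n * (2 * Real.pi * Complex.I)).mono fun z hz => ?_
    obtain ⟨n, hn⟩ := Complex.exp_eq_exp_iff_exists_int.1
      ((show Complex.exp z = c from hz).trans (show Complex.exp z₀ = c from h₀).symm)
    exact ⟨n, hn.symm⟩

/-- A countable subset of a metric space is totally disconnected. This gives uniqueness of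
logarithms here, and later uniqueness of shift functions and the structure of plaques. -/
theorem IsPreconnected.eq_of_countable_image {X Y : Type*} [TopologicalSpace X] [MetricSpace Y]
    {T : Set X} (hT : IsPreconnected T) {f : X → Y} (hf : ContinuousOn f T)
    (hc : (f '' T).Countable) {x y : X} (hx : x ∈ T) (hy : y ∈ T) : f x = f y :=
  hc.isTotallyDisconnected _ subset_rfl (hT.image f hf) (mem_image_of_mem f hx)
    (mem_image_of_mem f hy)

theorem IsPreconnected.eq_of_exp_eq {X : Type*} [TopologicalSpace X] {T : Set X}
    (hT : IsPreconnected T) {f : X → ℂ} (hf : ContinuousOn f T) {c : ℂ}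
    (hc : ∀ x ∈ T, Complex.exp (f x) = c) {x y : X} (hx : x ∈ T) (hy : y ∈ T) : f x = f y :=
  hT.eq_of_countable_image hf
    ((Complex.countable_setOf_exp_eq c).mono (by rintro _ ⟨z, hz, rfl⟩; exact hc z hz)) hx hy

theorem isPreconnected_ball_diff_zero (r : ℝ) : IsPreconnected (ball (0 : ℂ) r \ {0}) := by
  have h : ball (0 : ℂ) r \ {0} =
      (fun q : ℝ × ℝ => (q.1 : ℂ) * Complex.exp (q.2 * Complex.I)) '' (Ioo 0 r ×ˢ univ) := by
    ext w
    constructor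
    · rintro ⟨h1, h2⟩
      refine ⟨(‖w‖, w.arg), ⟨⟨norm_pos_iff.2 h2, by simpa using h1⟩, mem_univ _⟩,
        Complex.norm_mul_exp_arg_mul_I w⟩
    · rintro ⟨⟨ρ, θ⟩, ⟨⟨h1, h2⟩, -⟩, rfl⟩
      refine ⟨?_, ?_⟩
      · rw [mem_ball_zero_iff, norm_mul, Complex.norm_exp_ofReal_mul_I, mul_one]
        simpa [abs_of_pos h1] using h2
      · simpa using h1.ne'
  rw [h]
  exact (isPreconnected_Ioo.prod isPreconnected_univ).image _ (by fun_prop)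

variable {P : Type} [NormedAddCommGroup P] [NormedSpace ℝ P] {S : Set (ℂ × P)}

theorem dbar_congr_of_eventuallyEq {f g : ℂ × P → ℂ} {q : ℂ × P} (h : f =ᶠ[𝓝[S] q] g) (hq : q ∈ S) :
    dbar S f q = dbar S g q := by
  simp only [dbar, h.fderivWithin_eq (h.self_of_nhdsWithin hq)]

theorem dbar_cexp (hS : UniqueDiffOn ℝ S) {f : ℂ × P → ℂ} {q : ℂ × P} (hq : q ∈ S)
    (hf : DifferentiableWithinAt ℝ f S q) :
    dbar S (fun q => Complex.exp (f q)) q = Complex.exp (f q) * dbar S f q := by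
  rw [hf.hasFDerivWithinAt.cexp.dbar_eq hS hq, dbar]
  simp only [smul_apply, smul_eq_mul]
  ring

theorem dbar_const_mul (hS : UniqueDiffOn ℝ S) {f : ℂ × P → ℂ} {q : ℂ × P} (hq : q ∈ S) (c : ℂ)
    (hf : DifferentiableWithinAt ℝ f S q) :
    dbar S (fun q => c * f q) q = c * dbar S f q := by
  rw [(hf.hasFDerivWithinAt.const_mul c).dbar_eq hS hq, dbar]
  simp only [smul_apply, smul_eq_mul]
  ring

/-- The differential identity satisfied by `W = exp (l * lam) * w` with real-valued `lam`. -/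
theorem dbar_identity (hS : UniqueDiffOn ℝ S) {W : ℂ × P → ℂ} {lam : ℂ × P → ℝ} {l : ℂ}
    (hlam : ContDiffOn ℝ ∞ lam (S ∩ {q | q.1 ≠ 0}))
    (hW : ∀ q ∈ S, q.1 ≠ 0 → W q = Complex.exp (l * lam q) * q.1)
    (hW0 : ∀ q ∈ S, q.1 = 0 → W q = 0) {q : ℂ × P} (hq : q ∈ S) :
    conj l * conj q.1 * conj (W q) * dbar S W q =
      l * W q * (conj q.1 * dbar S (fun q => conj (W q)) q - conj (W q)) := by
  by_cases h0 : q.1 = 0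
  · rw [hW0 q hq h0, h0]
    simp
  have hnhds : ∀ᶠ q' in 𝓝[S] q, q' ∈ S ∩ {q | q.1 ≠ 0} :=
    inter_mem self_mem_nhdsWithin (mem_nhdsWithin_of_mem_nhds
      ((isOpen_ne_fun continuous_fst continuous_const).mem_nhds h0))
  have hl : DifferentiableWithinAt ℝ (fun q => (lam q : ℂ)) S q := by
    have h1 : DifferentiableWithinAt ℝ lam S q :=
      ((hlam q ⟨hq, h0⟩).mono_of_mem_nhdsWithin hnhds).differentiableWithinAt (by simp)
    exact Complex.ofRealCLM.differentiableAt.comp_differentiableWithinAt q h1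
  have he (c : ℂ) : DifferentiableWithinAt ℝ (fun q => Complex.exp (c * (lam q : ℂ))) S q :=
    (hl.const_mul c).cexp
  have hd (c : ℂ) : dbar S (fun q => Complex.exp (c * (lam q : ℂ))) q =
      Complex.exp (c * lam q) * (c * dbar S (fun q => (lam q : ℂ)) q) := by
    rw [dbar_cexp hS hq (hl.const_mul c), dbar_const_mul hS hq c hl]
  -- The reality of `lam` enters here. It makes `∂̄W` and `∂̄W̄` depend on the same function `∂̄
  -- lam`, which is then eliminated.
  have hcW : ∀ q ∈ S, q.1 ≠ 0 → conj (W q) = Complex.exp (conj l * lam q) * conj q.1 := by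
    intro q hq h0
    rw [hW q hq h0, map_mul, ← Complex.exp_conj, map_mul, Complex.conj_ofReal]
  have h1 : dbar S W q = l * W q * dbar S (fun q => (lam q : ℂ)) q := by
    rw [dbar_congr_of_eventuallyEq (hnhds.mono fun q' h => hW q' h.1 h.2) hq,
      dbar_mul hS hq (he l) differentiableWithinAt_fst, dbar_fst hS hq, hd, hW q hq h0]
    ring
  have h2 : dbar S (fun q => conj (W q)) q = Complex.exp (conj l * lam q) *
      (1 + conj q.1 * (conj l * dbar S (fun q => (lam q : ℂ)) q)) := by
    rw [dbar_congr_of_eventuallyEq (hnhds.mono fun q' h => hcW q' h.1 h.2) hq,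
      dbar_mul hS hq (he (conj l)) differentiableWithinAt_conj_fst, dbar_conj_fst hS hq, hd]
    ring
  rw [h1, h2, hcW q hq h0]
  ring

theorem ContDiffOn.conj {X : Type*} [NormedAddCommGroup X] [NormedSpace ℝ X] {T : Set X} {f : X → ℂ}
    {n : WithTop ℕ∞} (hf : ContDiffOn ℝ n f T) : ContDiffOn ℝ n (fun q => conj (f q)) T :=
  Complex.conjCLE.contDiff.comp_contDiffOn hf

/-- After inserting the expansion of `W` into the identity, the terms without an explicit factor `w`
all carry `w̄^(i+2)`, and at `w = 0` their coefficient is `(i + 1) l̄ ā b`. By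
`eq_zero_of_conj_pow_mul_eq` it vanishes. -/
theorem mul_eq_zero_of_dbar_identity (hS : UniqueDiffOn ℝ S) {W a b : ℂ × P → ℂ} {l : ℂ} (hl : l ≠ 0)
    (ha : ContDiffOn ℝ ∞ a S) (hb : ContDiffOn ℝ ∞ b S) (i : ℕ)
    (hW : ∀ q ∈ S, W q = q.1 * a q + conj q.1 ^ (i + 1) * b q)
    (hid : ∀ q ∈ S, conj l * conj q.1 * conj (W q) * dbar S W q =
      l * W q * (conj q.1 * dbar S (fun q => conj (W q)) q - conj (W q)))
    {p : P} (hp : ((0 : ℂ), p) ∈ S) : a (0, p) = 0 ∨ b (0, p) = 0 := by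
  have hdiff {f : ℂ × P → ℂ} (hf : ContDiffOn ℝ ∞ f S) {q} (hq : q ∈ S) :
    DifferentiableWithinAt ℝ f S q := (hf q hq).differentiableWithinAt (by simp)
  have hw : ContDiffOn ℝ ∞ (fun q : ℂ × P => q.1) S := contDiffOn_fst
  have hcw := hw.conj
  have hca := ha.conj
  have hcb := hb.conj
  have hda := contDiffOn_dbar hS ha
  have hdb := contDiffOn_dbar hS hb
  have hdca := contDiffOn_dbar hS hca
  have hdcb := contDiffOn_dbar hS hcb
  set da := dbar S a
  set db := dbar S b
  set dca := dbar S fun q => conj (a q)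
  set dcb := dbar S fun q => conj (b q)
  have h1 : ∀ q ∈ S, dbar S W q = q.1 * da q + ((i + 1) * conj q.1 ^ i * b q +
      conj q.1 ^ (i + 1) * db q) := by
    intro q hq
    rw [dbar_congr hW hq, dbar_add hS hq (hdiff (hw.mul ha) hq)
      (hdiff ((hcw.pow _).mul hb) hq), dbar_mul hS hq (hdiff hw hq) (hdiff ha hq), dbar_fst hS hq,
      dbar_mul hS hq (differentiableWithinAt_conj_fst_pow _) (hdiff hb hq), dbar_conj_fst_pow hS hq]
    ring
  have hcW : ∀ q ∈ S, conj (W q) = conj q.1 * conj (a q) + q.1 ^ (i + 1) * conj (b q) := by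
    intro q hq
    rw [hW q hq]
    simp
  have hdpow : ∀ q ∈ S, dbar S (fun q : ℂ × P => q.1 ^ (i + 1)) q = 0 := by
    intro q hq
    induction i + 1 with
    | zero => simp [dbar]
    | succ k ih =>
      simp only [pow_succ]
      rw [dbar_mul hS hq (hdiff (hw.pow k) hq) (hdiff hw hq), dbar_fst hS hq, ih]
      simp
  have h2 : ∀ q ∈ S, dbar S (fun q => conj (W q)) q =
      conj (a q) + conj q.1 * dca q + q.1 ^ (i + 1) * dcb q := by
    intro q hq
    rw [dbar_congr hcW hq, dbar_add hS hq (hdiff (hcw.mul hca) hq) (hdiff ((hw.pow _).mul hcb) hq),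
      dbar_mul hS hq (hdiff hcw hq) (hdiff hca hq), dbar_conj_fst hS hq,
      dbar_mul hS hq (hdiff (hw.pow _) hq) (hdiff hcb hq), hdpow q hq]
    ring
  have h3 := eq_zero_of_conj_pow_mul_eq hS hp (i + 2)
    (c := fun q => conj l * conj (a q) * ((i + 1) * b q + conj q.1 * db q) -
      l * conj q.1 * b q * dca q)
    (d := fun q => l * (a q * (conj q.1 ^ 2 * dca q + q.1 ^ (i + 1) * (conj q.1 * dcb q - conj (b q)))
        + conj q.1 ^ (i + 1) * b q * q.1 ^ i * (conj q.1 * dcb q - conj (b q))) -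
      conj l * (conj q.1 * conj (a q) * conj q.1 * da q + q.1 ^ i * conj (b q) *
        (q.1 * conj q.1 * da q + conj q.1 ^ (i + 1) * ((i + 1) * b q + conj q.1 * db q))))
    (by fun_prop) (by fun_prop) (fun q hq => ?_)
  · simp only [map_zero, zero_mul, add_zero, mul_zero, sub_zero, mul_eq_zero] at h3
    rcases h3 with (h3 | h3) | h3 | h3
    · exact absurd ((map_eq_zero _).1 h3) hl
    · exact .inl ((map_eq_zero _).1 h3)
    · exact absurd h3 (by exact_mod_cast i.succ_ne_zero)
    · exact .inr h3
  · have h4 := hid q hq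
    rw [h1 q hq, h2 q hq, hcW q hq, hW q hq] at h4
    linear_combination h4

variable {C : Set P} {r : ℝ} {W : ℂ × P → ℂ} {lam : ℂ × P → ℝ} {l : ℂ}

/-- As `a ≠ 0` on `w = 0`, the previous lemma gives `b' = 0` there, so `b' = w c + w̄ d`. The term
with `w c` is absorbed into `a'` without changing its values on `w = 0`, and the power of `w̄` goes
up by one. -/
theorem exists_conj_pow_expansion (hr : 0 < r) (hC : Convex ℝ C) (hCu : UniqueDiffOn ℝ C) (hl : l ≠ 0)
    {a b : ℂ × P → ℂ} (ha : ContDiffOn ℝ ∞ a (ball 0 r ×ˢ C))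
    (hb : ContDiffOn ℝ ∞ b (ball 0 r ×ˢ C))
    (hab : ∀ q ∈ ball 0 r ×ˢ C, W q = q.1 * a q + conj q.1 * b q)
    (ha0 : ∀ p ∈ C, a (0, p) ≠ 0)
    (hid : ∀ q ∈ ball 0 r ×ˢ C, conj l * conj q.1 * conj (W q) * dbar (ball 0 r ×ˢ C) W q =
      l * W q * (conj q.1 * dbar (ball 0 r ×ˢ C) (fun q => conj (W q)) q - conj (W q))) (j : ℕ) :
    ∃ a' b' : ℂ × P → ℂ, ContDiffOn ℝ ∞ a' (ball 0 r ×ˢ C) ∧ ContDiffOn ℝ ∞ b' (ball 0 r ×ˢ C) ∧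
      (∀ q ∈ ball 0 r ×ˢ C, W q = q.1 * a' q + conj q.1 ^ (j + 1) * b' q) ∧
      ∀ p ∈ C, a' (0, p) = a (0, p) := by
  have hS : UniqueDiffOn ℝ (ball (0 : ℂ) r ×ˢ C) := isOpen_ball.uniqueDiffOn.prod hCu
  induction j with
  | zero => exact ⟨a, b, ha, hb, by simpa using hab, fun p hp => rfl⟩
  | succ j ih =>
    obtain ⟨a', b', ha', hb', hW, h0⟩ := ih
    have hb0 : ∀ p ∈ C, b' (0, p) = 0 := fun p hp =>
      (mul_eq_zero_of_dbar_identity hS hl ha' hb' j hW hid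
        ⟨mem_ball_self hr, hp⟩).resolve_left (by rw [h0 p hp]; exact ha0 p hp)
    obtain ⟨c, d, hc, hd, hcd⟩ := exists_hadamard_complex (convex_ball (0 : ℂ) r)
      isOpen_ball.uniqueDiffOn (mem_ball_self hr) hC hCu hb' hb0
    refine ⟨fun q => a' q + conj q.1 ^ (j + 1) * c q, d,
      ha'.add ((contDiffOn_fst.conj.pow _).mul hc), hd, fun q hq => ?_, fun p hp => ?_⟩
    · rw [hW q hq, hcd q hq]
      ring
    · simp [h0 p hp]

theorem ne_zero_or_ne_zero_of_not_hasFDerivWithinAt (hr : 0 < r) {a b : ℂ × P → ℂ}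
    (ha : ContDiffOn ℝ ∞ a (ball 0 r ×ˢ C)) (hb : ContDiffOn ℝ ∞ b (ball 0 r ×ˢ C))
    (hab : ∀ q ∈ ball 0 r ×ˢ C, W q = q.1 * a q + conj q.1 * b q) {p₀ : P} (hp₀ : p₀ ∈ C)
    (hd : ¬HasFDerivWithinAt W (0 : ℂ × P →L[ℝ] ℂ) (ball 0 r ×ˢ C) (0, p₀)) :
    a (0, p₀) ≠ 0 ∨ b (0, p₀) ≠ 0 := by
  by_contra! h
  have h0 : ((0 : ℂ), p₀) ∈ ball (0 : ℂ) r ×ˢ C := ⟨mem_ball_self hr, hp₀⟩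
  have hdiff {f : ℂ × P → ℂ} (hf : ContDiffOn ℝ ∞ f (ball 0 r ×ˢ C)) :
      HasFDerivWithinAt f (fderivWithin ℝ f (ball 0 r ×ˢ C) (0, p₀)) (ball 0 r ×ˢ C) (0, p₀) :=
    ((hf _ h0).differentiableWithinAt (by simp)).hasFDerivWithinAt
  have hw : HasFDerivWithinAt (fun q : ℂ × P => conj q.1)
      ((Complex.conjCLE : ℂ →L[ℝ] ℂ).comp (ContinuousLinearMap.fst ℝ ℂ P)) (ball 0 r ×ˢ C) (0, p₀) :=
    ((Complex.conjCLE : ℂ →L[ℝ] ℂ).comp (ContinuousLinearMap.fst ℝ ℂ P)).hasFDerivWithinAt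
  have h1 := ((HasFDerivWithinAt.fun_mul hasFDerivWithinAt_fst (hdiff ha)).fun_add
    (hw.fun_mul (hdiff hb)))
  refine hd ((h1.congr (fun q hq => hab q hq) (hab _ h0)).congr_fderiv ?_)
  ext v <;> simp [h.1, h.2]

/-- If `a` vanished at `(0, p₀)`, then on a small circle `W / w` would be close to `b₀ w̄ / w` and
wind `-2` times around `0`. But `W / w = exp (l lam)` has a continuous logarithm on the circle. -/
theorem ne_zero_of_winding (hr : 0 < r)
    (hlam : ContDiffOn ℝ ∞ lam (ball 0 r ×ˢ C ∩ {q | q.1 ≠ 0}))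
    (hW : ∀ q ∈ ball 0 r ×ˢ C, q.1 ≠ 0 → W q = Complex.exp (l * lam q) * q.1) {a b : ℂ × P → ℂ}
    (ha : ContDiffOn ℝ ∞ a (ball 0 r ×ˢ C)) (hb : ContDiffOn ℝ ∞ b (ball 0 r ×ˢ C))
    (hab : ∀ q ∈ ball 0 r ×ˢ C, W q = q.1 * a q + conj q.1 * b q) {p₀ : P} (hp₀ : p₀ ∈ C)
    (hb0 : b (0, p₀) ≠ 0) : a (0, p₀) ≠ 0 := by
  intro ha0
  set b₀ := b (0, p₀) with hb₀
  have hsl {f : ℂ × P → ℂ} (hf : ContDiffOn ℝ ∞ f (ball 0 r ×ˢ C)) :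
      ContinuousOn (fun w => f (w, p₀)) (ball 0 r) :=
    hf.continuousOn.comp (by fun_prop) fun w hw => ⟨hw, hp₀⟩
  have hcont : ContinuousAt (fun w => ‖a (w, p₀)‖ + ‖b (w, p₀) - b₀‖) 0 :=
    (((hsl ha).norm.add ((hsl hb).sub continuousOn_const).norm)).continuousAt (ball_mem_nhds _ hr)
  have hlt : ∀ᶠ w in 𝓝 (0 : ℂ), ‖a (w, p₀)‖ + ‖b (w, p₀) - b₀‖ < ‖b₀‖ := by
    refine hcont.eventually_lt continuousAt_const ?_
    simp only [ha0, ← hb₀, sub_self, norm_zero, add_zero]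
    exact norm_pos_iff.2 hb0
  obtain ⟨δ, hδ, hδs⟩ := Metric.mem_nhds_iff.1 (hlt.and (ball_mem_nhds 0 hr))
  set ρ := δ / 2 with hρ
  have hρ0 : 0 < ρ := half_pos hδ
  set e : ℝ → ℂ := fun θ => ρ * Complex.exp (θ * Complex.I) with he
  have hec : Continuous e := by fun_prop
  have he0 : ∀ θ, e θ ≠ 0 := fun θ => mul_ne_zero (by exact_mod_cast hρ0.ne') (Complex.exp_ne_zero _)
  have heB : ∀ θ, e θ ∈ ball (0 : ℂ) δ := fun θ => by
    rw [mem_ball_zero_iff, he, norm_mul, Complex.norm_exp_ofReal_mul_I, mul_one]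
    simp only [Complex.norm_real, Real.norm_eq_abs, abs_of_pos hρ0]
    linarith
  have her : ∀ θ, e θ ∈ ball (0 : ℂ) r := fun θ => (hδs (heB θ)).2
  -- This is `exp (2 i θ) (W / w) / b₀` on the circle. It stays within distance `1` of `1`, so its
  -- principal logarithm is continuous.
  set z : ℝ → ℂ := fun θ => (a (e θ, p₀) * Complex.exp (2 * θ * Complex.I) + b (e θ, p₀)) / b₀ with hz
  have hzc : Continuous z := by
    have h1 : Continuous fun θ => a (e θ, p₀) := (hsl ha).comp_continuous hec her
    have h2 : Continuous fun θ => b (e θ, p₀) := (hsl hb).comp_continuous hec her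
    exact ((h1.mul (by fun_prop)).add h2).div_const _
  have hz1 : ∀ θ, z θ ∈ Complex.slitPlane := by
    intro θ
    refine Complex.mem_slitPlane_of_norm_lt_one (z := z θ - 1) ?_ |> fun h => by simpa using h
    have h1 : z θ - 1 = (a (e θ, p₀) * Complex.exp (2 * θ * Complex.I) + (b (e θ, p₀) - b₀)) / b₀ := by
      rw [hz]
      field_simp
      ring
    rw [h1, norm_div, div_lt_one (norm_pos_iff.2 hb0)]
    refine (norm_add_le _ _).trans_lt ?_
    have h2 : ‖Complex.exp (2 * θ * Complex.I)‖ = 1 := by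
      have := Complex.norm_exp_ofReal_mul_I (2 * θ)
      push_cast at this
      exact this
    rw [norm_mul, h2, mul_one]
    exact (hδs (heB θ)).1
  have hz0 : ∀ θ, z θ ≠ 0 := fun θ => Complex.slitPlane_ne_zero (hz1 θ)
  have hlc : Continuous fun θ => lam (e θ, p₀) :=
    hlam.continuousOn.comp_continuous (by fun_prop) fun θ => ⟨⟨her θ, hp₀⟩, he0 θ⟩
  -- `D` is a continuous logarithm of the constant `b₀`, hence constant. Yet from `0` to `2π` it
  -- changes by `4πi`, the other two terms being periodic.
  set D : ℝ → ℂ := fun θ => l * lam (e θ, p₀) + 2 * θ * Complex.I - Complex.log (z θ) with hD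
  have hDc : Continuous D :=
    ((continuous_const.mul (Complex.continuous_ofReal.comp hlc)).add
      (by fun_prop : Continuous fun θ : ℝ => 2 * (θ : ℂ) * Complex.I)).sub (hzc.clog hz1)
  have hDe : ∀ θ, Complex.exp (D θ) = b₀ := by
    intro θ
    rw [hD, Complex.exp_sub, Complex.exp_log (hz0 θ), div_eq_iff (hz0 θ), Complex.exp_add]
    have h1 := hW (e θ, p₀) ⟨her θ, hp₀⟩ (he0 θ)
    rw [hab _ ⟨her θ, hp₀⟩] at h1
    have h2 : conj (e θ) = ρ * Complex.exp (-(θ * Complex.I)) := by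
      rw [he, map_mul, ← Complex.exp_conj]
      simp
    have h3 : Complex.exp (2 * θ * Complex.I) = Complex.exp (θ * Complex.I) * Complex.exp (θ * Complex.I) := by
      rw [← Complex.exp_add]; ring_nf
    have h4 : Complex.exp (θ * Complex.I) * Complex.exp (-(θ * Complex.I)) = 1 := by
      rw [← Complex.exp_add]; simp
    have h5 : b₀ * z θ = a (e θ, p₀) * Complex.exp (2 * θ * Complex.I) + b (e θ, p₀) := by
      rw [hz]; field_simp
    rw [h5, h3]
    simp only [h2] at h1
    have hρC : (ρ : ℂ) ≠ 0 := by exact_mod_cast hρ0.ne'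
    have h6 : (ρ : ℂ) * (Complex.exp (l * lam (e θ, p₀)) * (Complex.exp (θ * Complex.I) * Complex.exp (θ * Complex.I))) =
      ρ * (a (e θ, p₀) * (Complex.exp (θ * Complex.I) * Complex.exp (θ * Complex.I)) + b (e θ, p₀)) := by
      simp only [he] at h1 ⊢
      linear_combination (-Complex.exp (θ * Complex.I)) * h1 + (ρ * b (e θ, p₀)) * h4
    exact mul_left_cancel₀ hρC h6
  have hconst := isPreconnected_univ.eq_of_exp_eq hDc.continuousOn (fun θ _ => hDe θ)
    (mem_univ 0) (mem_univ (2 * Real.pi))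
  have he2 : e (2 * Real.pi) = e 0 := by
    simp only [he]
    push_cast
    rw [Complex.exp_two_pi_mul_I]
    simp
  have hz2 : z (2 * Real.pi) = z 0 := by
    have h1 : Complex.exp (2 * ((2 * Real.pi : ℝ) : ℂ) * Complex.I) = 1 := by
      push_cast
      rw [show (2 * (2 * Real.pi) * Complex.I : ℂ) = 2 * Real.pi * Complex.I + 2 * Real.pi * Complex.I
        by ring, Complex.exp_add, Complex.exp_two_pi_mul_I, one_mul]
    simp only [hz, he2, h1]
    simp
  simp only [hD, he2, hz2] at hconst
  have h7 : (Real.pi : ℂ) * Complex.I = 0 := by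
    push_cast at hconst
    linear_combination (-1 / 4) * hconst
  simp [Real.pi_ne_zero] at h7

/-- The quotient `W / w` extends smoothly across `w = 0`. -/
theorem exists_contDiffOn_quotient (hr : 0 < r) (hC : Convex ℝ C) (hCu : UniqueDiffOn ℝ C) (hl : l ≠ 0)
    (hWs : ContDiffOn ℝ ∞ W (ball 0 r ×ˢ C))
    (hlam : ContDiffOn ℝ ∞ lam (ball 0 r ×ˢ C ∩ {q | q.1 ≠ 0}))
    (hW : ∀ q ∈ ball 0 r ×ˢ C, q.1 ≠ 0 → W q = Complex.exp (l * lam q) * q.1)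
    (hW0 : ∀ q ∈ ball 0 r ×ˢ C, q.1 = 0 → W q = 0) {p₀ : P} (hp₀ : p₀ ∈ C)
    (hd : ¬HasFDerivWithinAt W (0 : ℂ × P →L[ℝ] ℂ) (ball 0 r ×ˢ C) (0, p₀)) :
    ∃ r' > 0, r' ≤ r ∧ ∃ u : ℂ × P → ℂ, ContDiffOn ℝ ∞ u (ball 0 r ×ˢ (C ∩ ball p₀ r')) ∧
      (∀ p ∈ C ∩ ball p₀ r', u (0, p) ≠ 0) ∧ ∀ q ∈ ball 0 r ×ˢ C, W q = q.1 * u q := by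
  obtain ⟨a, b, ha, hb, hab⟩ := exists_hadamard_complex (convex_ball (0 : ℂ) r)
    isOpen_ball.uniqueDiffOn (mem_ball_self hr) hC hCu hWs
    (fun p hp => hW0 (0, p) ⟨mem_ball_self hr, hp⟩ rfl)
  have ha0 : a (0, p₀) ≠ 0 := by
    rcases ne_zero_or_ne_zero_of_not_hasFDerivWithinAt hr ha hb hab hp₀ hd with h | h
    · exact h
    · exact ne_zero_of_winding hr hlam hW ha hb hab hp₀ h
  have hca : ContinuousWithinAt (fun p => a (0, p)) C p₀ :=
    (ha.continuousOn.comp (by fun_prop) fun p hp => ⟨mem_ball_self hr, hp⟩ :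
      ContinuousOn (fun p => a (0, p)) C) p₀ hp₀
  obtain ⟨δ, hδ, hδs⟩ := Metric.mem_nhdsWithin_iff.1 (hca.eventually_ne ha0)
  have hne : ∀ p ∈ C ∩ ball p₀ (min δ r), a (0, p) ≠ 0 := fun p hp =>
    hδs ⟨ball_subset_ball (min_le_left _ _) hp.2, hp.1⟩
  have hsub : ball (0 : ℂ) r ×ˢ (C ∩ ball p₀ (min δ r)) ⊆ ball 0 r ×ˢ C :=
    prod_mono_right inter_subset_left
  have hCu' : UniqueDiffOn ℝ (C ∩ ball p₀ (min δ r)) := hCu.inter isOpen_ball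
  have hS' : UniqueDiffOn ℝ (ball (0 : ℂ) r ×ˢ (C ∩ ball p₀ (min δ r))) :=
    isOpen_ball.uniqueDiffOn.prod hCu'
  refine ⟨min δ r, lt_min hδ hr, min_le_right _ _,
    fun q => if q.1 = 0 then a (0, q.2) else W q / q.1, ?_, ?_, ?_⟩
  · rw [contDiffOn_infty]
    intro n
    -- For `C^n` smoothness, step `n + 1` of the expansion suffices: it gives `W / w = a' + b'
    -- w̄^(n+2) / w`, whose last factor is `C^n`.
    obtain ⟨a', b', ha', hb', h1, h2⟩ := exists_conj_pow_expansion hr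
      (hC.inter (convex_ball p₀ (min δ r))) hCu' hl (ha.mono hsub) (hb.mono hsub)
      (fun q hq => hab q (hsub hq)) hne (fun q hq => dbar_identity hS'
        (hlam.mono (inter_subset_inter_left _ hsub)) (fun q hq => hW q (hsub hq))
        (fun q hq => hW0 q (hsub hq)) hq) (n + 1)
    have h3 : ContDiffOn ℝ n (fun q : ℂ × P => a' q + b' q * (conj q.1 ^ (n + 1 + 1) * q.1⁻¹ ^ 1))
        (ball (0 : ℂ) r ×ˢ (C ∩ ball p₀ (min δ r))) :=
      (ha'.of_le (by exact_mod_cast le_top)).add ((hb'.of_le (by exact_mod_cast le_top)).mul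
        ((contDiff_conj_pow_mul_inv_pow n (by omega)).comp contDiff_fst).contDiffOn)
    refine h3.congr fun q hq => ?_
    obtain ⟨w, p⟩ := q
    dsimp only
    split_ifs with h
    · subst h
      rw [map_zero, zero_pow (by omega), zero_mul, mul_zero, add_zero]
      exact (h2 p hq.2).symm
    · rw [h1 _ hq]
      field_simp
  · intro p hp
    simpa using hne p hp
  · intro q hq
    dsimp only
    split_ifs with h
    · rw [hW0 q hq h, h, zero_mul]
    · field_simp

/-- Division by a non-real eigenvalue: the time function extends smoothly across `w = 0`. -/
theorem exists_contDiffOn_extension_complex (hr : 0 < r) (hC : Convex ℝ C) (hCu : UniqueDiffOn ℝ C)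
    (hl : l ≠ 0) (hWs : ContDiffOn ℝ ∞ W (ball 0 r ×ˢ C))
    (hlam : ContDiffOn ℝ ∞ lam (ball 0 r ×ˢ C ∩ {q | q.1 ≠ 0}))
    (hW : ∀ q ∈ ball 0 r ×ˢ C, q.1 ≠ 0 → W q = Complex.exp (l * lam q) * q.1)
    (hW0 : ∀ q ∈ ball 0 r ×ˢ C, q.1 = 0 → W q = 0) {p₀ : P} (hp₀ : p₀ ∈ C)
    (hd : ¬HasFDerivWithinAt W (0 : ℂ × P →L[ℝ] ℂ) (ball 0 r ×ˢ C) (0, p₀)) :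
    ∃ ρ > 0, ρ ≤ r ∧ ∃ L : ℂ × P → ℝ, ContDiffOn ℝ ∞ L (ball 0 ρ ×ˢ (C ∩ ball p₀ ρ)) ∧
      ∀ q ∈ ball 0 ρ ×ˢ (C ∩ ball p₀ ρ), q.1 ≠ 0 → L q = lam q := by
  obtain ⟨r', hr', hrr, u, hu, hu0, huW⟩ := exists_contDiffOn_quotient hr hC hCu hl hWs hlam hW hW0
    hp₀ hd
  have h0 : ((0 : ℂ), p₀) ∈ ball (0 : ℂ) r ×ˢ (C ∩ ball p₀ r') :=
    ⟨mem_ball_self hr, hp₀, mem_ball_self hr'⟩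
  set u₀ := u (0, p₀) with hu₀
  have hu₀' : u₀ ≠ 0 := hu0 p₀ h0.2
  have hev : ∀ᶠ q in 𝓝[ball 0 r ×ˢ (C ∩ ball p₀ r')] ((0 : ℂ), p₀), u q / u₀ ∈ Complex.slitPlane := by
    refine ((hu.continuousOn.div_const u₀) _ h0).eventually_mem
      (Complex.isOpen_slitPlane.mem_nhds ?_)
    change u₀ / u₀ ∈ Complex.slitPlane
    rw [div_self hu₀']
    exact Complex.one_mem_slitPlane
  obtain ⟨δ, hδ, hδs⟩ := Metric.mem_nhdsWithin_iff.1 hev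
  set ρ := min δ r' with hρ
  have hρ0 : 0 < ρ := lt_min hδ hr'
  have hρr : ρ ≤ r := (min_le_right _ _).trans hrr
  have hsub : ball (0 : ℂ) ρ ×ˢ (C ∩ ball p₀ ρ) ⊆ ball 0 r ×ˢ (C ∩ ball p₀ r') :=
    prod_mono (ball_subset_ball hρr)
      (inter_subset_inter_right _ (ball_subset_ball (min_le_right _ _)))
  have hsubC : ball (0 : ℂ) ρ ×ˢ (C ∩ ball p₀ ρ) ⊆ ball 0 r ×ˢ C :=
    hsub.trans (prod_mono_right inter_subset_left)
  have hslit : ∀ q ∈ ball (0 : ℂ) ρ ×ˢ (C ∩ ball p₀ ρ), u q / u₀ ∈ Complex.slitPlane := by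
    intro q hq
    refine hδs ⟨?_, hsub hq⟩
    rw [← ball_prod_same]
    exact ⟨ball_subset_ball (min_le_left _ _) hq.1, ball_subset_ball (min_le_left _ _) hq.2.2⟩
  have hlog : ContDiffOn ℝ ∞ (fun q => Complex.log (u q / u₀)) (ball (0 : ℂ) ρ ×ˢ (C ∩ ball p₀ ρ)) := by
    intro q hq
    have h1 : ContDiffAt ℝ ∞ Complex.log (u q / u₀) :=
      (Complex.contDiffAt_log (hslit q hq)).restrict_scalars ℝ
    exact h1.comp_contDiffWithinAt q (((hu.mono hsub).div_const u₀) q hq)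
  -- Off `w = 0`, `l lam` and `log (u / u₀)` are continuous logarithms of `u` and `u / u₀`. The
  -- punctured domain is connected, so they differ by a constant `c`, and `(log (u / u₀) + c) / l`
  -- extends `lam`.
  have hexp : ∀ q ∈ (ball (0 : ℂ) ρ \ {0}) ×ˢ (C ∩ ball p₀ ρ),
      Complex.exp (l * lam q - Complex.log (u q / u₀)) = u₀ := by
    rintro q ⟨⟨hq1, hq0⟩, hq2⟩
    have hq : q ∈ ball (0 : ℂ) ρ ×ˢ (C ∩ ball p₀ ρ) := ⟨hq1, hq2⟩
    have h1 := Complex.slitPlane_ne_zero (hslit q hq)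
    have h2 : u q = Complex.exp (l * lam q) := by
      refine mul_left_cancel₀ (show q.1 ≠ 0 from hq0) ?_
      rw [← huW q (hsubC hq), hW q (hsubC hq) hq0, mul_comm]
    rw [Complex.exp_sub, Complex.exp_log h1, ← h2, div_div_eq_mul_div]
    have : u q ≠ 0 := by rw [h2]; exact Complex.exp_ne_zero _
    field_simp
  have hpre : IsPreconnected ((ball (0 : ℂ) ρ \ {0}) ×ˢ (C ∩ ball p₀ ρ)) :=
    (isPreconnected_ball_diff_zero ρ).prod (hC.inter (convex_ball p₀ ρ)).isPreconnected
  have hsub2 : (ball (0 : ℂ) ρ \ {0}) ×ˢ (C ∩ ball p₀ ρ) ⊆ ball (0 : ℂ) ρ ×ˢ (C ∩ ball p₀ ρ) :=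
    prod_mono_left sdiff_subset
  have hcont : ContinuousOn (fun q => l * lam q - Complex.log (u q / u₀))
      ((ball (0 : ℂ) ρ \ {0}) ×ˢ (C ∩ ball p₀ ρ)) :=
    (continuousOn_const.mul (Complex.continuous_ofReal.comp_continuousOn
      (hlam.continuousOn.mono fun q hq => ⟨hsubC (hsub2 hq), hq.1.2⟩))).sub
      (hlog.continuousOn.mono hsub2)
  have hbase : (((ρ / 2 : ℝ) : ℂ), p₀) ∈ (ball (0 : ℂ) ρ \ {0}) ×ˢ (C ∩ ball p₀ ρ) := by
    refine ⟨⟨?_, ?_⟩, hp₀, mem_ball_self hρ0⟩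
    · rw [mem_ball_zero_iff, Complex.norm_real, Real.norm_eq_abs, abs_of_pos (half_pos hρ0)]
      exact half_lt_self hρ0
    · exact Complex.ofReal_ne_zero.2 (half_pos hρ0).ne'
  obtain ⟨c, hc⟩ : ∃ c : ℂ, ∀ q ∈ (ball (0 : ℂ) ρ \ {0}) ×ˢ (C ∩ ball p₀ ρ),
      l * lam q - Complex.log (u q / u₀) = c :=
    ⟨_, fun q hq => hpre.eq_of_exp_eq hcont hexp hq hbase⟩
  refine ⟨ρ, hρ0, hρr, fun q => ((Complex.log (u q / u₀) + c) / l).re,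
    Complex.reCLM.contDiff.comp_contDiffOn ((hlog.add contDiffOn_const).div_const l), ?_⟩
  intro q hq h
  have h1 := hc q ⟨⟨hq.1, h⟩, hq.2⟩
  have h2 : (Complex.log (u q / u₀) + c) / l = lam q := by
    rw [div_eq_iff hl]
    linear_combination -h1
  simp only [h2, Complex.ofReal_re]

end ComplexDivision

/-! ### Dual eigenvectors and Jordan chains of a nonzero matrix -/

section LinearDivision

open Metric Filter Matrix

/-- If `0` is the only root of the characteristic polynomial, that polynomial is a power of `X`, and
Cayley–Hamilton makes `B` nilpotent. Otherwise a nonzero root is an eigenvalue of the transpose. -/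
theorem Matrix.exists_eigenvector_or_pow_eq_zero {m : ℕ} (B : Matrix (Fin m) (Fin m) ℂ) :
    (∃ (v : Fin m → ℂ) (l : ℂ), v ≠ 0 ∧ l ≠ 0 ∧ v ᵥ* B = l • v) ∨ ∃ k, B ^ k = 0 := by
  by_cases h : ∀ z ∈ B.charpoly.roots, z = 0
  · right
    refine ⟨Multiset.card B.charpoly.roots, ?_⟩
    have h1 := (IsAlgClosed.splits B.charpoly).eq_prod_roots_of_monic B.charpoly_monic
    rw [Multiset.eq_replicate_card.2 h, Multiset.map_replicate, Multiset.prod_replicate] at h1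
    have h2 := B.aeval_self_charpoly
    rw [h1] at h2
    simpa using h2
  · left
    push Not at h
    obtain ⟨l, hl, hl0⟩ := h
    have h1 : Bᵀ.charpoly.IsRoot l := by
      rw [Matrix.charpoly_transpose]
      exact Polynomial.isRoot_of_mem_roots hl
    have h2 : Module.End.HasEigenvalue (Matrix.toLin' Bᵀ) l := by
      rw [Module.End.hasEigenvalue_iff_isRoot_charpoly, ← Matrix.charpoly_toLin'] at *
      simpa using h1
    obtain ⟨v, hv⟩ := h2.exists_hasEigenvector
    refine ⟨v, l, hv.2, hl0, ?_⟩
    have h3 := hv.apply_eq_smul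
    rwa [Matrix.toLin'_apply, Matrix.mulVec_transpose] at h3

/-- A non-zero linear endomorphism has a dual eigenvector with non-zero real or non-real eigenvalue,
or a dual Jordan chain of length two with eigenvalue zero. -/
theorem exists_dual_eigenvector {m : ℕ} {B : Matrix (Fin m) (Fin m) ℝ} (hB : B ≠ 0)
    {A : EuclideanSpace ℝ (Fin m) →L[ℝ] EuclideanSpace ℝ (Fin m)}
    (hA : ∀ y, A y = WithLp.toLp 2 (B *ᵥ WithLp.ofLp y)) :
    (∃ (ξ : EuclideanSpace ℝ (Fin m) →L[ℝ] ℝ) (l : ℝ), ξ ≠ 0 ∧ l ≠ 0 ∧ ∀ y, ξ (A y) = l * ξ y) ∨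
    (∃ (ξ : EuclideanSpace ℝ (Fin m) →L[ℝ] ℂ) (l : ℂ), Function.Surjective ξ ∧ l ≠ 0 ∧
      ∀ y, ξ (A y) = l * ξ y) ∨
    ∃ ξ : EuclideanSpace ℝ (Fin m) →L[ℝ] ℝ, ξ.comp A ≠ 0 ∧ ∀ y, ξ (A (A y)) = 0 := by
  rcases (B.map Complex.ofReal).exists_eigenvector_or_pow_eq_zero with ⟨v, l, hv, hl, h⟩ | ⟨k, hk⟩
  · set ξ : EuclideanSpace ℝ (Fin m) →L[ℝ] ℂ :=
      LinearMap.toContinuousLinearMap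
        { toFun := fun y => v ⬝ᵥ fun i => (y i : ℂ)
          map_add' := fun y z => by
            simp [dotProduct, mul_add, Finset.sum_add_distrib]
          map_smul' := fun c y => by
            simp [dotProduct, Finset.mul_sum, mul_left_comm] } with hξ
    have hξa : ∀ y, ξ y = v ⬝ᵥ fun i => (y i : ℂ) := fun y => rfl
    have hξA : ∀ y, ξ (A y) = l * ξ y := by
      intro y
      have h1 : (fun i => ((A y) i : ℂ)) = B.map Complex.ofReal *ᵥ fun i => (y i : ℂ) := by
        funext i
        rw [hA]
        simp [mulVec, dotProduct]
      rw [hξa, h1, dotProduct_mulVec, h, smul_dotProduct, hξa, smul_eq_mul]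
    have hξ0 : ∃ y, ξ y ≠ 0 := by
      by_contra! h0
      refine hv (funext fun i => ?_)
      have := h0 (EuclideanSpace.single i 1)
      rw [hξa] at this
      have h2 : (fun j => ((EuclideanSpace.single i (1 : ℝ) : EuclideanSpace ℝ (Fin m)) j : ℂ)) =
          Pi.single i 1 := by
        funext j
        by_cases hj : j = i <;> simp [hj]
      rwa [h2, dotProduct_single_one] at this
    obtain ⟨y₀, hy₀⟩ := hξ0
    -- The range of `ξ` is a nonzero real subspace of `ℂ`. If it is a line, then `l` is real, and
    -- division by `ξ y₀` makes `ξ` real-valued.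
    by_cases hs : Function.Surjective ξ
    · exact .inr (.inl ⟨ξ, l, hs, hl, hξA⟩)
    · left
      have hreal : ∀ y, ∃ t : ℝ, ξ y = t * ξ y₀ := by
        intro y
        by_contra! hy
        refine hs fun z => ?_
        set c := ξ y / ξ y₀ with hc
        have hcim : c.im ≠ 0 := by
          intro h0
          refine hy c.re ?_
          rw [show ((c.re : ℝ) : ℂ) = c from Complex.ext rfl (by simp [h0]), hc, div_mul_cancel₀ _ hy₀]
        set d := z / ξ y₀ with hd
        refine ⟨(d.im / c.im) • y + (d.re - d.im / c.im * c.re) • y₀, ?_⟩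
        have h1 : z = d * ξ y₀ := by rw [hd, div_mul_cancel₀ _ hy₀]
        have h2 : ξ y = c * ξ y₀ := by rw [hc, div_mul_cancel₀ _ hy₀]
        rw [map_add, map_smul, map_smul, h1, h2, Complex.real_smul, Complex.real_smul, ← mul_assoc,
          ← add_mul]
        congr 1
        apply Complex.ext
        · simp
        · simp [hcim]
      obtain ⟨t, ht⟩ := hreal (A y₀)
      have hlt : l = t := by
        rw [hξA] at ht
        exact mul_right_cancel₀ hy₀ ht
      refine ⟨Complex.reCLM.comp ((((ξ y₀)⁻¹ • ContinuousLinearMap.id ℝ ℂ)).comp ξ), t, ?_, ?_, ?_⟩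
      · intro h0
        have := congrArg (fun f => f y₀) h0
        simp [hy₀] at this
      · rintro rfl
        exact hl (by simpa using hlt)
      · intro y
        simp only [ContinuousLinearMap.comp_apply, hξA, hlt]
        simp
        ring
  · right; right
    have hk' : ∃ k, B ^ k = 0 := by
      refine ⟨k, ?_⟩
      have h1 : (B ^ k).map Complex.ofReal = 0 := by
        have := Matrix.map_pow B Complex.ofRealHom k
        exact this.trans hk
      ext i j
      have := congrFun (congrFun h1 i) j
      simpa using this
    classical
    have hn := Nat.find_spec hk'
    have hmin : ∀ j < Nat.find hk', B ^ j ≠ 0 := fun j hj => Nat.find_min hk' hj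
    set n := Nat.find hk'
    have hm : Nonempty (Fin m) := by
      by_contra hm
      rw [not_nonempty_iff] at hm
      exact hB (Subsingleton.elim _ _)
    obtain ⟨n', hn'⟩ : ∃ n', n = n' + 2 := by
      refine ⟨n - 2, ?_⟩
      have h0 : n ≠ 0 := fun h0 => by rw [h0, pow_zero] at hn; exact one_ne_zero hn
      have h1 : n ≠ 1 := fun h1 => by rw [h1, pow_one] at hn; exact hB hn
      -- The nilpotency index `n` is at least `2` because `B ≠ 0`. The functional sought is a row of
      -- `B ^ (n - 2)` for which the same row of `B ^ (n - 1)` is nonzero.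
      omega
    have h1 := hmin (n' + 1) (by omega)
    obtain ⟨i, hi⟩ : ∃ i, (B ^ (n' + 1)) i ≠ 0 := by
      by_contra! h
      exact h1 (funext h)
    obtain ⟨j, hj⟩ : ∃ j, (B ^ (n' + 1)) i j ≠ 0 := by
      by_contra! h
      exact hi (funext h)
    have hAp : ∀ (s : ℕ) y, (B ^ s) *ᵥ WithLp.ofLp (A y) = (B ^ (s + 1)) *ᵥ WithLp.ofLp y := by
      intro s y
      rw [hA, pow_succ]
      simp
    set ξ : EuclideanSpace ℝ (Fin m) →L[ℝ] ℝ := (EuclideanSpace.proj i).comp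
      (LinearMap.toContinuousLinearMap (Matrix.toEuclideanLin (B ^ n'))) with hξ
    have hξa : ∀ y, ξ y = ((B ^ n') *ᵥ WithLp.ofLp y) i := fun y => rfl
    refine ⟨ξ, fun h0 => ?_, fun y => ?_⟩
    · have h2 := congrArg (fun f => f (EuclideanSpace.single j 1)) h0
      simp only [ContinuousLinearMap.comp_apply, hξa, hAp] at h2
      refine hj ?_
      simpa using h2
    · rw [hξa, hAp, hAp, show n' + 1 + 1 = n by omega, hn]
      simp

end LinearDivision

/-! ### The division theorem for flows of linear vector fields -/

section DivisionTheorem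

open Metric Filter

theorem eq_exp_mul_of_hasDerivAt {g : ℝ → ℂ} {l : ℂ} {T : ℝ}
    (h : ∀ s ∈ uIcc 0 T, HasDerivAt g (l * g s) s) : g T = Complex.exp (l * T) * g 0 := by
  have h1 : ∀ s ∈ uIcc 0 T, HasDerivAt (fun s : ℝ => Complex.exp (-(l * s)) * g s) 0 s := by
    intro s hs
    have h2 : HasDerivAt (fun s : ℝ => -(l * (s : ℂ))) (-(l * 1)) s :=
      ((Complex.ofRealCLM.hasDerivAt (x := s)).const_mul l).neg
    exact (h2.cexp.mul (h s hs)).congr_deriv (by ring)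
  have h3 := (convex_uIcc (0 : ℝ) T).norm_image_sub_le_of_norm_hasDerivWithin_le (C := 0)
    (fun s hs => (h1 s hs).hasDerivWithinAt) (fun s hs => by simp) left_mem_uIcc right_mem_uIcc
  rw [zero_mul, norm_le_zero_iff, sub_eq_zero] at h3
  simp only [Complex.ofReal_zero, mul_zero, neg_zero, Complex.exp_zero, one_mul] at h3
  rw [← h3, ← mul_assoc, ← Complex.exp_add]
  simp

theorem eq_of_hasDerivAt_zero {g : ℝ → ℝ} {T : ℝ} (h : ∀ s ∈ uIcc 0 T, HasDerivAt g 0 s) {s : ℝ}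
    (hs : s ∈ uIcc 0 T) : g s = g 0 := by
  have h3 := (convex_uIcc (0 : ℝ) T).norm_image_sub_le_of_norm_hasDerivWithin_le (C := 0)
    (fun s hs => (h s hs).hasDerivWithinAt) (fun s hs => by simp) left_mem_uIcc hs
  rwa [zero_mul, norm_le_zero_iff, sub_eq_zero] at h3

theorem sub_eq_mul_of_hasDerivAt {g : ℝ → ℝ} {c T : ℝ} (h : ∀ s ∈ uIcc 0 T, HasDerivAt g c s) :
    g T - g 0 = T * c := by
  have h1 : ∀ s ∈ uIcc 0 T, HasDerivAt (fun s => g s - s * c) 0 s := fun s hs =>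
    ((h s hs).sub ((hasDerivAt_id s).mul_const c)).congr_deriv (by simp)
  have h2 := eq_of_hasDerivAt_zero h1 right_mem_uIcc
  simp only [zero_mul, sub_zero] at h2
  linarith

variable {V P G : Type} [NormedAddCommGroup V] [NormedSpace ℝ V] [NormedAddCommGroup P]
  [NormedSpace ℝ P] [NormedAddCommGroup G] [NormedSpace ℝ G] {C : Set P} {y₀ : V} {r : ℝ}

omit [NormedSpace ℝ P] in
/-- Two functions which are continuous where a linear map `A` is non-zero agree there as soon as
they agree where some non-zero linear map `ξ` is non-zero. -/
theorem eq_of_eq_of_ne_zero {V' V'' Y : Type*} [NormedAddCommGroup V'] [NormedSpace ℝ V']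
    [NormedAddCommGroup V''] [NormedSpace ℝ V''] [TopologicalSpace Y] [T2Space Y]
    {A : V →L[ℝ] V'} {ξ : V →L[ℝ] V''} (hξ : ξ ≠ 0) {f g : V × P → Y}
    (hf : ContinuousOn f ((ball y₀ r ×ˢ C) ∩ {q | A q.1 ≠ 0}))
    (hg : ContinuousOn g ((ball y₀ r ×ˢ C) ∩ {q | A q.1 ≠ 0}))
    (h : ∀ q ∈ ball y₀ r ×ˢ C, A q.1 ≠ 0 → ξ q.1 ≠ 0 → f q = g q) {q : V × P}
    (hq : q ∈ ball y₀ r ×ˢ C) (hA : A q.1 ≠ 0) : f q = g q := by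
  by_cases hq0 : ξ q.1 = 0
  swap
  · exact h q hq hA hq0
  obtain ⟨v, hv⟩ : ∃ v, ξ v ≠ 0 := by
    by_contra! h0
    exact hξ (ContinuousLinearMap.ext h0)
  have hc : Continuous fun t : ℝ => (q.1 + t • v, q.2) := by fun_prop
  have hev : ∀ᶠ t in 𝓝 (0 : ℝ), (q.1 + t • v, q.2) ∈ (ball y₀ r ×ˢ C) ∩ {q | A q.1 ≠ 0} := by
    have h1 : ∀ᶠ t in 𝓝 (0 : ℝ), q.1 + t • v ∈ ball y₀ r ∩ {y | A y ≠ 0} := by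
      have h2 : ContinuousAt (fun t : ℝ => q.1 + t • v) 0 := by fun_prop
      refine h2.eventually_mem ?_
      simp only [zero_smul, add_zero]
      exact (isOpen_ball.inter (isOpen_ne_fun A.continuous continuous_const)).mem_nhds ⟨hq.1, hA⟩
    exact h1.mono fun t ht => ⟨⟨ht.1, hq.2⟩, ht.2⟩
  have ht : Tendsto (fun t : ℝ => (q.1 + t • v, q.2)) (𝓝[≠] 0)
      (𝓝[(ball y₀ r ×ˢ C) ∩ {q | A q.1 ≠ 0}] q) := by
    refine tendsto_nhdsWithin_iff.2 ⟨?_, hev.filter_mono nhdsWithin_le_nhds⟩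
    have := hc.tendsto 0
    simp only [zero_smul, add_zero] at this
    exact this.mono_left nhdsWithin_le_nhds
  refine tendsto_nhds_unique_of_eventuallyEq ((hf q ⟨hq, hA⟩).tendsto.comp ht)
    ((hg q ⟨hq, hA⟩).tendsto.comp ht) ?_
  filter_upwards [hev.filter_mono nhdsWithin_le_nhds, self_mem_nhdsWithin] with t ht ht0
  refine h _ ht.1 ht.2 ?_
  simp only [map_add, map_smul, hq0, zero_add]
  exact smul_ne_zero ht0 hv

/-- Linear coordinates adapted to a surjective linear map `ξ`. -/
theorem exists_coordinates [FiniteDimensional ℝ V] {W : Type} [NormedAddCommGroup W]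
    [NormedSpace ℝ W] [FiniteDimensional ℝ W] {ξ : V →L[ℝ] W} (hξ : Function.Surjective ξ)
    (hy₀ : ξ y₀ = 0) :
    ∃ (T : V × P → W × (LinearMap.ker (ξ : V →ₗ[ℝ] W) × P))
      (T' : W × (LinearMap.ker (ξ : V →ₗ[ℝ] W) × P) → V × P),
      ContDiff ℝ ∞ T ∧ ContDiff ℝ ∞ T' ∧ (∀ q, T' (T q) = q) ∧ (∀ q, T (T' q) = q) ∧
      (∀ q, (T q).1 = ξ q.1) ∧ (∀ q, (T q).2.2 = q.2) ∧ (∀ q, (T' q).2 = q.2.2) ∧ (∀ p, T (y₀, p) = (0, (0, p))) ∧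
      (∀ r > 0, ∃ δ > 0, ∀ q, q.1 ∈ ball (0 : W) δ → q.2.1 ∈ ball 0 δ → (T' q).1 ∈ ball y₀ r) ∧
      (∀ r > 0, ∃ δ > 0, ∀ q, q.1 ∈ ball y₀ δ → (T q).1 ∈ ball 0 r ∧ (T q).2.1 ∈ ball 0 r) := by
  -- A right inverse of `ξ` splits `V` as `W × ker ξ`, here centred at `y₀`. The kernel directions
  -- then join the parameters.
  obtain ⟨s, hs⟩ := ξ.exists_rightInverse_of_surjective (LinearMap.range_eq_top.2 hξ)
  have hs' : Function.RightInverse s ξ := fun w => congrArg (fun f => f w) hs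
  set e := ContinuousLinearEquiv.equivOfRightInverse ξ s hs' with he
  have he1 : ∀ v, (e v).1 = ξ v := fun v => rfl
  refine ⟨fun q => ((e (q.1 - y₀)).1, ((e (q.1 - y₀)).2, q.2)),
    fun q => (y₀ + e.symm (q.1, q.2.1), q.2.2), ?_, ?_, ?_, ?_, ?_, fun q => rfl, fun q => rfl, ?_, ?_, ?_⟩
  · have h1 : ContDiff ℝ ∞ fun q : V × P => e (q.1 - y₀) :=
      e.contDiff.comp (contDiff_fst.sub contDiff_const)
    exact h1.fst.prodMk (h1.snd.prodMk contDiff_snd)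
  · have h1 : ContDiff ℝ ∞ fun q : W × (LinearMap.ker (ξ : V →ₗ[ℝ] W) × P) =>
        e.symm (q.1, q.2.1) := e.symm.contDiff.comp (contDiff_fst.prodMk contDiff_snd.fst)
    exact (contDiff_const.add h1).prodMk contDiff_snd.snd
  · intro q
    simp only [Prod.mk.eta, ContinuousLinearEquiv.symm_apply_apply, add_sub_cancel]
  · intro q
    simp
  · intro q
    simp [he1, hy₀]
  · intro p
    simp
  · intro r hr
    have h1 : ContinuousAt (fun k : W × LinearMap.ker (ξ : V →ₗ[ℝ] W) => y₀ + e.symm k) (0, 0) :=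
      (continuous_const.add e.symm.continuous).continuousAt
    have h2 : y₀ + e.symm ((0 : W), (0 : LinearMap.ker (ξ : V →ₗ[ℝ] W))) = y₀ := by
      rw [← Prod.zero_eq_mk, map_zero, add_zero]
    obtain ⟨δ, hδ, h3⟩ := Metric.eventually_nhds_iff_ball.1 (h1.eventually_mem
      (by rw [h2]; exact ball_mem_nhds y₀ hr))
    refine ⟨δ, hδ, fun q hq1 hq2 => h3 (q.1, q.2.1) ?_⟩
    rw [← ball_prod_same]
    exact ⟨hq1, hq2⟩
  · intro r hr
    have h1 : ContinuousAt (fun v : V => e (v - y₀)) y₀ := by fun_prop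
    obtain ⟨δ, hδ, h3⟩ := Metric.eventually_nhds_iff_ball.1 (h1.eventually_mem
      (by rw [sub_self, map_zero]; exact ball_mem_nhds 0 hr))
    refine ⟨δ, hδ, fun q hq => ?_⟩
    have := h3 q.1 hq
    rw [Prod.zero_eq_mk, ← ball_prod_same] at this
    exact this

/-- Hadamard's lemma for a non-zero linear functional. -/
theorem exists_hadamard_linear [FiniteDimensional ℝ V] [CompleteSpace G] {η : V →L[ℝ] ℝ} (hη : η ≠ 0)
    (hy₀ : η y₀ = 0) (hr : 0 < r) (hC : Convex ℝ C) (hCu : UniqueDiffOn ℝ C) {f : V × P → G}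
    (hf : ContDiffOn ℝ ∞ f (ball y₀ r ×ˢ C)) (hf0 : ∀ q ∈ ball y₀ r ×ˢ C, η q.1 = 0 → f q = 0) :
    ∃ ρ > 0, ρ ≤ r ∧ ∃ g : V × P → G, ContDiffOn ℝ ∞ g (ball y₀ ρ ×ˢ C) ∧
      ∀ q ∈ ball y₀ ρ ×ˢ C, f q = η q.1 • g q := by
  have hs : Function.Surjective η := LinearMap.surjective (f := (η : V →ₗ[ℝ] ℝ)) (by
    intro h
    exact hη (ContinuousLinearMap.coe_injective h))
  obtain ⟨T, T', hT, hT', hTT', hTT, hT1, hT2, hT2', -, hb, hb'⟩ := exists_coordinates (P := P) hs hy₀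
  obtain ⟨δ, hδ, hδb⟩ := hb r hr
  obtain ⟨δ', hδ', hδb'⟩ := hb' δ hδ
  have hmaps : ∀ q ∈ ball (0 : ℝ) δ ×ˢ (ball (0 : LinearMap.ker (η : V →ₗ[ℝ] ℝ)) δ ×ˢ C),
      T' q ∈ ball y₀ r ×ˢ C := fun q hq =>
    ⟨hδb q hq.1 hq.2.1, by rw [hT2']; exact hq.2.2⟩
  obtain ⟨g, hg, hfg⟩ := exists_hadamard_real (convex_ball (0 : ℝ) δ) isOpen_ball.uniqueDiffOn
    (mem_ball_self hδ) ((convex_ball (0 : LinearMap.ker (η : V →ₗ[ℝ] ℝ)) δ).prod hC)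
    (isOpen_ball.uniqueDiffOn.prod hCu) (hf.comp hT'.contDiffOn hmaps)
    (fun p hp => hf0 _ (hmaps _ ⟨mem_ball_self hδ, hp⟩) (by rw [← hT1, hTT]))
  have hmaps' : MapsTo T (ball y₀ (min δ' r) ×ˢ C)
      (ball (0 : ℝ) δ ×ˢ (ball (0 : LinearMap.ker (η : V →ₗ[ℝ] ℝ)) δ ×ˢ C)) := by
    intro q hq
    have h1 := hδb' q (ball_subset_ball (min_le_left _ _) hq.1)
    refine ⟨h1.1, h1.2, ?_⟩
    rw [hT2]
    exact hq.2
  refine ⟨min δ' r, lt_min hδ' hr, min_le_right _ _, g ∘ T, hg.comp hT.contDiffOn hmaps',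
    fun q hq => ?_⟩
  have h1 := hfg (T q) (hmaps' hq)
  rwa [Function.comp_apply, hTT', hT1] at h1

omit [NormedSpace ℝ V] [NormedSpace ℝ P] in
theorem ball_prod_mem_nhdsWithin {p₀ : P} {ρ : ℝ} (hρ : 0 < ρ) :
    ball y₀ ρ ×ˢ (C ∩ ball p₀ ρ) ∈ 𝓝[ball y₀ r ×ˢ C] (y₀, p₀) := by
  rw [nhdsWithin_prod_eq]
  exact prod_mem_prod (mem_nhdsWithin_of_mem_nhds (ball_mem_nhds _ hρ))
    (inter_mem self_mem_nhdsWithin (mem_nhdsWithin_of_mem_nhds (ball_mem_nhds _ hρ)))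

variable {m : ℕ} {y₀ : EuclideanSpace ℝ (Fin m)}
  {A : EuclideanSpace ℝ (Fin m) →L[ℝ] EuclideanSpace ℝ (Fin m)}
  {f : EuclideanSpace ℝ (Fin m) × P → EuclideanSpace ℝ (Fin m)}
  {lam : EuclideanSpace ℝ (Fin m) × P → ℝ}

/-- Along solutions `ξ` grows exponentially, so `ξ (f q) = exp (l lam) ξ (q.1)` vanishes with `ξ
(q.1)`, and Hadamard's lemma supplies a smooth quotient `g`. If `g` vanished at the base point, `ξ ∘
f` would have zero derivative there. Hence `log g / l` is smooth nearby. -/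
theorem exists_extension_of_real_eigenvector {ξ : EuclideanSpace ℝ (Fin m) →L[ℝ] ℝ} {l : ℝ}
    (hξ : ξ ≠ 0) (hl : l ≠ 0) (hξA : ∀ y, ξ (A y) = l * ξ y) (hy₀ : A y₀ = 0) (hr : 0 < r)
    (hC : Convex ℝ C) (hCu : UniqueDiffOn ℝ C) {p₀ : P} (hp₀ : p₀ ∈ C)
    (hf : ContDiffOn ℝ ∞ f (ball y₀ r ×ˢ C))
    (hc : ∀ q ∈ ball y₀ r ×ˢ C, ∃ c : ℝ → EuclideanSpace ℝ (Fin m), c 0 = q.1 ∧ c (lam q) = f q ∧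
      ∀ s ∈ uIcc 0 (lam q), HasDerivAt c (A (c s)) s)
    (hd : ¬HasFDerivWithinAt (fun q => ξ (f q)) (0 : EuclideanSpace ℝ (Fin m) × P →L[ℝ] ℝ)
      (ball y₀ r ×ˢ C) (y₀, p₀)) :
    ∃ ρ > 0, ρ ≤ r ∧ ∃ L : EuclideanSpace ℝ (Fin m) × P → ℝ,
      ContDiffOn ℝ ∞ L (ball y₀ ρ ×ˢ (C ∩ ball p₀ ρ)) ∧
      ∀ q ∈ ball y₀ ρ ×ˢ (C ∩ ball p₀ ρ), ξ q.1 ≠ 0 → L q = lam q := by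
  have hξ0 : ξ y₀ = 0 := by
    have h := hξA y₀
    rw [hy₀, map_zero] at h
    exact (mul_eq_zero.1 h.symm).resolve_left hl
  have hW : ∀ q ∈ ball y₀ r ×ˢ C, ξ (f q) = Real.exp (l * lam q) * ξ q.1 := by
    intro q hq
    obtain ⟨c, h0, h1, h2⟩ := hc q hq
    have h3 := eq_exp_mul_of_hasDerivAt (g := fun s => (ξ (c s) : ℂ)) (l := l) (T := lam q)
      (fun s hs => by
        have h4 := (ξ.hasFDerivAt.comp_hasDerivAt s (h2 s hs)).ofReal_comp
        rw [hξA] at h4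
        simpa using h4)
    simp only [h0, h1] at h3
    exact_mod_cast h3
  obtain ⟨ρ₁, hρ₁, hρr, g, hg, hfg⟩ := exists_hadamard_linear hξ hξ0 hr hC hCu
    (ξ.contDiff.comp_contDiffOn hf) (fun q hq h => by
      rw [Function.comp_apply, hW q hq, h, mul_zero])
  have hq₀ : (y₀, p₀) ∈ ball y₀ ρ₁ ×ˢ C := ⟨mem_ball_self hρ₁, hp₀⟩
  have hg0 : g (y₀, p₀) ≠ 0 := by
    intro h0
    have h1 : HasFDerivWithinAt (fun q : EuclideanSpace ℝ (Fin m) × P => ξ q.1)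
        (ξ.comp (ContinuousLinearMap.fst ℝ _ P)) (ball y₀ ρ₁ ×ˢ C) (y₀, p₀) :=
      (ξ.comp (ContinuousLinearMap.fst ℝ _ P)).hasFDerivWithinAt
    have h2 := h1.fun_mul ((hg _ hq₀).differentiableWithinAt (by simp)).hasFDerivWithinAt
    refine hd (((h2.congr (fun q hq => hfg q hq) (hfg _ hq₀)).congr_fderiv ?_).mono_of_mem_nhdsWithin
      (mem_of_superset (ball_prod_mem_nhdsWithin hρ₁) (prod_mono_right inter_subset_left)))
    simp [h0, hξ0]
  obtain ⟨δ, hδ, hδs⟩ := Metric.mem_nhdsWithin_iff.1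
    ((hg.continuousOn _ hq₀).eventually_ne hg0)
  set ρ := min δ ρ₁ with hρ
  have hsub : ball y₀ ρ ×ˢ (C ∩ ball p₀ ρ) ⊆ ball y₀ ρ₁ ×ˢ C :=
    prod_mono (ball_subset_ball (min_le_right _ _)) inter_subset_left
  have hgne : ∀ q ∈ ball y₀ ρ ×ˢ (C ∩ ball p₀ ρ), g q ≠ 0 := by
    intro q hq
    refine hδs ⟨?_, hsub hq⟩
    rw [← ball_prod_same]
    exact ⟨ball_subset_ball (min_le_left _ _) hq.1, ball_subset_ball (min_le_left _ _) hq.2.2⟩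
  refine ⟨ρ, lt_min hδ hρ₁, (min_le_right _ _).trans hρr, fun q => Real.log (g q) / l,
    ((hg.mono hsub).log hgne).div_const l, fun q hq hq0 => ?_⟩
  have h1 := hfg q (hsub hq)
  rw [Function.comp_apply, hW q (prod_mono_left (ball_subset_ball hρr) (hsub hq)), smul_eq_mul,
    mul_comm] at h1
  dsimp only
  rw [← mul_left_cancel₀ hq0 h1, Real.log_exp, mul_div_cancel_left₀ _ hl]

/-- `ξ ∘ A` is constant along solutions, so `ξ` is affine in time: `ξ (f q) - ξ (q.1) = lam q * ξ (A
q.1)`. The Hadamard quotient is already the extension, without any nondegeneracy of `f`. -/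
theorem exists_extension_of_jordan_chain {ξ : EuclideanSpace ℝ (Fin m) →L[ℝ] ℝ}
    (hξ : ξ.comp A ≠ 0) (hξA : ∀ y, ξ (A (A y)) = 0) (hy₀ : A y₀ = 0) (hr : 0 < r)
    (hC : Convex ℝ C) (hCu : UniqueDiffOn ℝ C) (p₀ : P)
    (hf : ContDiffOn ℝ ∞ f (ball y₀ r ×ˢ C))
    (hc : ∀ q ∈ ball y₀ r ×ˢ C, ∃ c : ℝ → EuclideanSpace ℝ (Fin m), c 0 = q.1 ∧ c (lam q) = f q ∧
      ∀ s ∈ uIcc 0 (lam q), HasDerivAt c (A (c s)) s) :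
    ∃ ρ > 0, ρ ≤ r ∧ ∃ L : EuclideanSpace ℝ (Fin m) × P → ℝ,
      ContDiffOn ℝ ∞ L (ball y₀ ρ ×ˢ (C ∩ ball p₀ ρ)) ∧
      ∀ q ∈ ball y₀ ρ ×ˢ (C ∩ ball p₀ ρ), ξ.comp A q.1 ≠ 0 → L q = lam q := by
  have hW : ∀ q ∈ ball y₀ r ×ˢ C, ξ (f q) - ξ q.1 = lam q * ξ.comp A q.1 := by
    intro q hq
    obtain ⟨c, h0, h1, h2⟩ := hc q hq
    have h3 : ∀ s ∈ uIcc 0 (lam q), ξ (A (c s)) = ξ (A q.1) := by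
      intro s hs
      have h4 := eq_of_hasDerivAt_zero (g := fun s => ξ (A (c s))) (fun s hs => by
        have h4 := (ξ.comp A).hasFDerivAt.comp_hasDerivAt s (h2 s hs)
        rw [ContinuousLinearMap.comp_apply, hξA] at h4
        exact h4) hs
      simpa only [h0] using h4
    have h5 := sub_eq_mul_of_hasDerivAt (g := fun s => ξ (c s)) (c := ξ (A q.1)) (T := lam q)
      (fun s hs => by
        have h4 := ξ.hasFDerivAt.comp_hasDerivAt s (h2 s hs)
        rw [h3 s hs] at h4
        exact h4)
    rw [h0, h1] at h5
    exact h5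
  obtain ⟨ρ, hρ, hρr, g, hg, hfg⟩ := exists_hadamard_linear hξ (by simp [hy₀]) hr hC hCu
    (f := fun q => ξ (f q) - ξ q.1)
    ((ξ.contDiff.comp_contDiffOn hf).sub (ξ.contDiff.comp contDiff_fst).contDiffOn)
    (fun q hq h => by rw [hW q hq, h, mul_zero])
  have hsub : ball y₀ ρ ×ˢ (C ∩ ball p₀ ρ) ⊆ ball y₀ ρ ×ˢ C := prod_mono_right inter_subset_left
  refine ⟨ρ, hρ, hρr, g, hg.mono hsub, fun q hq hq0 => ?_⟩
  have h1 := hfg q (hsub hq)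
  rw [hW q (prod_mono_left (ball_subset_ball hρr) (hsub hq)), smul_eq_mul, mul_comm] at h1
  exact (mul_left_cancel₀ hq0 h1).symm

/-- With `w = ξ (y)` as coordinate and `ker ξ × P` as parameter space, this is
`exists_contDiffOn_extension_complex`. The nondegeneracy condition passes to the new coordinates by
the chain rule. -/
theorem exists_extension_of_complex_eigenvector {ξ : EuclideanSpace ℝ (Fin m) →L[ℝ] ℂ} {l : ℂ}
    (hξ : Function.Surjective ξ) (hl : l ≠ 0) (hξA : ∀ y, ξ (A y) = l * ξ y) (hy₀ : A y₀ = 0)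
    (hr : 0 < r) (hC : Convex ℝ C) (hCu : UniqueDiffOn ℝ C) {p₀ : P} (hp₀ : p₀ ∈ C)
    (hf : ContDiffOn ℝ ∞ f (ball y₀ r ×ˢ C))
    (hlam : ContDiffOn ℝ ∞ lam ((ball y₀ r ×ˢ C) ∩ {q | A q.1 ≠ 0}))
    (hc : ∀ q ∈ ball y₀ r ×ˢ C, ∃ c : ℝ → EuclideanSpace ℝ (Fin m), c 0 = q.1 ∧ c (lam q) = f q ∧
      ∀ s ∈ uIcc 0 (lam q), HasDerivAt c (A (c s)) s)
    (hd : ¬HasFDerivWithinAt (fun q => ξ (f q)) (0 : EuclideanSpace ℝ (Fin m) × P →L[ℝ] ℂ)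
      (ball y₀ r ×ˢ C) (y₀, p₀)) :
    ∃ ρ > 0, ρ ≤ r ∧ ∃ L : EuclideanSpace ℝ (Fin m) × P → ℝ,
      ContDiffOn ℝ ∞ L (ball y₀ ρ ×ˢ (C ∩ ball p₀ ρ)) ∧
      ∀ q ∈ ball y₀ ρ ×ˢ (C ∩ ball p₀ ρ), ξ q.1 ≠ 0 → L q = lam q := by
  have hξ0 : ξ y₀ = 0 := by
    have h := hξA y₀
    rw [hy₀, map_zero] at h
    exact (mul_eq_zero.1 h.symm).resolve_left hl
  have hA0 : ∀ y, ξ y ≠ 0 → A y ≠ 0 := by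
    intro y hy h
    have h1 := hξA y
    rw [h, map_zero] at h1
    exact hy ((mul_eq_zero.1 h1.symm).resolve_left hl)
  have hW : ∀ q ∈ ball y₀ r ×ˢ C, ξ (f q) = Complex.exp (l * lam q) * ξ q.1 := by
    intro q hq
    obtain ⟨c, h0, h1, h2⟩ := hc q hq
    have h3 := eq_exp_mul_of_hasDerivAt (g := fun s => ξ (c s)) (l := l) (T := lam q)
      (fun s hs => by
        have h4 := ξ.hasFDerivAt.comp_hasDerivAt s (h2 s hs)
        rw [hξA] at h4
        exact h4)
    simpa only [h0, h1] using h3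
  obtain ⟨T, T', hT, hT', hTT', hTT, hT1, hT2, hT2', hT0, hb, hb'⟩ :=
    exists_coordinates (P := P) hξ hξ0
  obtain ⟨δ, hδ, hδb⟩ := hb r hr
  have hmaps : MapsTo T' (ball (0 : ℂ) δ ×ˢ (ball (0 : LinearMap.ker ξ.toLinearMap) δ ×ˢ C)) (ball y₀ r ×ˢ C) := fun q hq =>
    ⟨hδb q hq.1 hq.2.1, by rw [hT2']; exact hq.2.2⟩
  have hξT : ∀ q, ξ (T' q).1 = q.1 := fun q => by rw [← hT1, hTT]
  have hT0' : T' (0, (0, p₀)) = (y₀, p₀) := by rw [← hT0, hTT']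
  have hmemT : ∀ δ > 0, ∃ δ' > 0, δ' ≤ r ∧ MapsTo T (ball y₀ δ' ×ˢ (C ∩ ball p₀ δ'))
      (ball (0 : ℂ) δ ×ˢ ((ball (0 : LinearMap.ker ξ.toLinearMap) δ ×ˢ C) ∩ ball ((0 : LinearMap.ker ξ.toLinearMap), p₀) δ)) := by
    intro δ hδ
    obtain ⟨δ', hδ', h⟩ := hb' δ hδ
    refine ⟨min (min δ' δ) r, lt_min (lt_min hδ' hδ) hr, min_le_right _ _, fun q hq => ?_⟩
    have h1 := h q (ball_subset_ball ((min_le_left _ _).trans (min_le_left _ _)) hq.1)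
    have h2 : (T q).2.2 = q.2 := hT2 q
    refine ⟨h1.1, ⟨h1.2, ?_⟩, ?_⟩
    · rw [h2]
      exact hq.2.1
    · rw [← ball_prod_same]
      refine ⟨h1.2, ?_⟩
      rw [h2]
      exact ball_subset_ball ((min_le_left _ _).trans (min_le_right _ _)) hq.2.2
  obtain ⟨ρ₁, hρ₁, hρδ, L, hL, hLlam⟩ := exists_contDiffOn_extension_complex
    (W := fun q => ξ (f (T' q))) (lam := lam ∘ T') (p₀ := ((0 : LinearMap.ker ξ.toLinearMap), p₀))
    hδ ((convex_ball (0 : LinearMap.ker ξ.toLinearMap) δ).prod hC) (isOpen_ball.uniqueDiffOn.prod hCu) hl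
    ((ξ.contDiff.comp_contDiffOn hf).comp hT'.contDiffOn hmaps)
    (hlam.comp hT'.contDiffOn fun q hq => ⟨hmaps hq.1, hA0 _ (by rw [hξT]; exact hq.2)⟩)
    (fun q hq _ => by rw [hW _ (hmaps hq), hξT]; rfl)
    (fun q hq h => by rw [hW _ (hmaps hq), hξT, h, mul_zero])
    ⟨mem_ball_self hδ, hp₀⟩ (fun h => by
      obtain ⟨δ', hδ', hδr, hm⟩ := hmemT δ hδ
      have hTd : HasFDerivWithinAt T (fderiv ℝ T (y₀, p₀)) (ball y₀ δ' ×ˢ (C ∩ ball p₀ δ')) (y₀, p₀) :=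
        (hT.differentiable (by simp) _).hasFDerivAt.hasFDerivWithinAt
      rw [← hT0] at h
      have h1 := h.comp (y₀, p₀) hTd (hm.mono_right (prod_mono_right inter_subset_left))
      rw [ContinuousLinearMap.zero_comp] at h1
      refine hd ((h1.congr (fun q _ => ?_) ?_).mono_of_mem_nhdsWithin
        (ball_prod_mem_nhdsWithin hδ'))
      · simp only [Function.comp_apply, hTT']
      · simp only [Function.comp_apply, hTT'])
  obtain ⟨δ', hδ', hδr, hm⟩ := hmemT ρ₁ hρ₁
  have hm' : MapsTo T (ball y₀ δ' ×ˢ (C ∩ ball p₀ δ'))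
      (ball (0 : ℂ) ρ₁ ×ˢ ((ball (0 : LinearMap.ker ξ.toLinearMap) δ ×ˢ C) ∩ ball ((0 : LinearMap.ker ξ.toLinearMap), p₀) ρ₁)) :=
    hm.mono_right (prod_mono_right (inter_subset_inter_left _
      (prod_mono_left (ball_subset_ball hρδ))))
  refine ⟨δ', hδ', hδr, L ∘ T, hL.comp hT.contDiffOn hm', fun q hq hq0 => ?_⟩
  rw [Function.comp_apply, hLlam _ (hm' hq) (by rw [hT1]; exact hq0), Function.comp_apply, hTT']

/-- If `f q` is the image of `q.1` under the flow of a non-zero linear vector field `A` at the time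
`lam q`, and `f` is nondegenerate at a zero of `A`, then the function `lam`, smooth off the zeros of
`A`, extends smoothly across them. -/
theorem exists_extension_of_linear_flow {B : Matrix (Fin m) (Fin m) ℝ} (hB : B ≠ 0)
    (hA : ∀ y, A y = WithLp.toLp 2 (B.mulVec (WithLp.ofLp y))) (hy₀ : A y₀ = 0)
    (hr : 0 < r) (hC : Convex ℝ C) (hCu : UniqueDiffOn ℝ C) {p₀ : P} (hp₀ : p₀ ∈ C)
    (hf : ContDiffOn ℝ ∞ f (ball y₀ r ×ˢ C))
    (hlam : ContDiffOn ℝ ∞ lam ((ball y₀ r ×ˢ C) ∩ {q | A q.1 ≠ 0}))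
    (hc : ∀ q ∈ ball y₀ r ×ˢ C, ∃ c : ℝ → EuclideanSpace ℝ (Fin m), c 0 = q.1 ∧ c (lam q) = f q ∧
      ∀ s ∈ uIcc 0 (lam q), HasDerivAt c (A (c s)) s)
    (hd : ∀ ξ : EuclideanSpace ℝ (Fin m) →L[ℝ] ℝ, ξ ≠ 0 → ¬HasFDerivWithinAt (fun q => ξ (f q))
      (0 : EuclideanSpace ℝ (Fin m) × P →L[ℝ] ℝ) (ball y₀ r ×ˢ C) (y₀, p₀)) :
    ∃ ρ > 0, ρ ≤ r ∧ ∃ L : EuclideanSpace ℝ (Fin m) × P → ℝ,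
      ContDiffOn ℝ ∞ L (ball y₀ ρ ×ˢ (C ∩ ball p₀ ρ)) ∧
      ∀ q ∈ ball y₀ ρ ×ˢ (C ∩ ball p₀ ρ), A q.1 ≠ 0 → L q = lam q := by
  -- Each case yields equality only where `ξ ≠ 0`. By density and continuity it holds wherever `A ≠
  -- 0`.
  have key {V'' : Type} [NormedAddCommGroup V''] [NormedSpace ℝ V'']
      {ξ : EuclideanSpace ℝ (Fin m) →L[ℝ] V''} (hξ : ξ ≠ 0)
      (h : ∃ ρ > 0, ρ ≤ r ∧ ∃ L : EuclideanSpace ℝ (Fin m) × P → ℝ,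
        ContDiffOn ℝ ∞ L (ball y₀ ρ ×ˢ (C ∩ ball p₀ ρ)) ∧
        ∀ q ∈ ball y₀ ρ ×ˢ (C ∩ ball p₀ ρ), ξ q.1 ≠ 0 → L q = lam q) :
      ∃ ρ > 0, ρ ≤ r ∧ ∃ L : EuclideanSpace ℝ (Fin m) × P → ℝ,
        ContDiffOn ℝ ∞ L (ball y₀ ρ ×ˢ (C ∩ ball p₀ ρ)) ∧
        ∀ q ∈ ball y₀ ρ ×ˢ (C ∩ ball p₀ ρ), A q.1 ≠ 0 → L q = lam q := by
    obtain ⟨ρ, hρ, hρr, L, hL, h1⟩ := h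
    refine ⟨ρ, hρ, hρr, L, hL, fun q hq hq0 => eq_of_eq_of_ne_zero hξ
      (hL.continuousOn.mono inter_subset_left) (hlam.continuousOn.mono (inter_subset_inter_left _
        (prod_mono (ball_subset_ball hρr) inter_subset_left))) (fun q hq _ => h1 q hq) hq hq0⟩
  rcases exists_dual_eigenvector hB hA with ⟨ξ, l, hξ, hl, h⟩ | ⟨ξ, l, hξ, hl, h⟩ | ⟨ξ, hξ, h⟩
  · exact key hξ (exists_extension_of_real_eigenvector hξ hl h hy₀ hr hC hCu hp₀ hf hc (hd ξ hξ))
  · have hξ0 : ξ ≠ 0 := by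
      rintro rfl
      obtain ⟨y, hy⟩ := hξ 1
      simp at hy
    refine key hξ0 (exists_extension_of_complex_eigenvector hξ hl h hy₀ hr hC hCu hp₀ hf hlam hc
      fun h1 => ?_)
    -- Nondegeneracy is given for real functionals; the real part of `ξ` is enough.
    refine hd (Complex.reCLM.comp ξ) (fun h0 => ?_) ?_
    · obtain ⟨y, hy⟩ := hξ 1
      have := congrArg (fun f => f y) h0
      simp [hy] at this
    · have h2 := Complex.reCLM.hasFDerivAt.comp_hasFDerivWithinAt _ h1
      rw [ContinuousLinearMap.comp_zero] at h2
      exact h2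
  · exact key hξ (exists_extension_of_jordan_chain hξ h hy₀ hr hC hCu p₀ hf hc)

end DivisionTheorem

/-! ### An implicit function theorem over sets that need not be open -/

section Implicit

open Metric Filter

variable {E : Type u} [NormedAddCommGroup E] [NormedSpace ℝ E]

/-- Since only one real unknown is solved for, monotonicity in `s` and the intermediate value
theorem replace the inverse function theorem, which would need an open set of parameters. Continuity
of the solution also follows from monotonicity. -/
theorem exists_implicit_of_pos {K : Set E} (hK : UniqueDiffOn ℝ K) {ψ : E × ℝ → ℝ} {x₀ : E}
    (hx₀ : x₀ ∈ K) {s₀ r ε₀ : ℝ} (hr : 0 < r) (hε₀ : 0 < ε₀)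
    (hψ : ContDiffOn ℝ ∞ ψ ((K ∩ ball x₀ r) ×ˢ ball s₀ ε₀))
    (hd : 0 < fderivWithin ℝ ψ ((K ∩ ball x₀ r) ×ˢ ball s₀ ε₀) (x₀, s₀) (0, 1)) :
    ∃ δ > 0, δ ≤ r ∧ ∃ ε > 0, ε ≤ ε₀ ∧ ∃ σ : E × ℝ → ℝ,
      ContDiffOn ℝ ∞ σ ((K ∩ ball x₀ δ) ×ˢ ball (ψ (x₀, s₀)) δ) ∧
      ∀ x ∈ K ∩ ball x₀ δ, ∀ ρ ∈ ball (ψ (x₀, s₀)) δ, σ (x, ρ) ∈ ball s₀ ε ∧ ψ (x, σ (x, ρ)) = ρ ∧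
        ∀ s ∈ ball s₀ ε, ψ (x, s) = ρ → s = σ (x, ρ) := by
  set S := (K ∩ ball x₀ r) ×ˢ ball s₀ ε₀ with hS
  have hSu : UniqueDiffOn ℝ S := (hK.inter isOpen_ball).prod isOpen_ball.uniqueDiffOn
  have h₀ : (x₀, s₀) ∈ S := ⟨⟨hx₀, mem_ball_self hr⟩, mem_ball_self hε₀⟩
  set D := fderivWithin ℝ ψ S with hDdef
  have hD : ContDiffOn ℝ ∞ D S := hψ.fderivWithin hSu (m := ∞) (by norm_cast)
  have hψD : ∀ q ∈ S, HasFDerivWithinAt ψ (D q) S q := fun q hq =>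
    ((hψ q hq).differentiableWithinAt (by simp)).hasFDerivWithinAt
  obtain ⟨δ₁, hδ₁, hpos⟩ := Metric.mem_nhdsWithin_iff.1
    (((hD.clm_apply contDiffOn_const).continuousOn _ h₀).eventually (lt_mem_nhds hd))
  set ε := min ε₀ δ₁ / 2 with hε
  have hm : 0 < min ε₀ δ₁ := lt_min hε₀ hδ₁
  have hε0 : 0 < ε := half_pos hm
  have hIcc : Icc (s₀ - ε) (s₀ + ε) ⊆ ball s₀ (min ε₀ δ₁) := by
    rw [Real.ball_eq_Ioo]
    exact Icc_subset_Ioo (by linarith) (by linarith)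
  have hIccε : Icc (s₀ - ε) (s₀ + ε) ⊆ ball s₀ ε₀ := hIcc.trans (ball_subset_ball (min_le_left _ _))
  set d₁ := min r δ₁ with hd₁
  have hd₁0 : 0 < d₁ := lt_min hr hδ₁
  have hmem : ∀ x ∈ K ∩ ball x₀ d₁, ∀ s ∈ Icc (s₀ - ε) (s₀ + ε), (x, s) ∈ S ∧ 0 < D (x, s) (0, 1) := by
    intro x hx s hs
    have h1 : (x, s) ∈ S := ⟨⟨hx.1, ball_subset_ball (min_le_left _ _) hx.2⟩, hIccε hs⟩
    refine ⟨h1, hpos ⟨?_, h1⟩⟩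
    rw [← ball_prod_same]
    exact ⟨ball_subset_ball (min_le_right _ _) hx.2,
      ball_subset_ball (min_le_right _ _) (hIcc hs)⟩
  have hder : ∀ x ∈ K ∩ ball x₀ d₁, ∀ s ∈ Icc (s₀ - ε) (s₀ + ε),
      HasDerivAt (fun s => ψ (x, s)) (D (x, s) (0, 1)) s := by
    intro x hx s hs
    have h1 := (hmem x hx s hs).1
    have h2 : HasDerivWithinAt (fun s : ℝ => (x, s)) ((0 : E), (1 : ℝ)) (ball s₀ ε₀) s :=
      ((hasDerivAt_const s x).prodMk (hasDerivAt_id s)).hasDerivWithinAt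
    exact ((hψD _ h1).comp_hasDerivWithinAt s h2 fun t ht => ⟨h1.1, ht⟩).hasDerivAt
      (isOpen_ball.mem_nhds h1.2)
  have hcont : ∀ x ∈ K ∩ ball x₀ d₁, ContinuousOn (fun s => ψ (x, s)) (Icc (s₀ - ε) (s₀ + ε)) :=
    fun x hx s hs => (hder x hx s hs).continuousAt.continuousWithinAt
  have hmono : ∀ x ∈ K ∩ ball x₀ d₁, StrictMonoOn (fun s => ψ (x, s)) (Icc (s₀ - ε) (s₀ + ε)) :=
    fun x hx => strictMonoOn_of_deriv_pos (convex_Icc _ _) (hcont x hx) fun s hs => by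
      rw [(hder x hx s (interior_subset hs)).deriv]
      exact (hmem x hx s (interior_subset hs)).2
  have hx₀' : x₀ ∈ K ∩ ball x₀ d₁ := ⟨hx₀, mem_ball_self hd₁0⟩
  have hl : s₀ - ε ∈ Icc (s₀ - ε) (s₀ + ε) := ⟨le_rfl, by linarith⟩
  have hu : s₀ + ε ∈ Icc (s₀ - ε) (s₀ + ε) := ⟨by linarith, le_rfl⟩
  have hm0 : s₀ ∈ Icc (s₀ - ε) (s₀ + ε) := ⟨by linarith, by linarith⟩
  set ρ₀ := ψ (x₀, s₀) with hρ₀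
  have ha : ψ (x₀, s₀ - ε) < ρ₀ := hmono x₀ hx₀' hl hm0 (by linarith)
  have hb : ρ₀ < ψ (x₀, s₀ + ε) := hmono x₀ hx₀' hm0 hu (by linarith)
  have hcx : ∀ s ∈ Icc (s₀ - ε) (s₀ + ε), ContinuousWithinAt (fun x => ψ (x, s)) (K ∩ ball x₀ r) x₀ :=
    fun s hs => (hψ.continuousOn.comp (f := fun x => (x, s)) (by fun_prop)
      fun x hx => ⟨hx, hIccε hs⟩) x₀ ⟨hx₀, mem_ball_self hr⟩
  obtain ⟨a, ha1, ha2⟩ := exists_between ha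
  obtain ⟨b, hb1, hb2⟩ := exists_between hb
  obtain ⟨δ₂, hδ₂, h2⟩ := Metric.mem_nhdsWithin_iff.1
    (((hcx _ hl).eventually (gt_mem_nhds ha1)).and ((hcx _ hu).eventually (lt_mem_nhds hb2)))
  -- For `x` this close to `x₀`, the values of `ψ` at `s₀ - ε` and `s₀ + ε` lie below `a` and above
  -- `b`, hence bracket every `ρ` within `δ` of `ρ₀`.
  set δ := min (min d₁ δ₂) (min (ρ₀ - a) (b - ρ₀)) with hδ
  have hδ0 : 0 < δ := lt_min (lt_min hd₁0 hδ₂) (lt_min (by linarith) (by linarith))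
  have hδd : δ ≤ d₁ := (min_le_left _ _).trans (min_le_left _ _)
  have hδδ : δ ≤ δ₂ := (min_le_left _ _).trans (min_le_right _ _)
  have hδa : δ ≤ ρ₀ - a := (min_le_right _ _).trans (min_le_left _ _)
  have hδb : δ ≤ b - ρ₀ := (min_le_right _ _).trans (min_le_right _ _)
  have hδr : δ ≤ r := hδd.trans (min_le_left _ _)
  have hKd : ∀ x ∈ K ∩ ball x₀ δ, x ∈ K ∩ ball x₀ d₁ := fun x hx =>
    ⟨hx.1, ball_subset_ball hδd hx.2⟩
  set T := (K ∩ ball x₀ δ) ×ˢ ball ρ₀ δ with hT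
  have hex : ∀ q : E × ℝ, ∃ s, q ∈ T → s ∈ ball s₀ ε ∧ ψ (q.1, s) = q.2 := by
    intro q
    by_cases hq : q ∈ T
    · have h3 := h2 ⟨ball_subset_ball hδδ hq.1.2, hq.1.1, ball_subset_ball hδr hq.1.2⟩
      have h4 : q.2 ∈ Ioo (ρ₀ - δ) (ρ₀ + δ) := by
        rw [← Real.ball_eq_Ioo]; exact hq.2
      obtain ⟨s, hs, hs'⟩ := intermediate_value_Ioo (by linarith) (hcont q.1 (hKd _ hq.1))
        (show q.2 ∈ Ioo (ψ (q.1, s₀ - ε)) (ψ (q.1, s₀ + ε)) from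
          ⟨by linarith [h3.1, h4.1], by linarith [h3.2, h4.2]⟩)
      exact ⟨s, fun _ => ⟨by rw [Real.ball_eq_Ioo]; exact hs, hs'⟩⟩
    · exact ⟨0, fun h => absurd h hq⟩
  choose σ hσ using hex
  have hball : ball s₀ ε ⊆ Icc (s₀ - ε) (s₀ + ε) := by
    rw [Real.ball_eq_Ioo]
    exact Ioo_subset_Icc_self
  have hcσ : ContinuousOn σ T := by
    intro q hq
    rw [ContinuousWithinAt, tendsto_order]
    have hq1 := hKd _ hq.1
    have hTS : ∀ s ∈ Icc (s₀ - ε) (s₀ + ε), ContinuousWithinAt (fun q : E × ℝ => ψ (q.1, s)) T q :=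
      fun s hs => (hψ.continuousOn.comp (f := fun q : E × ℝ => (q.1, s)) (by fun_prop)
        fun q' hq' => (hmem _ (hKd _ hq'.1) s hs).1) q hq
    have hc2 : ContinuousWithinAt (fun q : E × ℝ => q.2) T q := continuousWithinAt_snd
    have hσq := hσ q hq
    have hσI := hball hσq.1
    constructor
    · intro a' ha'
      set s := max a' (s₀ - ε) with hs
      have hσ1 : s₀ - ε < σ q := by
        have := hσq.1
        rw [Real.ball_eq_Ioo] at this
        exact this.1
      have hsσ : s < σ q := max_lt ha' hσ1
      have hsI : s ∈ Icc (s₀ - ε) (s₀ + ε) := ⟨le_max_right _ _, hsσ.le.trans hσI.2⟩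
      have h3 : ψ (q.1, s) < q.2 := (hmono _ hq1 hsI hσI hsσ).trans_eq hσq.2
      filter_upwards [(hTS s hsI).eventually_lt hc2 h3, self_mem_nhdsWithin] with q' hq' hq'T
      rw [← (hσ q' hq'T).2] at hq'
      exact (le_max_left _ _).trans_lt
        (((hmono _ (hKd _ hq'T.1)).lt_iff_lt hsI (hball (hσ q' hq'T).1)).1 hq')
    · intro a' ha'
      set s := min a' (s₀ + ε) with hs
      have hσ1 : σ q < s₀ + ε := by
        have := hσq.1
        rw [Real.ball_eq_Ioo] at this
        exact this.2
      have hsσ : σ q < s := lt_min ha' hσ1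
      have hsI : s ∈ Icc (s₀ - ε) (s₀ + ε) := ⟨hσI.1.trans hsσ.le, min_le_right _ _⟩
      have h3 : q.2 < ψ (q.1, s) := hσq.2.symm.trans_lt (hmono _ hq1 hσI hsI hsσ)
      filter_upwards [hc2.eventually_lt (hTS s hsI) h3, self_mem_nhdsWithin] with q' hq' hq'T
      rw [← (hσ q' hq'T).2] at hq'
      exact (((hmono _ (hKd _ hq'T.1)).lt_iff_lt (hball (hσ q' hq'T).1) hsI).1 hq').trans_le
        (min_le_left _ _)
  have hTu : UniqueDiffOn ℝ T := (hK.inter isOpen_ball).prod isOpen_ball.uniqueDiffOn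
  have hgS : ∀ q ∈ T, (q.1, σ q) ∈ S := fun q hq => (hmem _ (hKd _ hq.1) _ (hball (hσ q hq).1)).1
  -- The derivative found by implicit differentiation. It is justified below by viewing `(x, ρ) ↦
  -- (x, σ)` as a right inverse of `(x, s) ↦ (x, ψ)`.
  set G : E × ℝ → E × ℝ →L[ℝ] ℝ := fun q => (D q (0, 1))⁻¹ •
    (ContinuousLinearMap.snd ℝ E ℝ - ((D q).comp (ContinuousLinearMap.inl ℝ E ℝ)).comp
      (ContinuousLinearMap.fst ℝ E ℝ)) with hG
  have hσd : ∀ q ∈ T, HasFDerivWithinAt σ (G (q.1, σ q)) T q := by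
    intro q hq
    set p := (q.1, σ q) with hp
    have hpS := hgS q hq
    have hne : D p (0, 1) ≠ 0 := (hmem _ (hKd _ hq.1) _ (hball (hσ q hq).1)).2.ne'
    have h1 : HasFDerivWithinAt (fun p : E × ℝ => (p.1, ψ p))
        ((ContinuousLinearMap.fst ℝ E ℝ).prod (D p)) S p :=
      hasFDerivWithinAt_fst.prodMk (hψD p hpS)
    have hg : Tendsto (fun q => (q.1, σ q)) (𝓝[T] q) (𝓝[S] p) :=
      tendsto_nhdsWithin_iff.2 ⟨(continuousWithinAt_fst.prodMk (hcσ q hq)),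
        eventually_of_mem self_mem_nhdsWithin hgS⟩
    have h2 := HasFDerivWithinAt.of_comp_of_leftInverse
      (f'symm := (ContinuousLinearMap.fst ℝ E ℝ).prod (G p)) hg h1 (hasFDerivWithinAt_id q T)
      (eventually_of_mem self_mem_nhdsWithin fun q' hq' => Prod.ext rfl (hσ q' hq').2) (by
        rintro ⟨v, a⟩
        refine Prod.ext rfl ?_
        have h3 : D p (v, a) = D p (v, 0) + a * D p (0, 1) := by
          have : ((v, a) : E × ℝ) = (v, 0) + a • (0, 1) := by simp
          rw [this, map_add, map_smul, smul_eq_mul]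
        simp only [hG, ContinuousLinearMap.prod_apply, smul_apply, sub_apply,
          ContinuousLinearMap.comp_apply, ContinuousLinearMap.coe_fst', ContinuousLinearMap.coe_snd',
          ContinuousLinearMap.inl_apply, smul_eq_mul, h3]
        field_simp
        ring) hq
    exact h2.snd
  -- Bootstrapping: the derivative of `σ` is a smooth expression in `σ`, so each order of smoothness
  -- gives the next.
  have hsm : ∀ n : ℕ, ContDiffOn ℝ n σ T := by
    intro n
    induction n with
    | zero => simpa using hcσ
    | succ n ih =>
      push_cast
      rw [contDiffOn_succ_iff_hasFDerivWithinAt_of_uniqueDiffOn hTu]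
      refine ⟨fun h => absurd h (by simp), _, ?_, hσd⟩
      have hp : ContDiffOn ℝ n (fun q : E × ℝ => (q.1, σ q)) T := contDiffOn_fst.prodMk ih
      have hDc : ContDiffOn ℝ n (fun q : E × ℝ => D (q.1, σ q)) T :=
        (hD.of_le (by exact_mod_cast le_top)).comp hp hgS
      exact ((hDc.clm_apply contDiffOn_const).inv fun q hq =>
        (hmem _ (hKd _ hq.1) _ (hball (hσ q hq).1)).2.ne').smul
        (contDiffOn_const.sub ((hDc.clm_comp contDiffOn_const).clm_comp contDiffOn_const))
  refine ⟨δ, hδ0, hδr, ε, hε0, ?_, σ, contDiffOn_infty.2 hsm, fun x hx ρ hρ => ?_⟩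
  · have := min_le_left ε₀ δ₁
    linarith
  · have h3 := hσ (x, ρ) ⟨hx, hρ⟩
    exact ⟨h3.1, h3.2, fun s hs h4 => (hmono x (hKd x hx)).injOn (hball hs) (hball h3.1)
      (h4.trans h3.2.symm)⟩

/-- The implicit function theorem for real-valued functions with parameters in a possibly
non-open set, e.g. a half-space. -/
theorem exists_implicit {K : Set E} (hK : UniqueDiffOn ℝ K) {ψ : E × ℝ → ℝ} {x₀ : E}
    (hx₀ : x₀ ∈ K) {s₀ r ε₀ d : ℝ} (hr : 0 < r) (hε₀ : 0 < ε₀)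
    (hψ : ContDiffOn ℝ ∞ ψ ((K ∩ ball x₀ r) ×ˢ ball s₀ ε₀))
    (hd : HasDerivAt (fun s => ψ (x₀, s)) d s₀) (hd0 : d ≠ 0) :
    ∃ δ > 0, δ ≤ r ∧ ∃ ε > 0, ε ≤ ε₀ ∧ ∃ σ : E × ℝ → ℝ,
      ContDiffOn ℝ ∞ σ ((K ∩ ball x₀ δ) ×ˢ ball (ψ (x₀, s₀)) δ) ∧
      ∀ x ∈ K ∩ ball x₀ δ, ∀ ρ ∈ ball (ψ (x₀, s₀)) δ, σ (x, ρ) ∈ ball s₀ ε ∧ ψ (x, σ (x, ρ)) = ρ ∧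
        ∀ s ∈ ball s₀ ε, ψ (x, s) = ρ → s = σ (x, ρ) := by
  have h₀ : (x₀, s₀) ∈ (K ∩ ball x₀ r) ×ˢ ball s₀ ε₀ :=
    ⟨⟨hx₀, mem_ball_self hr⟩, mem_ball_self hε₀⟩
  have hval {f : E × ℝ → ℝ} {d : ℝ} (hf : ContDiffOn ℝ ∞ f ((K ∩ ball x₀ r) ×ˢ ball s₀ ε₀))
      (hd : HasDerivAt (fun s => f (x₀, s)) d s₀) :
      fderivWithin ℝ f ((K ∩ ball x₀ r) ×ˢ ball s₀ ε₀) (x₀, s₀) (0, 1) = d := by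
    have h2 : HasDerivWithinAt (fun s : ℝ => (x₀, s)) ((0 : E), (1 : ℝ)) (ball s₀ ε₀) s₀ :=
      ((hasDerivAt_const s₀ x₀).prodMk (hasDerivAt_id s₀)).hasDerivWithinAt
    have h3 := (((hf _ h₀).differentiableWithinAt (by simp)).hasFDerivWithinAt.comp_hasDerivWithinAt
      s₀ h2 fun t ht => ⟨h₀.1, ht⟩).hasDerivAt (isOpen_ball.mem_nhds h₀.2)
    exact h3.unique hd
  rcases lt_or_gt_of_ne hd0 with hneg | hpos
  · obtain ⟨δ, hδ, hδr, ε, hε, hεε, σ, hσ, h⟩ := exists_implicit_of_pos hK hx₀ hr hε₀ hψ.neg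
      (by rw [hval hψ.neg hd.neg]; linarith)
    have hmem : ∀ ρ ∈ ball (ψ (x₀, s₀)) δ, -ρ ∈ ball (-ψ (x₀, s₀)) δ := fun ρ hρ => by
      rw [mem_ball, dist_neg_neg]
      exact hρ
    refine ⟨δ, hδ, hδr, ε, hε, hεε, fun q => σ (q.1, -q.2), ?_, fun x hx ρ hρ => ?_⟩
    · exact hσ.comp (f := fun q : E × ℝ => (q.1, -q.2)) (by fun_prop)
        fun q hq => ⟨hq.1, hmem _ hq.2⟩
    · obtain ⟨h1, h2, h3⟩ := h x hx (-ρ) (hmem ρ hρ)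
      exact ⟨h1, neg_injective h2, fun s hs hs' => h3 s hs (by rw [hs'])⟩
  · exact exists_implicit_of_pos hK hx₀ hr hε₀ hψ (by rwa [hval hψ hd])

end Implicit

/-! ### Plaques of the orbit foliation and uniqueness of shift functions -/

section Lifts

open Metric Filter

theorem Set.countable_of_isolated {A : Set ℝ} (h : ∀ s ∈ A, ∀ᶠ t in 𝓝[≠] s, t ∉ A) : A.Countable := by
  have hd : DiscreteTopology A := by
    rw [discreteTopology_subtype_iff]
    intro s hs
    rw [← _root_.disjoint_iff, Filter.disjoint_principal_right]
    exact h s hs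
  exact countable_coe_iff.1 (separableSpace_iff_countable.1 inferInstance)

variable {E : Type u} [NormedAddCommGroup E] [NormedSpace ℝ E]
  {H : Type v} [TopologicalSpace H] {I : ModelWithCorners ℝ E H}
  {M : Type w} [TopologicalSpace M] [ChartedSpace H M] [IsManifold I ∞ M]
  {F : ∀ p : M, TangentSpace I p}

/-- The implicit function theorem for real-valued functions with parameters in a manifold with
boundary. -/
theorem exists_implicit_manifold {O : Set (M × ℝ)} (hO : IsOpen O) {ψ : M × ℝ → ℝ}
    (hψ : ContMDiffOn (I.prod 𝓘(ℝ, ℝ)) 𝓘(ℝ, ℝ) ∞ ψ O) {x₀ : M} {s₀ d : ℝ} (h₀ : (x₀, s₀) ∈ O)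
    (hd : HasDerivAt (fun s => ψ (x₀, s)) d s₀) (hd0 : d ≠ 0) :
    ∃ W : Set M, IsOpen W ∧ x₀ ∈ W ∧ ∃ δ > 0, ∃ ε > 0, ∃ σ : M × ℝ → ℝ,
      ContMDiffOn (I.prod 𝓘(ℝ, ℝ)) 𝓘(ℝ, ℝ) ∞ σ (W ×ˢ ball (ψ (x₀, s₀)) δ) ∧
      W ×ˢ ball s₀ ε ⊆ O ∧
      ∀ x ∈ W, ∀ ρ ∈ ball (ψ (x₀, s₀)) δ, σ (x, ρ) ∈ ball s₀ ε ∧ ψ (x, σ (x, ρ)) = ρ ∧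
        ∀ s ∈ ball s₀ ε, ψ (x, s) = ρ → s = σ (x, ρ) := by
  set φ := extChartAt I x₀ with hφ
  obtain ⟨W₁, hW₁, B, hB, hWB⟩ := mem_nhds_prod_iff.1 (hO.mem_nhds h₀)
  obtain ⟨ε₀, hε₀, hεB⟩ := Metric.mem_nhds_iff.1 hB
  have h1 : φ.target ∩ φ.symm ⁻¹' W₁ ∈ 𝓝[range I] (φ x₀) :=
    inter_mem (extChartAt_target_mem_nhdsWithin x₀)
      (mem_nhdsWithin_of_mem_nhds (continuousAt_extChartAt_symm x₀ (by
        rw [extChartAt_to_inv]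
        exact hW₁)))
  obtain ⟨r, hr, hrs⟩ := Metric.mem_nhdsWithin_iff.1 h1
  have hmaps : MapsTo (fun q : E × ℝ => (φ.symm q.1, q.2))
      ((range I ∩ ball (φ x₀) r) ×ˢ ball s₀ ε₀) O := fun q hq =>
    hWB ⟨(hrs ⟨hq.1.2, hq.1.1⟩).2, hεB hq.2⟩
  have hψ' : ContDiffOn ℝ ∞ (fun q : E × ℝ => ψ (φ.symm q.1, q.2))
      ((range I ∩ ball (φ x₀) r) ×ˢ ball s₀ ε₀) := by
    rw [← contMDiffOn_iff_contDiffOn]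
    refine hψ.comp (ContMDiffOn.prodMk ?_ ?_) hmaps
    · exact (contMDiffOn_extChartAt_symm x₀).comp
        (contMDiffOn_iff_contDiffOn.2 contDiffOn_fst) fun q hq => (hrs ⟨hq.1.2, hq.1.1⟩).1
    · exact contMDiffOn_iff_contDiffOn.2 contDiffOn_snd
  have hx₀ : φ.symm (φ x₀) = x₀ := extChartAt_to_inv x₀
  have hrange : φ x₀ ∈ range I := mem_range_self _
  obtain ⟨δ, hδ, hδr, ε, hε, hεε, σ, hσ, h⟩ := exists_implicit I.uniqueDiffOn hrange hr
    hε₀ hψ' (by simpa only [hx₀] using hd) hd0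
  simp only [hx₀] at hσ h
  set W := φ.source ∩ φ ⁻¹' ball (φ x₀) δ with hW
  have hWo : IsOpen W :=
    (continuousOn_extChartAt x₀).isOpen_inter_preimage (isOpen_extChartAt_source x₀) isOpen_ball
  have hmem : ∀ x ∈ W, φ x ∈ range I ∩ ball (φ x₀) δ := fun x hx => ⟨mem_range_self _, hx.2⟩
  refine ⟨W, hWo, ⟨mem_extChartAt_source x₀, mem_ball_self hδ⟩, δ, hδ, ε, hε,
    fun q => σ (φ q.1, q.2), ?_, ?_, ?_⟩
  · have h2 : ContMDiffOn (I.prod 𝓘(ℝ, ℝ)) 𝓘(ℝ, E × ℝ) ∞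
        (fun q : M × ℝ => (φ q.1, q.2)) (W ×ˢ ball (ψ (x₀, s₀)) δ) := by
      refine ContMDiffOn.prodMk_space ?_ contMDiffOn_snd
      refine (contMDiffOn_extChartAt (I := I) (x := x₀) (n := ∞)).comp contMDiffOn_fst
        fun q hq => ?_
      simpa [φ] using hq.1.1
    exact (contMDiffOn_iff_contDiffOn.2 hσ).comp h2 fun q hq => ⟨hmem _ hq.1, hq.2⟩
  · rintro ⟨x, s⟩ ⟨hx, hs⟩
    have := hmaps (x := (φ x, s)) ⟨⟨mem_range_self _, ball_subset_ball hδr hx.2⟩,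
      ball_subset_ball hεε hs⟩
    simpa only [φ.left_inv hx.1] using this
  · intro x hx ρ hρ
    have := h (φ x) (hmem x hx) ρ hρ
    simpa only [φ.left_inv hx.1] using this

variable [T2Space M] [CompleteSpace E]

omit [CompleteSpace E] in
theorem IsSmoothField.hasDerivAt_extChartAt_flow (hF : IsSmoothField I F) {x p : M} {s : ℝ}
    (hs : (x, s) ∈ flowDomain F) (hp : flow F x s ∈ (extChartAt I p).source) :
    HasDerivAt (fun s => extChartAt I p (flow F x s))
      (chartField F p (extChartAt I p (flow F x s))) s := by
  obtain ⟨a, b, -, -, hsab, -, hc⟩ := hF.exists_Ioo_of_mem_flowDomain hs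
  have h1 := (hc.isMIntegralCurveAt (isOpen_Ioo.mem_nhds hsab)).eventually_hasDerivAt.self_of_nhds
  set q := flow F x s with hq
  have hqs := mem_extChartAt_source (I := I) q
  have h1' : HasDerivAt (extChartAt I q ∘ flow F x) (F q) s := by
    refine h1.congr_deriv ?_
    exact tangentCoordChange_self hqs
  have h2 := (hasFDerivWithinAt_tangentCoordChange (I := I) (x := q) (y := p) ⟨hqs, hp⟩)
  have h3 := HasFDerivWithinAt.comp_hasDerivAt_of_eq s h2 h1'
    (Eventually.of_forall fun t => mem_range_self _) rfl
  rw [chartField_extChartAt hp]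
  refine h3.congr_of_eventuallyEq ?_
  have hcs : ContinuousAt (flow F x) s :=
    (hF.hasMFDerivAt_flow hs).continuousAt
  filter_upwards [hcs.eventually ((isOpen_extChartAt_source (I := I) q).mem_nhds hqs)] with t ht
  simp only [Function.comp_apply, (extChartAt I q).left_inv ht]

omit [T2Space M] [CompleteSpace E] in
theorem exists_apply_chartField_ne_zero {p : M} (hp : F p ≠ 0) :
    ∃ l : E →L[ℝ] ℝ, l (chartField F p (extChartAt I p p)) ≠ 0 := by
  obtain ⟨l, hl⟩ := SeparatingDual.exists_ne_zero (R := ℝ) (V := E)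
    (x := chartField F p (extChartAt I p p)) (by rw [chartField_self]; exact hp)
  exact ⟨l, hl⟩

/-- A solution `σ` of `l (chart (flow x (σ (x, ρ)))) = ρ` near a regular point of the flow. -/
theorem IsSmoothField.exists_time_function (hF : IsSmoothField I F) (hI : IsBoundaryModel I) {x₀ : M}
    {s₀ : ℝ} (h₀ : (x₀, s₀) ∈ flowDomain F) {l : E →L[ℝ] ℝ}
    (hl : l (chartField F (flow F x₀ s₀) (extChartAt I (flow F x₀ s₀) (flow F x₀ s₀))) ≠ 0) :
    ∃ W : Set M, IsOpen W ∧ x₀ ∈ W ∧ ∃ δ > 0, ∃ ε > 0, ∃ σ : M × ℝ → ℝ,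
      ContMDiffOn (I.prod 𝓘(ℝ, ℝ)) 𝓘(ℝ, ℝ) ∞ σ
        (W ×ˢ ball (l (extChartAt I (flow F x₀ s₀) (flow F x₀ s₀))) δ) ∧
      (∀ x ∈ W, ∀ s ∈ ball s₀ ε, (x, s) ∈ flowDomain F ∧
        flow F x s ∈ (extChartAt I (flow F x₀ s₀)).source) ∧
      ∀ x ∈ W, ∀ ρ ∈ ball (l (extChartAt I (flow F x₀ s₀) (flow F x₀ s₀))) δ, σ (x, ρ) ∈ ball s₀ ε ∧
        l (extChartAt I (flow F x₀ s₀) (flow F x (σ (x, ρ)))) = ρ ∧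
        ∀ s ∈ ball s₀ ε, l (extChartAt I (flow F x₀ s₀) (flow F x s)) = ρ → s = σ (x, ρ) := by
  set p := flow F x₀ s₀ with hp
  set O := flowDomain F ∩ (fun q : M × ℝ => flow F q.1 q.2) ⁻¹' (extChartAt I p).source with hO
  have hfc : ContinuousOn (fun q : M × ℝ => flow F q.1 q.2) (flowDomain F) := fun q hq =>
    (hF.contMDiffAt_flow hI hq).continuousAt.continuousWithinAt
  have hOo : IsOpen O := hfc.isOpen_inter_preimage (hF.isOpen_flowDomain hI)
    (isOpen_extChartAt_source p)
  have hψ : ContMDiffOn (I.prod 𝓘(ℝ, ℝ)) 𝓘(ℝ, ℝ) ∞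
      (fun q : M × ℝ => l (extChartAt I p (flow F q.1 q.2))) O := by
    have h1 : ContMDiffOn (I.prod 𝓘(ℝ, ℝ)) 𝓘(ℝ, E) ∞
        (fun q : M × ℝ => extChartAt I p (flow F q.1 q.2)) O :=
      (contMDiffOn_extChartAt (I := I) (x := p) (n := ∞)).comp
        (fun q hq => (hF.contMDiffAt_flow hI hq.1).contMDiffWithinAt) fun q hq => by
          simpa using hq.2
    exact l.contDiff.contMDiff.comp_contMDiffOn h1
  obtain ⟨W, hW, hxW, δ, hδ, ε, hε, σ, hσ, hWO, h⟩ := exists_implicit_manifold hOo hψ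
    (x₀ := x₀) (s₀ := s₀) ⟨h₀, mem_extChartAt_source p⟩
    (l.hasFDerivAt.comp_hasDerivAt s₀ (hF.hasDerivAt_extChartAt_flow h₀ (mem_extChartAt_source p)))
    hl
  exact ⟨W, hW, hxW, δ, hδ, ε, hε, σ, hσ, fun x hx s hs => hWO (mk_mem_prod hx hs), h⟩

omit [CompleteSpace E] in
/-- The times at which a regular integral curve passes through a given point are countable. -/
theorem IsSmoothField.countable_setOf_flow_eq (hF : IsSmoothField I F) {x y : M} (hy : F y ≠ 0) :
    {s : ℝ | (x, s) ∈ flowDomain F ∧ flow F x s = y}.Countable := by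
  refine Set.countable_of_isolated fun s hs => ?_
  obtain ⟨l, hl⟩ := exists_apply_chartField_ne_zero hy
  have h1 := l.hasFDerivAt.comp_hasDerivAt s (hF.hasDerivAt_extChartAt_flow (p := y) hs.1
    (by rw [hs.2]; exact mem_extChartAt_source y))
  rw [hs.2] at h1
  filter_upwards [h1.eventually_ne (c := l (extChartAt I y y)) hl] with t ht ht'
  exact ht (by simp only [Function.comp_apply, ht'.2])

/-- Near a regular point there is a function `τ` such that a curve which stays in a single orbit
moves along this orbit by the time `τ`. -/
theorem IsSmoothField.exists_plaque_time (hF : IsSmoothField I F) (hI : IsBoundaryModel I) {p₀ : M}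
    (hp₀ : F p₀ ≠ 0) : ∃ W : Set M, IsOpen W ∧ p₀ ∈ W ∧ ∃ τ : M → ℝ,
      ContMDiffOn I 𝓘(ℝ, ℝ) ∞ τ W ∧
      ∀ (T : Set ℝ) (κ : ℝ → M) (q : M), IsPreconnected T → ContinuousOn κ T → MapsTo κ T W →
        (∀ t ∈ T, κ t ∈ orbit F q) → ∀ t ∈ T, ∀ t' ∈ T,
        (κ t, τ (κ t) - τ (κ t')) ∈ flowDomain F ∧ flow F (κ t) (τ (κ t) - τ (κ t')) = κ t' := by
  obtain ⟨l, hl⟩ := exists_apply_chartField_ne_zero hp₀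
  have h₀ := hF.flow_zero hI p₀
  obtain ⟨W, hW, hpW, δ, hδ, ε, hε, σ, hσ, hWd, h⟩ := hF.exists_time_function hI (x₀ := p₀) (s₀ := 0)
    h₀.1 (l := l) (by rw [h₀.2]; exact hl)
  simp only [h₀.2] at hσ hWd h
  set ρ := l (extChartAt I p₀ p₀) with hρ
  have hρb : ρ ∈ ball ρ δ := mem_ball_self hδ
  -- `τ x` is the time at which the orbit of `x` reaches the level set `l = ρ`, which is transverse
  -- to `F` at `p₀`; `θ` below projects a curve to this level set along the flow.
  set τ : M → ℝ := fun x => σ (x, ρ) with hτ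
  have hτs : ContMDiffOn I 𝓘(ℝ, ℝ) ∞ τ W :=
    hσ.comp (contMDiffOn_id.prodMk contMDiffOn_const) fun x hx => ⟨hx, hρb⟩
  refine ⟨W, hW, hpW, τ, hτs, fun T κ q hT hκ hκW hκq => ?_⟩
  set θ : ℝ → M := fun t => flow F (κ t) (τ (κ t)) with hθ
  have hdom : ∀ t ∈ T, (κ t, τ (κ t)) ∈ flowDomain F ∧ θ t ∈ (extChartAt I p₀).source := fun t ht =>
    hWd _ (hκW ht) _ (h _ (hκW ht) _ hρb).1
  have hθc : ContinuousOn (fun t => extChartAt I p₀ (θ t)) T := by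
    have h1 : ContinuousOn θ T := fun t ht =>
      (hF.contMDiffAt_flow hI (hdom t ht).1).continuousAt.comp_continuousWithinAt
        (f := fun t => (κ t, τ (κ t))) ((hκ t ht).prodMk
          ((hτs.continuousOn _ (hκW ht)).comp (hκ t ht) hκW))
    exact (continuousOn_extChartAt p₀).comp h1 fun t ht => (hdom t ht).2
  -- The orbit of `q` may return to `W` infinitely often, but it meets the level set at isolated
  -- times, hence countably many. So the connected image of `θ` is a single point.
  set A : Set ℝ := {s | (q, s) ∈ flowDomain F ∧ ∃ t ∈ T, θ t = flow F q s} with hA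
  have hAc : A.Countable := by
    refine Set.countable_of_isolated ?_
    rintro s ⟨hs, t, ht, hst⟩
    have hκt := hκW ht
    have hτt := h _ hκt _ hρb
    have hev : ∀ᶠ s' in 𝓝[≠] s, τ (κ t) + (s' - s) ∈ ball 0 ε := by
      refine eventually_nhdsWithin_of_eventually_nhds ?_
      have hc : ContinuousAt (fun s' => τ (κ t) + (s' - s)) s := by fun_prop
      refine hc.eventually_mem (isOpen_ball.mem_nhds ?_)
      simpa using hτt.1
    filter_upwards [hev, self_mem_nhdsWithin] with s' hs' hne hmem
    obtain ⟨hs'd, t', ht', hst'⟩ := hmem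
    have h1 := hF.flow_sub hs hs'd
    rw [← hst] at h1
    have h2 := hF.flow_add (hdom t ht).1 h1.1
    have h3 := hτt.2.2 _ hs' (by
      rw [h2.2, h1.2, ← hst']
      exact (h _ (hκW ht') _ hρb).2.1)
    exact hne (by simp only [hτ] at h3; simp only [mem_singleton_iff]; linarith)
  have hcount : ((fun t => extChartAt I p₀ (θ t)) '' T).Countable := by
    refine (hAc.image fun s => extChartAt I p₀ (flow F q s)).mono ?_
    rintro _ ⟨t, ht, rfl⟩
    have h1 : θ t ∈ orbit F q := hF.flow_mem_orbit (hκq t ht) (hdom t ht).1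
    obtain ⟨s, hs, hst⟩ := h1
    exact ⟨s, ⟨hs, t, ht, hst⟩, by simp only [hst]⟩
  intro t ht t' ht'
  have h1 : θ t = θ t' := (extChartAt I p₀).injOn (hdom t ht).2 (hdom t' ht').2
    (hT.eq_of_countable_image hθc hcount ht ht')
  have h2 := hF.flow_neg hI (hdom t' ht').1
  -- Both points flow to the same point of the level set. Going there from `κ t` and back to `κ t'`
  -- takes time `τ (κ t) - τ (κ t')`.
  have h3 : flow F (κ t') (τ (κ t')) = flow F (κ t) (τ (κ t)) := h1.symm
  rw [h3] at h2
  have h4 := hF.flow_add (hdom t ht).1 h2.1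
  rw [← sub_eq_add_neg] at h4
  exact ⟨h4.1, h4.2.trans h2.2⟩

/-- Continuous shift functions along a curve which agree at one time agree. -/
theorem IsSmoothField.eqOn_of_flow_eq (hF : IsSmoothField I F) (hI : IsBoundaryModel I) {x : M}
    (hx : F x ≠ 0) {T : Set ℝ} (hT : IsPreconnected T) {a b : ℝ → ℝ} (ha : ContinuousOn a T)
    (hb : ContinuousOn b T) (had : ∀ t ∈ T, (x, a t) ∈ flowDomain F)
    (hbd : ∀ t ∈ T, (x, b t) ∈ flowDomain F) (h : ∀ t ∈ T, flow F x (a t) = flow F x (b t)) {t₀ : ℝ}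
    (ht₀ : t₀ ∈ T) (h₀ : a t₀ = b t₀) : EqOn a b T := by
  intro t ht
  -- The difference of two shift functions is a return time of `x` to itself, and these are
  -- countable.
  have hc : ((fun t => a t - b t) '' T).Countable := by
    refine (hF.countable_setOf_flow_eq (x := x) hx).mono ?_
    rintro _ ⟨t, ht, rfl⟩
    have h1 := hF.flow_neg hI (hbd t ht)
    rw [← h t ht] at h1
    have h2 := hF.flow_add (had t ht) h1.1
    rw [← sub_eq_add_neg] at h2
    exact ⟨h2.1, h2.2.trans h1.2⟩
  have h1 : a t - b t = a t₀ - b t₀ := hT.eq_of_countable_image (ha.sub hb) hc ht ht₀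
  linarith

end Lifts

/-! ### Existence and smoothness of shift functions over regular points -/

section LiftExistence

open Metric Filter

variable {E : Type u} [NormedAddCommGroup E] [NormedSpace ℝ E]
  {H : Type v} [TopologicalSpace H] {I : ModelWithCorners ℝ E H}
  {M : Type w} [TopologicalSpace M] [ChartedSpace H M] [IsManifold I ∞ M]
  {F : ∀ p : M, TangentSpace I p} [T2Space M] [CompleteSpace E]

theorem IsSmoothField.ne_zero_of_mem_orbit (hF : IsSmoothField I F) (hI : IsBoundaryModel I) {p q : M}
    (hq : F q ≠ 0) (hp : p ∈ orbit F q) : F p ≠ 0 := by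
  obtain ⟨t, ht, rfl⟩ := hp
  exact hF.flow_ne_zero hI ht hq

/-- Local existence of continuous shift functions along a family of curves in regular orbits. -/
theorem IsSmoothField.exists_local_lift (hF : IsSmoothField I F) (hI : IsBoundaryModel I)
    {X : Type*} [TopologicalSpace X] {R : Set X} (hR : IsOpen R) {g : X → M} {K : X × ℝ → M}
    (hK : ContinuousOn K (R ×ˢ univ)) (hreg : ∀ x ∈ R, F (g x) ≠ 0)
    (horb : ∀ x ∈ R, ∀ t, K (x, t) ∈ orbit F (g x)) {α₀ : X → ℝ} (hα₀ : ContinuousOn α₀ R)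
    (h₀ : ∀ x ∈ R, (g x, α₀ x) ∈ flowDomain F ∧ K (x, 0) = flow F (g x) (α₀ x)) {x₀ : X}
    (hx₀ : x₀ ∈ R) :
    ∃ N : Set X, IsOpen N ∧ x₀ ∈ N ∧ N ⊆ R ∧ ∃ L : X × ℝ → ℝ, ContinuousOn L (N ×ˢ Icc 0 1) ∧
      ∀ x ∈ N, L (x, 0) = α₀ x ∧ ∀ t ∈ Icc (0 : ℝ) 1, (g x, L (x, t)) ∈ flowDomain F ∧
        K (x, t) = flow F (g x) (L (x, t)) := by
  have hKc : ∀ t, ContinuousAt K (x₀, t) := fun t =>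
    hK.continuousAt ((hR.prod isOpen_univ).mem_nhds ⟨hx₀, mem_univ t⟩)
  choose W hWo hW τ hτ hτW using fun t : ℝ =>
    hF.exists_plaque_time hI (hF.ne_zero_of_mem_orbit hI (hreg x₀ hx₀) (horb x₀ hx₀ t))
  have hcx : Continuous fun t : ℝ => K (x₀, t) := by
    rw [continuous_iff_continuousAt]
    exact fun t => (hKc t).comp (f := fun t => (x₀, t)) (by fun_prop)
  -- By compactness `[0,1]` splits into finitely many intervals on each of which the curve of `x₀`
  -- lies in a single plaque neighbourhood. The lift is continued interval by interval.
  obtain ⟨a, ha0, ham, ⟨n, hn⟩, hacov⟩ := exists_monotone_Icc_subset_open_cover_unitInterval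
    (c := fun i : ℝ => {t : unitInterval | K (x₀, t) ∈ W i})
    (fun i => (hWo i).preimage (hcx.comp continuous_subtype_val))
    (fun t _ => mem_iUnion.2 ⟨t, hW t⟩)
  have key : ∀ n : ℕ, ∃ N : Set X, IsOpen N ∧ x₀ ∈ N ∧ N ⊆ R ∧ ∃ L : X × ℝ → ℝ,
      ContinuousOn L (N ×ˢ Icc 0 (a n : ℝ)) ∧ ∀ x ∈ N, L (x, 0) = α₀ x ∧
        ∀ t ∈ Icc (0 : ℝ) (a n), (g x, L (x, t)) ∈ flowDomain F ∧
          K (x, t) = flow F (g x) (L (x, t)) := by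
    intro n
    induction n with
    | zero =>
      refine ⟨R, hR, hx₀, subset_rfl, fun q => α₀ q.1, hα₀.comp continuousOn_fst fun q hq => hq.1,
        fun x hx => ⟨rfl, fun t ht => ?_⟩⟩
      have h1 : t = 0 := by
        rw [ha0] at ht
        exact le_antisymm ht.2 ht.1
      rw [h1]
      exact h₀ x hx
    | succ n ih =>
      obtain ⟨N, hNo, hxN, hNR, L, hL, hLl⟩ := ih
      obtain ⟨i, hi⟩ := hacov n
      have hab : (a n : ℝ) ≤ a (n + 1) := ham n.le_succ
      have ha0' : (0 : ℝ) ≤ a n := (a n).2.1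
      have hev : ∀ᶠ x in 𝓝 x₀, ∀ t ∈ Icc (a n : ℝ) (a (n + 1)), K (x, t) ∈ W i := by
        refine isCompact_Icc.eventually_forall_of_forall_eventually fun t ht => ?_
        have ht' : K (x₀, t) ∈ W i :=
          hi (show (⟨t, ha0'.trans ht.1, ht.2.trans (a (n + 1)).2.2⟩ : unitInterval) ∈ _ from ht)
        exact (hKc t).eventually ((hWo i).mem_nhds ht')
      obtain ⟨N', hN', hN'o, hxN'⟩ := _root_.mem_nhds_iff.1 hev
      refine ⟨N ∩ N', hNo.inter hN'o, ⟨hxN, hxN'⟩, inter_subset_left.trans hNR,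
        -- Truncating the time at `a n` lets one formula serve on both sides: the bracket is zero
        -- before `a n`, and the first term is frozen afterwards.
        fun q => L (q.1, min q.2 (a n)) + (τ i (K (q.1, a n)) - τ i (K (q.1, max q.2 (a n)))),
        ?_, ?_⟩
      · have h1 : ContinuousOn (fun q : X × ℝ => L (q.1, min q.2 (a n)))
            ((N ∩ N') ×ˢ Icc 0 (a (n + 1) : ℝ)) :=
          hL.comp (by fun_prop) fun q hq => ⟨hq.1.1, le_min hq.2.1 ha0', min_le_right _ _⟩
        have h2 : ContinuousOn (fun q : X × ℝ => τ i (K (q.1, a n)))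
            ((N ∩ N') ×ˢ Icc 0 (a (n + 1) : ℝ)) :=
          (hτ i).continuousOn.comp (hK.comp (f := fun q : X × ℝ => (q.1, (a n : ℝ))) (by fun_prop)
            fun q hq => ⟨hNR hq.1.1, mem_univ _⟩) fun q hq => hN' hq.1.2 _ ⟨le_rfl, hab⟩
        have h3 : ContinuousOn (fun q : X × ℝ => τ i (K (q.1, max q.2 (a n))))
            ((N ∩ N') ×ˢ Icc 0 (a (n + 1) : ℝ)) :=
          (hτ i).continuousOn.comp (hK.comp (f := fun q : X × ℝ => (q.1, max q.2 (a n : ℝ)))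
            (by fun_prop) fun q hq => ⟨hNR hq.1.1, mem_univ _⟩)
            fun q hq => hN' hq.1.2 _ ⟨le_max_right _ _, max_le hq.2.2 hab⟩
        exact h1.add (h2.sub h3)
      · intro x hx
        have hlx := hLl x hx.1
        refine ⟨by simp [ha0', hlx.1], fun t ht => ?_⟩
        dsimp only
        rcases le_total t (a n) with h | h
        · rw [min_eq_left h, max_eq_right h, sub_self, add_zero]
          exact hlx.2 t ⟨ht.1, h⟩
        · rw [min_eq_right h, max_eq_left h]
          have h1 := hlx.2 _ ⟨ha0', le_rfl⟩
          have hcκ : Continuous fun t : ℝ => K (x, t) := by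
            rw [← continuousOn_univ]
            exact hK.comp (by fun_prop) fun t _ => ⟨hNR hx.1, mem_univ t⟩
          have h2 := hτW i (Icc (a n : ℝ) (a (n + 1))) (fun t => K (x, t)) (g x) isPreconnected_Icc
            hcκ.continuousOn (fun t ht => hN' hx.2 t ht) (fun t _ => horb x (hNR hx.1) t) (a n)
            ⟨le_rfl, hab⟩ t ⟨h, ht.2⟩
          rw [h1.2] at h2
          have h3 := hF.flow_add h1.1 h2.1
          rw [h1.2]
          exact ⟨h3.1, (h3.2.trans h2.2).symm⟩
  have h1 := key n
  rw [hn n le_rfl] at h1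
  exact h1

/-- Existence of continuous shift functions along a family of curves in regular orbits. -/
theorem IsSmoothField.exists_lift (hF : IsSmoothField I F) (hI : IsBoundaryModel I)
    {X : Type*} [TopologicalSpace X] {R : Set X} (hR : IsOpen R) {g : X → M} {K : X × ℝ → M}
    (hK : ContinuousOn K (R ×ˢ Icc 0 1)) (hreg : ∀ x ∈ R, F (g x) ≠ 0)
    (horb : ∀ x ∈ R, ∀ t ∈ Icc (0 : ℝ) 1, K (x, t) ∈ orbit F (g x)) {α₀ : X → ℝ}
    (hα₀ : ContinuousOn α₀ R)
    (h₀ : ∀ x ∈ R, (g x, α₀ x) ∈ flowDomain F ∧ K (x, 0) = flow F (g x) (α₀ x)) :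
    ∃ L : X × ℝ → ℝ, ContinuousOn L (R ×ˢ Icc 0 1) ∧
      ∀ x ∈ R, L (x, 0) = α₀ x ∧ ∀ t ∈ Icc (0 : ℝ) 1, (g x, L (x, t)) ∈ flowDomain F ∧
        K (x, t) = flow F (g x) (L (x, t)) := by
  -- The local lemma wants a family over all real times, so the homotopy is made constant outside
  -- `[0,1]`.
  set K' : X × ℝ → M := fun q => K (q.1, max 0 (min q.2 1)) with hK'
  have hpr : ∀ t : ℝ, max 0 (min t 1) ∈ Icc (0 : ℝ) 1 := fun t =>
    ⟨le_max_left _ _, max_le zero_le_one (min_le_right _ _)⟩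
  have hprI : ∀ t ∈ Icc (0 : ℝ) 1, max 0 (min t 1) = t := fun t ht => by
    rw [min_eq_left ht.2, max_eq_right ht.1]
  have hloc : ∀ x₀ : X, ∃ (N : Set X) (L : X × ℝ → ℝ), x₀ ∈ R → IsOpen N ∧ x₀ ∈ N ∧ N ⊆ R ∧
      ContinuousOn L (N ×ˢ Icc 0 1) ∧ ∀ x ∈ N, L (x, 0) = α₀ x ∧
        ∀ t ∈ Icc (0 : ℝ) 1, (g x, L (x, t)) ∈ flowDomain F ∧ K (x, t) = flow F (g x) (L (x, t)) := by
    intro x₀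
    by_cases hx₀ : x₀ ∈ R
    · obtain ⟨N, hN, hxN, hNR, L, hL, h⟩ := hF.exists_local_lift hI hR (g := g) (K := K')
        (hK.comp (by fun_prop) fun q hq => ⟨hq.1, hpr _⟩) hreg
        (fun x hx t => horb x hx _ (hpr t)) hα₀ (fun x hx => by
          simp only [hK', hprI 0 ⟨le_rfl, zero_le_one⟩]
          exact h₀ x hx) hx₀
      refine ⟨N, L, fun _ => ⟨hN, hxN, hNR, hL, fun x hx => ⟨(h x hx).1, fun t ht => ?_⟩⟩⟩
      have := (h x hx).2 t ht
      simpa only [hK', hprI t ht] using this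
    · exact ⟨∅, fun _ => 0, fun h => absurd h hx₀⟩
  choose N L hL using hloc
  have hzero : (0 : ℝ) ∈ Icc (0 : ℝ) 1 := ⟨le_rfl, zero_le_one⟩
  -- Each point uses the lift chosen around itself. By uniqueness these choices agree with the one
  -- lift around `x₀` nearby, which gives continuity.
  refine ⟨fun q => L q.1 q, ?_, fun x hx => (hL x hx).2.2.2.2 x (hL x hx).2.1⟩
  rintro ⟨x₀, t₀⟩ ⟨hx₀, ht₀⟩
  obtain ⟨hNo, hxN, hNR, hLc, hLl⟩ := hL x₀ hx₀
  have heq : ∀ q ∈ N x₀ ×ˢ Icc (0 : ℝ) 1, L q.1 q = L x₀ q := by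
    rintro ⟨x, t⟩ ⟨hx, ht⟩
    obtain ⟨-, hxN', -, hLc', hLl'⟩ := hL x (hNR hx)
    refine hF.eqOn_of_flow_eq hI (hreg x (hNR hx)) isPreconnected_Icc (T := Icc 0 1)
      (a := fun t => L x (x, t)) (b := fun t => L x₀ (x, t))
      (hLc'.comp (by fun_prop) fun t ht => ⟨hxN', ht⟩) (hLc.comp (by fun_prop) fun t ht => ⟨hx, ht⟩)
      (fun t ht => ((hLl' x hxN').2 t ht).1) (fun t ht => ((hLl x hx).2 t ht).1)
      (fun t ht => ((hLl' x hxN').2 t ht).2.symm.trans ((hLl x hx).2 t ht).2) hzero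
      ((hLl' x hxN').1.trans (hLl x hx).1.symm) ht
  have h1 : ContinuousWithinAt (fun q => L q.1 q) (N x₀ ×ˢ Icc (0 : ℝ) 1) (x₀, t₀) :=
    (hLc _ ⟨hxN, ht₀⟩).congr heq (heq _ ⟨hxN, ht₀⟩)
  refine h1.mono_of_mem_nhdsWithin ?_
  rw [nhdsWithin_prod_eq]
  exact prod_mem_prod (mem_nhdsWithin_of_mem_nhds (hNo.mem_nhds hxN)) self_mem_nhdsWithin

/-- A continuous shift function is as smooth as the map it represents, at regular points. -/
theorem IsSmoothField.contMDiffWithinAt_shift (hF : IsSmoothField I F) (hI : IsBoundaryModel I)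
    {E' : Type*} [NormedAddCommGroup E'] [NormedSpace ℝ E'] {H' : Type*} [TopologicalSpace H']
    {J : ModelWithCorners ℝ E' H'} {Z : Type*} [TopologicalSpace Z] [ChartedSpace H' Z]
    {S : Set Z} {z : Z} {g k : Z → M} {a : Z → ℝ} (hg : ContMDiffWithinAt J I ∞ g S z)
    (hk : ContMDiffWithinAt J I ∞ k S z) (ha : ContinuousWithinAt a S z)
    (hdom : (g z, a z) ∈ flowDomain F) (heq : ∀ y ∈ S, k y = flow F (g y) (a y)) (hz : z ∈ S)
    (hreg : F (g z) ≠ 0) : ContMDiffWithinAt J 𝓘(ℝ, ℝ) ∞ a S z := by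
  have hkz := heq z hz
  obtain ⟨l, hl⟩ := exists_apply_chartField_ne_zero (hF.flow_ne_zero hI hdom hreg)
  obtain ⟨W, hW, hgW, δ, hδ, ε, hε, σ, hσ, -, h⟩ := hF.exists_time_function hI hdom hl
  set p := flow F (g z) (a z) with hp
  have hcz : ContMDiffWithinAt J 𝓘(ℝ, ℝ) ∞ (fun y => l (extChartAt I p (k y))) S z := by
    have h1 : ContMDiffWithinAt J 𝓘(ℝ, E) ∞ (fun y => extChartAt I p (k y)) S z := by
      have h2 : ContMDiffAt I 𝓘(ℝ, E) ∞ (extChartAt I p) (k z) := by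
        rw [hkz]
        exact contMDiffAt_extChartAt
      exact h2.comp_contMDiffWithinAt z hk
    exact (l.contDiff.contMDiff _).comp_contMDiffWithinAt z h1
  have hmem : (g z, l (extChartAt I p (k z))) ∈ W ×ˢ ball (l (extChartAt I p p)) δ :=
    ⟨hgW, by rw [hkz]; exact mem_ball_self hδ⟩
  have h1 : ContMDiffWithinAt J 𝓘(ℝ, ℝ) ∞ (fun y => σ (g y, l (extChartAt I p (k y)))) S z :=
    (hσ.contMDiffAt ((hW.prod isOpen_ball).mem_nhds hmem)).comp_contMDiffWithinAt
      (f := fun y => (g y, l (extChartAt I p (k y)))) z (hg.prodMk hcz)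
  -- Continuity of `a` keeps it in the window where the implicit solution `σ` is unique.
  have hev : ∀ᶠ y in 𝓝[S] z, a y = σ (g y, l (extChartAt I p (k y))) := by
    filter_upwards [self_mem_nhdsWithin, hg.continuousWithinAt.eventually (hW.mem_nhds hgW),
      hcz.continuousWithinAt.eventually (isOpen_ball.mem_nhds hmem.2),
      ha.eventually (ball_mem_nhds _ hε)] with y hy h2 h3 h4
    exact (h _ h2 _ h3).2.2 _ h4 (by rw [heq y hy])
  exact h1.congr_of_eventuallyEq hev (hev.self_of_nhdsWithin hz)

end LiftExistence

/-! ### Shift maps preserve orbits and are isotopic to the inclusion -/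

section ShiftMaps

open Metric Filter

variable {E : Type u} [NormedAddCommGroup E] [NormedSpace ℝ E]
  {H : Type v} [TopologicalSpace H] {I : ModelWithCorners ℝ E H}
  {M : Type w} [TopologicalSpace M] [ChartedSpace H M]

/-- A smooth map on an open subset, extended by a constant, is smooth on this subset. -/
theorem contMDiffOn_extend {E' : Type*} [NormedAddCommGroup E'] [NormedSpace ℝ E'] {H' : Type*}
    [TopologicalSpace H'] {J : ModelWithCorners ℝ E' H'} {N : Type*} [TopologicalSpace N]
    [ChartedSpace H' N] {V : Opens M} {f : V → N} (hf : ContMDiff I J ∞ f) (c : N) :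
    ContMDiffOn I J ∞ (Function.extend Subtype.val f fun _ => c) V := by
  intro x hx
  refine ContMDiffAt.contMDiffWithinAt ?_
  have h1 : (fun x : V => Function.extend Subtype.val f (fun _ => c) (x : M)) = f :=
    funext fun x => Subtype.val_injective.extend_apply f _ x
  have h2 := hf ⟨x, hx⟩
  rw [← h1] at h2
  exact contMDiffAt_subtype_iff.1 h2

variable [IsManifold I ∞ M] {F : ∀ p : M, TangentSpace I p} [T2Space M] [CompleteSpace E]

theorem IsSmoothField.isOpen_setOf_flow_mem (hF : IsSmoothField I F) (hI : IsBoundaryModel I)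
    (V : Opens M) : IsOpen {q : M × ℝ | q ∈ flowDomain F ∧ flow F q.1 q.2 ∈ V} := by
  have hfc : ContinuousOn (fun q : M × ℝ => flow F q.1 q.2) (flowDomain F) := fun q hq =>
    (hF.contMDiffAt_flow hI hq).continuousAt.continuousWithinAt
  exact hfc.isOpen_inter_preimage (hF.isOpen_flowDomain hI) V.isOpen

theorem IsSmoothField.contMDiff_shiftMap (hF : IsSmoothField I F) (hI : IsBoundaryModel I)
    {V : Opens M} {α : V → ℝ} (hα : α ∈ shiftFunctions F V) : ContMDiff I I ∞ (shiftMap F V α) :=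
  fun p => (hF.contMDiffAt_flow hI (hα.2 p)).comp p
    (f := fun p : V => ((p : M), α p)) ((contMDiff_subtype_val p).prodMk (hα.1 p))

/-- The inverse is `q ↦ flow F q (-s q)`, where `s` solves `s = α (flow F q (-s))`. At the zero `z`
the flow stands still, so the left side minus the right side has derivative `1` in `s`, and the
implicit function theorem applies. -/
theorem IsSmoothField.isLocalDiffeomorphAt_shiftMap (hF : IsSmoothField I F)
    (hI : IsBoundaryModel I) {V : Opens M} {α : V → ℝ} (hα : α ∈ shiftFunctions F V) {z : V}
    (hz : F z = 0) : IsLocalDiffeomorphAt I I ∞ (shiftMap F V α) z := by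
  set β : M → ℝ := Function.extend Subtype.val α fun _ => 0 with hβ
  have hβα : ∀ x : V, β x = α x := fun x => Subtype.val_injective.extend_apply α _ x
  have hβs : ContMDiffOn I 𝓘(ℝ, ℝ) ∞ β V := contMDiffOn_extend hα.1 0
  set O : Set (M × ℝ) := (fun q : M × ℝ => (q.1, -q.2)) ⁻¹'
    {q : M × ℝ | q ∈ flowDomain F ∧ flow F q.1 q.2 ∈ V} with hO
  have hOo : IsOpen O := (hF.isOpen_setOf_flow_mem hI V).preimage (by fun_prop)
  have hneg : ContMDiff (I.prod 𝓘(ℝ, ℝ)) (I.prod 𝓘(ℝ, ℝ)) ∞ (fun q : M × ℝ => (q.1, -q.2)) :=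
    contMDiff_fst.prodMk ((contDiff_neg.contMDiff).comp contMDiff_snd)
  have hfl : ContMDiffOn (I.prod 𝓘(ℝ, ℝ)) I ∞ (fun q : M × ℝ => flow F q.1 (-q.2)) O := fun q hq =>
    ((hF.contMDiffAt_flow hI hq.1).comp q (hneg q)).contMDiffWithinAt
  have hψ : ContMDiffOn (I.prod 𝓘(ℝ, ℝ)) 𝓘(ℝ, ℝ) ∞
      (fun q : M × ℝ => q.2 - β (flow F q.1 (-q.2))) O :=
    contMDiffOn_snd.sub (hβs.comp hfl fun q hq => hq.2)
  have hfz : ∀ t, flow F (z : M) t = z := fun t => (hF.flow_of_eq_zero hz t).2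
  have h₀ : ((z : M), α z) ∈ O := by
    refine ⟨(hF.flow_of_eq_zero hz _).1, ?_⟩
    rw [hfz]
    exact z.2
  obtain ⟨W, hW, hzW, δ, hδ, ε, hε, σ, hσ, hWO, h⟩ := exists_implicit_manifold hOo hψ h₀ (d := 1)
    (by
      simp only [hfz]
      exact (hasDerivAt_id _).sub_const _) one_ne_zero
  have hψ0 : α z - β (flow F (z : M) (-α z)) = 0 := by rw [hfz, hβα, sub_self]
  simp only [hψ0] at hσ h
  have h0 : (0 : ℝ) ∈ ball (0 : ℝ) δ := mem_ball_self hδ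
  set s : M → ℝ := fun q => σ (q, 0) with hs
  have hss : ContMDiffOn I 𝓘(ℝ, ℝ) ∞ s W :=
    hσ.comp (contMDiffOn_id.prodMk contMDiffOn_const) fun q hq => ⟨hq, h0⟩
  have hsO : ∀ q ∈ W, (q, s q) ∈ O := fun q hq => hWO ⟨hq, (h q hq 0 h0).1⟩
  classical
  set g : M → V := fun q => if hq : flow F q (-s q) ∈ V then ⟨_, hq⟩ else z with hg
  have hgv : ∀ q ∈ W, (g q : M) = flow F q (-s q) := fun q hq => by
    have : flow F q (-s q) ∈ V := (hsO q hq).2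
    simp only [hg, dif_pos this]
  have hαg : ∀ q ∈ W, α (g q) = s q := fun q hq => by
    have h1 : s q - β (flow F q (-s q)) = 0 := (h q hq 0 h0).2.1
    rw [← hβα, hgv q hq]
    linarith
  have hfg : ∀ q ∈ W, shiftMap F V α (g q) = q := fun q hq => by
    have h1 := (hF.flow_neg hI (hsO q hq).1).2
    rw [neg_neg] at h1
    rw [shiftMap, hαg q hq, hgv q hq]
    exact h1
  have hgs : ContMDiffOn I I ∞ g W := by
    intro q hq
    rw [← ContMDiffWithinAt.subtypeVal_comp_iff]
    have h1 : ContMDiffOn I I ∞ (fun q => flow F q (-s q)) W :=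
      hfl.comp (contMDiffOn_id.prodMk hss) fun q hq => hsO q hq
    exact (h1 q hq).congr hgv (hgv q hq)
  have hφ := hF.contMDiff_shiftMap hI hα
  refine ⟨{ toFun := shiftMap F V α
            invFun := g
            source := shiftMap F V α ⁻¹' W ∩ α ⁻¹' ball (α z) ε
            target := W
            map_source' := fun x hx => hx.1
            map_target' := fun q hq => ⟨by rw [mem_preimage, hfg q hq]; exact hq, by
              rw [mem_preimage, hαg q hq]
              exact (h q hq 0 h0).1⟩
            left_inv' := fun x hx => ?_
            right_inv' := hfg
            open_source := (hW.preimage hφ.continuous).inter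
              (isOpen_ball.preimage hα.1.continuous)
            open_target := hW
            contMDiffOn_toFun := hφ.contMDiffOn
            contMDiffOn_invFun := hgs }, ⟨?_, mem_ball_self hε⟩, fun x _ => rfl⟩
  · have h1 := (hF.flow_neg hI (hα.2 x)).2
    have h2 : α x = s (shiftMap F V α x) := (h _ hx.1 0 h0).2.2 _ hx.2 (by
      simp only [shiftMap] at h1 ⊢
      rw [h1, hβα, sub_self])
    refine Subtype.ext ?_
    rw [hgv _ hx.1, ← h2]
    exact h1
  · rw [mem_preimage, shiftMap, hfz]
    exact hzW

theorem IsSmoothField.shiftMap_mem_orbitMaps (hF : IsSmoothField I F) (hI : IsBoundaryModel I)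
    {V : Opens M} {α : V → ℝ} (hα : α ∈ shiftFunctions F V) : shiftMap F V α ∈ orbitMaps F V :=
  ⟨hF.contMDiff_shiftMap hI hα, fun _ p hp => hF.flow_mem_orbit hp (hα.2 p),
    fun _ hz => hF.isLocalDiffeomorphAt_shiftMap hI hα hz⟩

theorem IsSmoothField.mul_mem_flowDomain (hF : IsSmoothField I F) (hI : IsBoundaryModel I) {p : M}
    {s t : ℝ} (hs : (p, s) ∈ flowDomain F) (ht : t ∈ Icc (0 : ℝ) 1) : (p, t * s) ∈ flowDomain F := by
  refine hF.mem_flowDomain_of_mem_uIcc (hF.flow_zero hI p).1 hs ?_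
  rcases le_total 0 s with h | h
  · rw [uIcc_of_le h]
    exact ⟨mul_nonneg ht.1 h, mul_le_of_le_one_left h ht.2⟩
  · rw [uIcc_of_ge h]
    exact ⟨by nlinarith [ht.2], mul_nonpos_of_nonneg_of_nonpos ht.1 h⟩

/-- The homotopy consists of the shifts by `t α`; these are defined because maximal intervals of
existence contain `0` and are intervals. -/
theorem IsSmoothField.shiftImage_subset_orbitMapsId (hF : IsSmoothField I F)
    (hI : IsBoundaryModel I) (V : Opens M) : shiftImage F V ⊆ orbitMapsId F V := by
  rintro _ ⟨α, hα, rfl⟩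
  have hd : ∀ (p : V), ∀ t ∈ Icc (0 : ℝ) 1, ((p : M), t * α p) ∈ flowDomain F := fun p t ht =>
    hF.mul_mem_flowDomain hI (hα.2 p) ht
  refine ⟨fun q => flow F q.1 (q.2 * α q.1), ?_, fun t ht => ?_, fun p => ?_, fun p => ?_⟩
  · rintro ⟨p, t⟩ ⟨-, ht⟩
    refine ContinuousAt.continuousWithinAt ?_
    have h1 : ContinuousAt (fun q : V × ℝ => ((q.1 : M), q.2 * α q.1)) (p, t) := by
      have := hα.1.continuous
      fun_prop
    exact ContinuousAt.comp (f := fun q : V × ℝ => ((q.1 : M), q.2 * α q.1))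
      (hF.contMDiffAt_flow hI (hd p t ht)).continuousAt h1
  · exact hF.shiftMap_mem_orbitMaps hI (α := fun p => t * α p)
      ⟨contMDiff_const.mul hα.1, fun p => hd p t ht⟩
  · simp only [zero_mul]
    exact (hF.flow_zero hI _).2
  · simp only [one_mul]
    rfl

end ShiftMaps

/-! ### Coordinates adapted to a regular extension of a linear field -/

section LinearChart

open Metric Filter

variable {E : Type u} [NormedAddCommGroup E] [NormedSpace ℝ E]
  {H : Type v} [TopologicalSpace H] {I : ModelWithCorners ℝ E H}
  {M : Type w} [TopologicalSpace M] [ChartedSpace H M]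

/-- Local coordinates on `V` near `z`, of which the first ones are given by the function `Y`, and
the others range over a convex set. -/
structure LinearChart {m : ℕ} (I : ModelWithCorners ℝ E H) (Y : M → EuclideanSpace ℝ (Fin m))
    (V : Opens M) (z : M) where
  /-- The number of additional coordinates. -/
  k : ℕ
  /-- The range of the additional coordinates. -/
  C : Set (EuclideanSpace ℝ (Fin k))
  /-- The radius of the range of `Y`. -/
  r : ℝ
  /-- The parametrization. -/
  Θ : EuclideanSpace ℝ (Fin m) × EuclideanSpace ℝ (Fin k) → M
  /-- The additional coordinates. -/
  U : M → EuclideanSpace ℝ (Fin k)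
  /-- The neighbourhood of `z` where the coordinates are used. -/
  O : Set M
  convex : Convex ℝ C
  uniqueDiffOn : UniqueDiffOn ℝ C
  r_pos : 0 < r
  contMDiffOn_Θ : ContMDiffOn 𝓘(ℝ, EuclideanSpace ℝ (Fin m) × EuclideanSpace ℝ (Fin k)) I ∞ Θ
    (ball (Y z) r ×ˢ C)
  Θ_mem : ∀ q ∈ ball (Y z) r ×ˢ C, Θ q ∈ V
  Y_Θ : ∀ q ∈ ball (Y z) r ×ˢ C, Y (Θ q) = q.1
  isOpen_O : IsOpen O
  mem_O : z ∈ O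
  O_subset : O ⊆ V
  contMDiffOn_U : ContMDiffOn I 𝓘(ℝ, EuclideanSpace ℝ (Fin k)) ∞ U O
  coord_mem : ∀ x ∈ O, (Y x, U x) ∈ ball (Y z) r ×ˢ C
  Θ_coord : ∀ x ∈ O, Θ (Y x, U x) = x

/-- Consequences of `F` being a regular extension of the linear field `A` on `V`: `Y` is the linear
component, on which `F` induces the field `A`. -/
structure IsLinearComponent {m : ℕ} (F : ∀ p : M, TangentSpace I p) (V : Opens M)
    (A : EuclideanSpace ℝ (Fin m) →L[ℝ] EuclideanSpace ℝ (Fin m))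
    (Y : M → EuclideanSpace ℝ (Fin m)) : Prop where
  contMDiffOn : ContMDiffOn I 𝓘(ℝ, EuclideanSpace ℝ (Fin m)) ∞ Y V
  mfderiv_apply : ∀ x ∈ V, mfderiv I 𝓘(ℝ, EuclideanSpace ℝ (Fin m)) Y x (F x) = A (Y x)
  nonempty_chart : ∀ z ∈ V, Nonempty (LinearChart I Y V z)

/-- From here on the diffeomorphism and the second factor are replaced by the function `Y` and
charts in which it is a coordinate. -/
theorem IsLinearExtensionOn.exists_isLinearComponent [IsManifold I ∞ M]
    {F : ∀ p : M, TangentSpace I p} {V : Opens M} (h : IsLinearExtensionOn.{u, v, w, x} F V) :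
    ∃ (m : ℕ) (B : Matrix (Fin m) (Fin m) ℝ)
      (A : EuclideanSpace ℝ (Fin m) →L[ℝ] EuclideanSpace ℝ (Fin m))
      (Y : M → EuclideanSpace ℝ (Fin m)), B ≠ 0 ∧ A ≠ 0 ∧
      (∀ y, A y = WithLp.toLp 2 (B.mulVec (WithLp.ofLp y))) ∧ IsLinearComponent F V A Y := by
  obtain ⟨m, k, B, H', _, J, N, _, _, _, η, hB, -, ⟨hN, -, hF⟩⟩ := h
  set A : EuclideanSpace ℝ (Fin m) →L[ℝ] EuclideanSpace ℝ (Fin m) :=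
    LinearMap.toContinuousLinearMap (Matrix.toEuclideanLin B) with hA
  have hAB : ∀ y, A y = WithLp.toLp 2 (B.mulVec (WithLp.ofLp y)) := fun y => rfl
  have hA0 : A ≠ 0 := by
    intro h0
    refine hB ?_
    have h1 : Matrix.toEuclideanLin B = 0 := by
      ext1 y
      exact congrArg (fun f => f y) h0
    simpa using h1
  set Y : M → EuclideanSpace ℝ (Fin m) :=
    Function.extend Subtype.val (fun x : V => (η x).1) fun _ => 0 with hY
  have hYη : ∀ x : V, Y x = (η x).1 := fun x => Subtype.val_injective.extend_apply _ _ x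
  have hYs : ContMDiffOn I 𝓘(ℝ, EuclideanSpace ℝ (Fin m)) ∞ Y V :=
    contMDiffOn_extend (contMDiff_fst.comp η.contMDiff) 0
  refine ⟨m, B, A, Y, hB, hA0, hAB, hYs, fun x hx => ?_, fun z hz => ?_⟩
  · set Ψ : EuclideanSpace ℝ (Fin m) × N → M := fun r => (η.symm r : M) with hΨ
    set Φ : M → EuclideanSpace ℝ (Fin m) × N :=
      Function.extend Subtype.val η fun _ => η ⟨x, hx⟩ with hΦ
    have hΦη : ∀ x : V, Φ x = η x := fun x => Subtype.val_injective.extend_apply _ _ x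
    obtain ⟨r, rfl⟩ : ∃ r, Ψ r = x := ⟨η ⟨x, hx⟩, by simp [hΨ]⟩
    have hΨd : MDifferentiableAt (𝓘(ℝ, EuclideanSpace ℝ (Fin m)).prod J) I Ψ r :=
      ((contMDiff_subtype_val.comp η.symm.contMDiff) r).mdifferentiableAt (n := ∞) (by simp)
    have hΦd : MDifferentiableAt I (𝓘(ℝ, EuclideanSpace ℝ (Fin m)).prod J) Φ (Ψ r) :=
      ((contMDiffOn_extend η.contMDiff _).contMDiffAt (V.isOpen.mem_nhds hx)).mdifferentiableAt
        (n := ∞) (by simp)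
    have hΦΨ : Φ ∘ Ψ = id := by
      funext r
      simp [hΨ, hΦη]
    have h1 : (mfderiv I (𝓘(ℝ, EuclideanSpace ℝ (Fin m)).prod J) Φ (Ψ r)).comp
        (mfderiv (𝓘(ℝ, EuclideanSpace ℝ (Fin m)).prod J) I Ψ r) = ContinuousLinearMap.id ℝ _ := by
      rw [← mfderiv_comp r hΦd hΨd, hΦΨ, mfderiv_id]
    -- The pulled back field involves the inverse of the derivative of `Ψ`; both compositions are
    -- needed to identify it with the derivative of `Φ`.
    have h2 : (mfderiv (𝓘(ℝ, EuclideanSpace ℝ (Fin m)).prod J) I Ψ r).comp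
        (mfderiv I (𝓘(ℝ, EuclideanSpace ℝ (Fin m)).prod J) Φ (Ψ r)) =
        ContinuousLinearMap.id ℝ _ := by
      have hr : Φ (Ψ r) = r := congrFun hΦΨ r
      have hΨd' : MDifferentiableAt (𝓘(ℝ, EuclideanSpace ℝ (Fin m)).prod J) I Ψ (Φ (Ψ r)) := by
        rw [hr]
        exact hΨd
      have h3 := mfderiv_comp (Ψ r) hΨd' hΦd
      have h4 : Ψ ∘ Φ =ᶠ[𝓝 (Ψ r)] id := by
        filter_upwards [V.isOpen.mem_nhds hx] with y hy
        have := hΦη ⟨y, hy⟩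
        simp only [Function.comp_apply, id, hΨ] at this ⊢
        rw [this, η.symm_apply_apply]
      rw [h4.mfderiv_eq, mfderiv_id] at h3
      rw [hr] at h3
      exact h3.symm
    have h3 := hF r
    rw [VectorField.mpullback_apply, ContinuousLinearMap.inverse_eq h2 h1] at h3
    have h4 : Y =ᶠ[𝓝 (Ψ r)] Prod.fst ∘ Φ := by
      filter_upwards [V.isOpen.mem_nhds hx] with y hy
      rw [Function.comp_apply, hΦη ⟨y, hy⟩, hYη ⟨y, hy⟩]
    rw [h4.mfderiv_eq, mfderiv_comp (Ψ r) mdifferentiableAt_fst hΦd, mfderiv_fst]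
    have h5 : Y (Ψ r) = r.1 := by
      rw [h4.self_of_nhds, Function.comp_apply]
      exact congrArg Prod.fst (congrFun hΦΨ r)
    rw [h5]
    exact congrArg Prod.fst h3
  · set n₀ := (η ⟨z, hz⟩).2 with hn₀
    set φ := extChartAt J n₀ with hφ
    obtain ⟨r, hr, hrs⟩ := Metric.mem_nhdsWithin_iff.1
      (extChartAt_target_mem_nhdsWithin (I := J) n₀)
    -- Intersecting with a ball keeps the range of the chart convex, also at boundary points of `N`,
    -- as Hadamard's lemma requires.
    set C := range J ∩ ball (φ n₀) r with hC
    have hCt : C ⊆ φ.target := fun u hu => hrs ⟨hu.2, hu.1⟩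
    set Θ : EuclideanSpace ℝ (Fin m) × EuclideanSpace ℝ (Fin k) → M :=
      fun q => (η.symm (q.1, φ.symm q.2) : M) with hΘ
    set U : M → EuclideanSpace ℝ (Fin k) :=
      Function.extend Subtype.val (fun x : V => φ (η x).2) fun _ => 0 with hU
    have hUη : ∀ x : V, U x = φ (η x).2 := fun x => Subtype.val_injective.extend_apply _ _ x
    set O' : Set V := {x | (η x).1 ∈ ball (Y z) r} ∩
      (fun x => (η x).2) ⁻¹' (φ.source ∩ φ ⁻¹' ball (φ n₀) r) with hO'
    have hO'o : IsOpen O' :=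
      (isOpen_ball.preimage (continuous_fst.comp η.continuous)).inter
        (((continuousOn_extChartAt n₀).isOpen_inter_preimage (isOpen_extChartAt_source n₀)
          isOpen_ball).preimage (continuous_snd.comp η.continuous))
    have hYz : Y z = (η ⟨z, hz⟩).1 := hYη ⟨z, hz⟩
    refine ⟨⟨k, C, r, Θ, U, Subtype.val '' O', J.convex_range.inter (convex_ball _ _),
      J.uniqueDiffOn.inter isOpen_ball, hr, ?_, fun q _ => (η.symm _).2, fun q hq => ?_,
      V.isOpen.isOpenMap_subtype_val _ hO'o, ?_, ?_, ?_, ?_, ?_⟩⟩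
    · have h1 : ContMDiffOn 𝓘(ℝ, EuclideanSpace ℝ (Fin m) × EuclideanSpace ℝ (Fin k))
          (𝓘(ℝ, EuclideanSpace ℝ (Fin m)).prod J) ∞
          (fun q : EuclideanSpace ℝ (Fin m) × EuclideanSpace ℝ (Fin k) => (q.1, φ.symm q.2))
          (ball (Y z) r ×ˢ C) :=
        (contMDiffOn_iff_contDiffOn.2 contDiffOn_fst).prodMk
          ((contMDiffOn_extChartAt_symm n₀).comp (contMDiffOn_iff_contDiffOn.2 contDiffOn_snd)
            fun q hq => hCt hq.2)
      exact (contMDiff_subtype_val.comp η.symm.contMDiff).comp_contMDiffOn h1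
    · rw [hYη (η.symm _), η.apply_symm_apply]
    · refine ⟨⟨z, hz⟩, ⟨?_, mem_extChartAt_source n₀, mem_ball_self hr⟩, rfl⟩
      rw [mem_ofPred_eq, ← hYz]
      exact mem_ball_self hr
    · rintro _ ⟨x, -, rfl⟩
      exact x.2
    · rintro _ ⟨x, hx, rfl⟩
      refine ContMDiffAt.contMDiffWithinAt ?_
      rw [← contMDiffAt_subtype_iff]
      simp only [hUη]
      have h1 : ContMDiffAt J 𝓘(ℝ, EuclideanSpace ℝ (Fin k)) ∞ φ (η x).2 :=
        contMDiffAt_extChartAt' (by simpa [φ] using hx.2.1)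
      exact h1.comp x ((contMDiff_snd.comp η.contMDiff) x)
    · rintro _ ⟨x, hx, rfl⟩
      rw [hYη, hUη]
      exact ⟨hx.1, mem_range_self _, hx.2.2⟩
    · rintro _ ⟨x, hx, rfl⟩
      simp only [hΘ, hYη, hUη]
      rw [φ.left_inv hx.2.1, Prod.mk.eta, η.symm_apply_apply]

end LinearChart

/-! ### The linear component: density of regular points and its evolution -/

section LinearComponent

open Metric Filter

/-- Local smooth extensions from a dense subset fit together. -/
theorem contMDiffOn_extendFrom {E' : Type*} [NormedAddCommGroup E'] [NormedSpace ℝ E'] {H' : Type*}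
    [TopologicalSpace H'] {J : ModelWithCorners ℝ E' H'} {Z : Type*} [TopologicalSpace Z]
    [ChartedSpace H' Z] {D S : Set Z} (hDS : D ⊆ S) (hS : S ⊆ closure D) {f : Z → ℝ}
    (h : ∀ z ∈ S, ∃ O : Set Z, IsOpen O ∧ z ∈ O ∧ ∃ g : Z → ℝ, ContMDiffOn J 𝓘(ℝ, ℝ) ∞ g (O ∩ S) ∧
      ∀ x ∈ D ∩ O, g x = f x) :
    ContMDiffOn J 𝓘(ℝ, ℝ) ∞ (extendFrom D f) S := by
  intro z hz
  obtain ⟨O, hO, hzO, g, hg, hgf⟩ := h z hz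
  have h1 : ∀ y ∈ O ∩ S, extendFrom D f y = g y := by
    intro y hy
    refine extendFrom_eq (hS hy.2) ?_
    have h2 : Tendsto g (𝓝[D ∩ O] y) (𝓝 (g y)) :=
      (hg y hy).continuousWithinAt.mono fun x hx => ⟨hx.2, hDS hx.1⟩
    have h3 : Tendsto f (𝓝[D ∩ O] y) (𝓝 (g y)) :=
      h2.congr' (eventually_nhdsWithin_of_forall hgf)
    rwa [nhdsWithin_inter_of_mem' (mem_nhdsWithin_of_mem_nhds (hO.mem_nhds hy.1))] at h3
  refine ((hg z ⟨hzO, hz⟩).congr h1 (h1 z ⟨hzO, hz⟩)).mono_of_mem_nhdsWithin ?_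
  exact inter_mem (mem_nhdsWithin_of_mem_nhds (hO.mem_nhds hzO)) self_mem_nhdsWithin

variable {E : Type u} [NormedAddCommGroup E] [NormedSpace ℝ E]
  {H : Type v} [TopologicalSpace H] {I : ModelWithCorners ℝ E H}
  {M : Type w} [TopologicalSpace M] [ChartedSpace H M]
  {F : ∀ p : M, TangentSpace I p} {V : Opens M} {m : ℕ}
  {A : EuclideanSpace ℝ (Fin m) →L[ℝ] EuclideanSpace ℝ (Fin m)}
  {Y : M → EuclideanSpace ℝ (Fin m)}

open Classical in
/-- The parametrization of a linear chart, as a map to the open subset. -/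
def LinearChart.param {z : M} (c : LinearChart I Y V z) (x : V)
    (q : EuclideanSpace ℝ (Fin m) × EuclideanSpace ℝ (Fin c.k)) : V :=
  if h : q ∈ ball (Y z) c.r ×ˢ c.C then ⟨c.Θ q, c.Θ_mem q h⟩ else x

theorem LinearChart.coe_param {z : M} (c : LinearChart I Y V z) (x : V)
    {q : EuclideanSpace ℝ (Fin m) × EuclideanSpace ℝ (Fin c.k)}
    (h : q ∈ ball (Y z) c.r ×ˢ c.C) : (c.param x q : M) = c.Θ q := by
  rw [LinearChart.param, dif_pos h]

theorem LinearChart.param_coord {z : M} (c : LinearChart I Y V z) (x₀ x : V) (hx : (x : M) ∈ c.O) :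
    c.param x₀ (Y x, c.U x) = x :=
  Subtype.ext ((c.coe_param x₀ (c.coord_mem x hx)).trans (c.Θ_coord x hx))

theorem LinearChart.contMDiffOn_param {z : M} (c : LinearChart I Y V z) (x : V) :
    ContMDiffOn 𝓘(ℝ, EuclideanSpace ℝ (Fin m) × EuclideanSpace ℝ (Fin c.k)) I ∞ (c.param x)
      (ball (Y z) c.r ×ˢ c.C) := by
  intro q hq
  rw [← ContMDiffWithinAt.subtypeVal_comp_iff]
  exact (c.contMDiffOn_Θ q hq).congr (fun p hp => c.coe_param x hp) (c.coe_param x hq)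

/-- The converse may fail, since `F` may have a nonzero component along the second factor. Therefore
two open sets are kept apart later: the regular points, and the points where `A (Y x) ≠ 0`. -/
theorem IsLinearComponent.apply_eq_zero (hL : IsLinearComponent F V A Y) {x : M} (hx : x ∈ V)
    (h : F x = 0) : A (Y x) = 0 := by
  rw [← hL.mfderiv_apply x hx, h]
  exact map_zero _

/-- From a point with `ξ (Y z) = 0` one moves `Y` in a direction `v` with `ξ v ≠ 0`, keeping the
other coordinates fixed. -/
theorem IsLinearComponent.dense {W : Type*} [NormedAddCommGroup W] [NormedSpace ℝ W]
    (hL : IsLinearComponent F V A Y) {ξ : EuclideanSpace ℝ (Fin m) →L[ℝ] W} (hξ : ξ ≠ 0) :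
    Dense {x : V | ξ (Y x) ≠ 0} := by
  intro z
  by_cases hz : ξ (Y z) = 0
  · obtain ⟨c⟩ := hL.nonempty_chart z z.2
    obtain ⟨v, hv⟩ : ∃ v, ξ v ≠ 0 := by
      by_contra! h
      exact hξ (ContinuousLinearMap.ext h)
    have h0 := c.coord_mem z c.mem_O
    set w : ℝ → V := fun s => c.param z (Y z + s • v, c.U z) with hw
    have hcurve : ContinuousAt
        (fun s : ℝ => ((Y z + s • v, c.U z) : EuclideanSpace ℝ (Fin m) × _)) 0 := by fun_prop
    have hev : ∀ᶠ s : ℝ in 𝓝 0, (Y z + s • v, c.U z) ∈ ball (Y z) c.r ×ˢ c.C := by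
      have h1 : ContinuousAt (fun s : ℝ => Y z + s • v) 0 := by fun_prop
      have h2 := h1.eventually (isOpen_ball.mem_nhds (x := Y z + (0 : ℝ) • v) (s := ball (Y z) c.r)
        (by simpa using c.r_pos))
      filter_upwards [h2] with s hs using ⟨hs, h0.2⟩
    have hwc : Tendsto w (𝓝[≠] 0) (𝓝 z) := by
      have h1 := (c.contMDiffOn_param z _ h0).continuousWithinAt
      have h2 : Tendsto (fun s : ℝ => ((Y z + s • v, c.U z) : EuclideanSpace ℝ (Fin m) × _)) (𝓝 0)
          (𝓝[ball (Y z) c.r ×ˢ c.C] (Y z, c.U z)) := by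
        refine tendsto_nhdsWithin_iff.2 ⟨?_, hev⟩
        have h3 := hcurve.tendsto
        simpa only [zero_smul, add_zero] using h3
      have h3 := h1.tendsto.comp h2
      rw [c.param_coord z z c.mem_O] at h3
      exact h3.mono_left nhdsWithin_le_nhds
    refine mem_closure_of_tendsto hwc ?_
    filter_upwards [nhdsWithin_le_nhds hev, self_mem_nhdsWithin] with s hs hs0
    rw [hw, c.coe_param z hs, c.Y_Θ _ hs, map_add, hz, zero_add, map_smul]
    exact smul_ne_zero hs0 hv
  · exact subset_closure hz

theorem IsLinearComponent.isNowhereDense (hL : IsLinearComponent F V A Y) (hA : A ≠ 0) :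
    IsNowhereDense {x : V | F x = 0} := by
  have hYc : Continuous fun x : V => A (Y x) := A.continuous.comp
    (hL.contMDiffOn.continuousOn.comp_continuous continuous_subtype_val fun x => x.2)
  have h1 : IsClosed {x : V | A (Y x) = 0} := isClosed_eq hYc continuous_const
  have h2 : IsNowhereDense {x : V | A (Y x) = 0} := by
    rw [h1.isNowhereDense_iff, ← compl_compl {x : V | A (Y x) = 0}, interior_compl,
      compl_empty_iff]
    exact (hL.dense hA).closure_eq
  exact h2.mono fun x hx => hL.apply_eq_zero x.2 hx

variable [IsManifold I ∞ M]

theorem IsLinearComponent.hasDerivAt (hL : IsLinearComponent F V A Y) (hF : IsSmoothField I F)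
    {x : M} {s : ℝ} (hs : (x, s) ∈ flowDomain F) [T2Space M] (hV : flow F x s ∈ V) :
    HasDerivAt (fun s => Y (flow F x s)) (A (Y (flow F x s))) s := by
  have hY : MDifferentiableAt I 𝓘(ℝ, EuclideanSpace ℝ (Fin m)) Y (flow F x s) :=
    (hL.contMDiffOn.contMDiffAt (V.isOpen.mem_nhds hV)).mdifferentiableAt (by simp)
  have h := (hY.hasMFDerivAt.comp s (hF.hasMFDerivAt_flow hs)).hasFDerivAt
  refine HasDerivAt.congr_deriv (F := EuclideanSpace ℝ (Fin m)) (HasFDerivAt.hasDerivAt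
    (F := EuclideanSpace ℝ (Fin m)) h) ?_
  rw [← hL.mfderiv_apply _ hV]
  exact congrArg (mfderiv I 𝓘(ℝ, EuclideanSpace ℝ (Fin m)) Y (flow F x s))
    (one_smul ℝ (F (flow F x s)))

end LinearComponent

/-! ### Nondegeneracy at zeros -/

section Extension

open Metric Filter

variable {E : Type u} [NormedAddCommGroup E] [NormedSpace ℝ E]
  {H : Type v} [TopologicalSpace H] {I : ModelWithCorners ℝ E H}
  {M : Type w} [TopologicalSpace M] [ChartedSpace H M]
  {F : ∀ p : M, TangentSpace I p} {V : Opens M} {m : ℕ}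
  {A : EuclideanSpace ℝ (Fin m) →L[ℝ] EuclideanSpace ℝ (Fin m)}
  {Y : M → EuclideanSpace ℝ (Fin m)}

/-- The linear component of a local diffeomorphism at a fixed point is a submersion. -/
theorem LinearChart.not_hasFDerivWithinAt {z : V} (c : LinearChart I Y V z)
    (hY : ContMDiffOn I 𝓘(ℝ, EuclideanSpace ℝ (Fin m)) ∞ Y V) {h : V → M}
    (hh : IsLocalDiffeomorphAt I I ∞ h z) (hz : h z = z) {t₀ : ℝ}
    {S : Set (EuclideanSpace ℝ (Fin m) × (EuclideanSpace ℝ (Fin c.k) × ℝ))}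
    (hS : ∀ᶠ q in 𝓝[ball (Y z) c.r ×ˢ c.C] (Y z, c.U z), (q.1, (q.2, t₀)) ∈ S)
    {f : EuclideanSpace ℝ (Fin m) × (EuclideanSpace ℝ (Fin c.k) × ℝ) → EuclideanSpace ℝ (Fin m)}
    (hf : ∀ x : V, (x : M) ∈ c.O → f (Y x, (c.U x, t₀)) = Y (h x))
    {ξ : EuclideanSpace ℝ (Fin m) →L[ℝ] ℝ} (hξ : ξ ≠ 0) :
    ¬HasFDerivWithinAt (fun q => ξ (f q))
      (0 : EuclideanSpace ℝ (Fin m) × (EuclideanSpace ℝ (Fin c.k) × ℝ) →L[ℝ] ℝ) S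
      (Y z, (c.U z, t₀)) := by
  intro hd
  obtain ⟨Φ, hzΦ, hΦ⟩ := hh
  obtain ⟨v, hv⟩ : ∃ v, ξ v ≠ 0 := by
    by_contra! h
    exact hξ (ContinuousLinearMap.ext h)
  have h0 := c.coord_mem z c.mem_O
  have hΦz : Φ z = z := (hΦ hzΦ).symm.trans hz
  have hzt : (z : M) ∈ Φ.target := hΦz ▸ Φ.map_source hzΦ
  have hiz : Φ.invFun z = z := (congrArg Φ.invFun hΦz).symm.trans (Φ.left_inv hzΦ)
  set T : Set ℝ := {s | Y z + s • v ∈ ball (Y z) c.r} with hT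
  have hTo : IsOpen T := isOpen_ball.preimage (by fun_prop)
  have h0T : (0 : ℝ) ∈ T := by simpa [hT] using c.r_pos
  -- Along `w` the component `Y` moves with velocity `v`; this curve is two-sided even at a boundary
  -- point, because the range of `Y` in the chart is a ball. Its preimage under `h` is a curve along
  -- which `ξ ∘ f` has derivative `ξ v ≠ 0`.
  set w : ℝ → M := fun s => c.Θ (Y z + s • v, c.U z) with hw
  have hw0 : w 0 = z := by
    simp only [hw, zero_smul, add_zero]
    exact c.Θ_coord z c.mem_O
  have hws : ContMDiffAt 𝓘(ℝ, ℝ) I ∞ w 0 := by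
    refine ContMDiffOn.contMDiffAt (s := T) ?_ (hTo.mem_nhds h0T)
    refine c.contMDiffOn_Θ.comp (t := ball (Y z) c.r ×ˢ c.C) ?_ fun s hs => ⟨hs, h0.2⟩
    exact contMDiffOn_iff_contDiffOn.2 (by fun_prop)
  set x : ℝ → V := fun s => Φ.invFun (w s) with hx
  have hx0 : x 0 = z := by simp only [hx, hw0, hiz]
  have hx0O : (x 0 : M) ∈ c.O := by
    rw [hx0]
    exact c.mem_O
  have hxs : ContMDiffAt 𝓘(ℝ, ℝ) I ∞ x 0 := by
    refine ContMDiffAt.comp (g := Φ.invFun) 0 ?_ hws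
    rw [hw0]
    exact Φ.contMDiffOn_invFun.contMDiffAt (Φ.open_target.mem_nhds hzt)
  have hxs' : ContMDiffAt 𝓘(ℝ, ℝ) I ∞ (fun s => (x s : M)) 0 :=
    (contMDiff_subtype_val (x 0)).comp 0 hxs
  have hYx : ContMDiffAt 𝓘(ℝ, ℝ) 𝓘(ℝ, EuclideanSpace ℝ (Fin m)) ∞ (fun s => Y (x s)) 0 :=
    (hY.contMDiffAt (V.isOpen.mem_nhds (x 0).2)).comp 0 hxs'
  have hUx : ContMDiffAt 𝓘(ℝ, ℝ) 𝓘(ℝ, EuclideanSpace ℝ (Fin c.k)) ∞ (fun s => c.U (x s)) 0 := by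
    refine ContMDiffAt.comp 0 (c.contMDiffOn_U.contMDiffAt (c.isOpen_O.mem_nhds hx0O)) hxs'
  have hYd := (contMDiffAt_iff_contDiffAt.1 hYx).differentiableAt (by simp)
  have hUd := (contMDiffAt_iff_contDiffAt.1 hUx).differentiableAt (by simp)
  have hγ := (hYd.prodMk (hUd.prodMk (differentiableAt_const t₀))).hasDerivAt
  have hevO : ∀ᶠ s in 𝓝 (0 : ℝ), (x s : M) ∈ c.O :=
    hxs'.continuousAt.eventually (c.isOpen_O.mem_nhds hx0O)
  have hevS : ∀ᶠ s in 𝓝 (0 : ℝ), (Y (x s), (c.U (x s), t₀)) ∈ S := by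
    have h1 : Tendsto (fun s => (Y (x s), c.U (x s))) (𝓝 0)
        (𝓝[ball (Y z) c.r ×ˢ c.C] (Y z, c.U z)) := by
      refine tendsto_nhdsWithin_iff.2 ⟨?_, ?_⟩
      · have h2 := (hYx.continuousAt.prodMk hUx.continuousAt).tendsto
        simpa only [hx0] using h2
      · filter_upwards [hevO] with s hs using c.coord_mem _ hs
    exact h1.eventually hS
  have hchain := HasFDerivWithinAt.comp_hasDerivAt_of_eq (0 : ℝ) hd hγ hevS (by rw [hx0])
  have hlin : HasDerivAt (fun s : ℝ => ξ (Y z) + s * ξ v) (ξ v) 0 := by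
    simpa using ((hasDerivAt_id (0 : ℝ)).mul_const (ξ v)).const_add (ξ (Y z))
  refine hv (hlin.unique (hchain.congr_of_eventuallyEq ?_))
  have hevt : ∀ᶠ s in 𝓝 (0 : ℝ), w s ∈ Φ.target :=
    hws.continuousAt.eventually (Φ.open_target.mem_nhds (by rw [hw0]; exact hzt))
  filter_upwards [hevO, hevt, hTo.mem_nhds h0T] with s hs hst hsT
  have h1 : h (x s) = w s := (hΦ (Φ.map_target hst)).trans (Φ.right_inv hst)
  have h2 : Y (w s) = Y z + s • v := c.Y_Θ _ ⟨hsT, h0.2⟩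
  rw [Function.comp_apply, hf _ hs, h1, h2, map_add, map_smul, smul_eq_mul]

end Extension

/-! ### Extension of shift functions over the zeros -/

section ShiftExtension

open Metric Filter

variable {E : Type u} [NormedAddCommGroup E] [NormedSpace ℝ E]
  {H : Type v} [TopologicalSpace H] {I : ModelWithCorners ℝ E H}
  {M : Type w} [TopologicalSpace M] [ChartedSpace H M] [IsManifold I ∞ M] [T2Space M]
  [CompleteSpace E]
  {F : ∀ p : M, TangentSpace I p} {V : Opens M} {m : ℕ}
  {A : EuclideanSpace ℝ (Fin m) →L[ℝ] EuclideanSpace ℝ (Fin m)}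
  {Y : M → EuclideanSpace ℝ (Fin m)}

omit [T2Space M] [CompleteSpace E] in
theorem IsSmoothField.isOpen_setOf_ne_zero (hF : IsSmoothField I F) : IsOpen {p | F p ≠ 0} := by
  rw [isOpen_iff_mem_nhds]
  intro p hp
  have h1 : ContinuousOn (fun q => chartField F p (extChartAt I p q)) (extChartAt I p).source :=
    (hF.contDiffOn_chartField p).continuousOn.comp (continuousOn_extChartAt p)
      (extChartAt I p).mapsTo
  have hs := (isOpen_extChartAt_source (I := I) p).mem_nhds (mem_extChartAt_source p)
  have h2 := (h1.continuousAt hs).eventually_ne (y := 0) (by rw [chartField_self]; exact hp)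
  filter_upwards [h2, hs] with q hq hqs hq0
  refine hq ?_
  rw [chartField_extChartAt hqs, hq0]
  exact map_zero _

theorem IsSmoothField.eq_of_mem_orbitMaps (hF : IsSmoothField I F) (hI : IsBoundaryModel I)
    {h : V → M} (hh : h ∈ orbitMaps F V) {z : V} (hz : F z = 0) : h z = z := by
  obtain ⟨t, -, ht⟩ := hh.2.1 z z (hF.mem_orbit_self hI _)
  rw [ht, (hF.flow_of_eq_zero hz t).2]

/-- Near a zero of the field, shift functions of homotopies extend smoothly. -/
theorem IsLinearComponent.exists_local_extension (hL : IsLinearComponent F V A Y)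
    {B : Matrix (Fin m) (Fin m) ℝ} (hB : B ≠ 0)
    (hA : ∀ y, A y = WithLp.toLp 2 (B.mulVec (WithLp.ofLp y))) (hF : IsSmoothField I F)
    (hI : IsBoundaryModel I) {K : V × ℝ → M} {Λ : V × ℝ → ℝ}
    (hK : ContMDiffOn (I.prod 𝓘(ℝ, ℝ)) I ∞ K (univ ×ˢ Icc (0 : ℝ) 1))
    (hKm : ∀ t ∈ Icc (0 : ℝ) 1, (fun p : V => K (p, t)) ∈ orbitMaps F V)
    (hΛ : ContMDiffOn (I.prod 𝓘(ℝ, ℝ)) 𝓘(ℝ, ℝ) ∞ Λ ({p : V | F p ≠ 0} ×ˢ Icc (0 : ℝ) 1))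
    (hdom : ∀ p : V, F p ≠ 0 → ∀ t ∈ Icc (0 : ℝ) 1,
      ((p : M), Λ (p, t)) ∈ flowDomain F ∧ K (p, t) = flow F p (Λ (p, t)))
    {z : V} {t₀ : ℝ} (hz : F z = 0) (ht₀ : t₀ ∈ Icc (0 : ℝ) 1)
    (hQ : ∀ᶠ q in 𝓝[univ ×ˢ Icc (0 : ℝ) 1] (z, t₀), F (q.1 : M) ≠ 0 →
      ∀ s ∈ uIcc 0 (Λ q), flow F (q.1 : M) s ∈ V) :
    ∃ O : Set (V × ℝ), IsOpen O ∧ (z, t₀) ∈ O ∧ ∃ g : V × ℝ → ℝ,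
      ContMDiffOn (I.prod 𝓘(ℝ, ℝ)) 𝓘(ℝ, ℝ) ∞ g (O ∩ univ ×ˢ Icc (0 : ℝ) 1) ∧
      ∀ q ∈ ({p : V | A (Y p) ≠ 0} ×ˢ Icc (0 : ℝ) 1) ∩ O, g q = Λ q := by
  obtain ⟨c⟩ := hL.nonempty_chart z z.2
  have h0 := c.coord_mem z c.mem_O
  have hKz : ∀ p : V, F p = 0 → ∀ t ∈ Icc (0 : ℝ) 1, K (p, t) = p := fun p hp t ht =>
    hF.eq_of_mem_orbitMaps hI (hKm t ht) hp
  -- `Y` obeys the linear equation only inside `V`, so the whole orbit segment from the point to its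
  -- image has to stay there.
  have hN : ∀ᶠ q in 𝓝[univ ×ˢ Icc (0 : ℝ) 1] (z, t₀), K q ∈ V ∧ (F (q.1 : M) ≠ 0 →
      ∀ s ∈ uIcc 0 (Λ q), flow F (q.1 : M) s ∈ V) := by
    refine Filter.Eventually.and ?_ hQ
    refine (hK (z, t₀) ⟨mem_univ _, ht₀⟩).continuousWithinAt.eventually (V.isOpen.mem_nhds ?_)
    rw [hKz z hz t₀ ht₀]
    exact z.2
  -- The time of the homotopy becomes one more parameter, so smoothness in `(x, t)` jointly comes
  -- from one application of the division theorem.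
  set C₁ : Set (EuclideanSpace ℝ (Fin c.k) × ℝ) := c.C ×ˢ Icc (0 : ℝ) 1 with hC₁
  set Ξ : EuclideanSpace ℝ (Fin m) × (EuclideanSpace ℝ (Fin c.k) × ℝ) → V × ℝ :=
    fun q => (c.param z (q.1, q.2.1), q.2.2) with hΞ
  have hΞs : ContMDiffOn 𝓘(ℝ, EuclideanSpace ℝ (Fin m) × (EuclideanSpace ℝ (Fin c.k) × ℝ))
      (I.prod 𝓘(ℝ, ℝ)) ∞ Ξ (ball (Y z) c.r ×ˢ C₁) := by
    refine ContMDiffOn.prodMk ?_ (contMDiffOn_iff_contDiffOn.2 (by fun_prop))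
    refine (c.contMDiffOn_param z).comp
      (f := fun q : EuclideanSpace ℝ (Fin m) × (EuclideanSpace ℝ (Fin c.k) × ℝ) => (q.1, q.2.1))
      (contMDiffOn_iff_contDiffOn.2 (by fun_prop)) fun q hq => ⟨hq.1, hq.2.1⟩
  have hp₁ : (Y z, (c.U z, t₀)) ∈ ball (Y z) c.r ×ˢ C₁ := ⟨h0.1, h0.2, ht₀⟩
  have hΞ0 : Ξ (Y z, (c.U z, t₀)) = (z, t₀) := by
    simp only [hΞ, c.param_coord z z c.mem_O]
  have hΞN : ∀ᶠ q in 𝓝[ball (Y z) c.r ×ˢ C₁] (Y z, (c.U z, t₀)), K (Ξ q) ∈ V ∧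
      (F ((Ξ q).1 : M) ≠ 0 → ∀ s ∈ uIcc 0 (Λ (Ξ q)), flow F ((Ξ q).1 : M) s ∈ V) := by
    have h1 : Tendsto Ξ (𝓝[ball (Y z) c.r ×ˢ C₁] (Y z, (c.U z, t₀)))
        (𝓝[univ ×ˢ Icc (0 : ℝ) 1] (z, t₀)) := by
      refine tendsto_nhdsWithin_iff.2 ⟨?_, ?_⟩
      · rw [← hΞ0]
        exact (hΞs _ hp₁).continuousWithinAt
      · filter_upwards [self_mem_nhdsWithin] with q hq using ⟨mem_univ _, hq.2.2⟩
    exact h1.eventually hN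
  obtain ⟨ε, hε, hεN⟩ := Metric.mem_nhdsWithin_iff.1 hΞN
  set r := min ε c.r with hr
  have hr0 : 0 < r := lt_min hε c.r_pos
  set C := C₁ ∩ ball (c.U z, t₀) r with hC
  have hsub : ball (Y z) r ×ˢ C ⊆ ball (Y z) c.r ×ˢ C₁ :=
    prod_mono (ball_subset_ball (min_le_right _ _)) inter_subset_left
  have hsubN : ∀ q ∈ ball (Y z) r ×ˢ C, K (Ξ q) ∈ V ∧
      (F ((Ξ q).1 : M) ≠ 0 → ∀ s ∈ uIcc 0 (Λ (Ξ q)), flow F ((Ξ q).1 : M) s ∈ V) := by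
    refine fun q hq => hεN ⟨?_, hsub hq⟩
    exact ball_subset_ball (min_le_left ε c.r)
      (by rw [← ball_prod_same]; exact ⟨hq.1, hq.2.2⟩)
  have hYΞ : ∀ q ∈ ball (Y z) r ×ˢ C, Y (Ξ q).1 = q.1 := fun q hq => by
    have h1 : (q.1, q.2.1) ∈ ball (Y z) c.r ×ˢ c.C := ⟨(hsub hq).1, (hsub hq).2.1⟩
    simp only [hΞ, c.coe_param z h1, c.Y_Θ _ h1]
  have hF0 : ∀ p : V, A (Y p) ≠ 0 → F p ≠ 0 := fun p hp h => hp (hL.apply_eq_zero p.2 h)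
  have hp₀ : (c.U z, t₀) ∈ C := ⟨hp₁.2, mem_ball_self hr0⟩
  classical
  obtain ⟨ρ, hρ, hρr, L, hLs, hLe⟩ : ∃ ρ > 0, ρ ≤ r ∧
      ∃ L : EuclideanSpace ℝ (Fin m) × (EuclideanSpace ℝ (Fin c.k) × ℝ) → ℝ,
        ContDiffOn ℝ ∞ L (ball (Y z) ρ ×ˢ (C ∩ ball (c.U z, t₀) ρ)) ∧
        ∀ q ∈ ball (Y z) ρ ×ˢ (C ∩ ball (c.U z, t₀) ρ), A q.1 ≠ 0 →
          L q = if F ((Ξ q).1 : M) = 0 then 0 else Λ (Ξ q) := by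
    -- At zeros of `F` nothing is known about `Λ`; the value `0` is substituted there, with a
    -- constant solution. This does not affect the points where `A (Y x) ≠ 0`.
    refine exists_extension_of_linear_flow (A := A) (y₀ := Y z) (r := r)
      (C := C) (p₀ := (c.U z, t₀)) (f := fun q => Y (K (Ξ q)))
      (lam := fun q => if F ((Ξ q).1 : M) = 0 then 0 else Λ (Ξ q)) hB hA (hL.apply_eq_zero z.2 hz) hr0
      ((c.convex.prod (convex_Icc 0 1)).inter (convex_ball _ _))
      ((c.uniqueDiffOn.prod (uniqueDiffOn_Icc zero_lt_one)).inter isOpen_ball)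
      hp₀ ?_ ?_ ?_ ?_
    · refine contMDiffOn_iff_contDiffOn.1 ?_
      refine hL.contMDiffOn.comp (hK.comp (hΞs.mono hsub) fun q hq => ⟨mem_univ _, (hsub hq).2.2⟩)
        fun q hq => (hsubN q hq).1
    · have h1 : ∀ q ∈ (ball (Y z) r ×ˢ C) ∩ {q | A q.1 ≠ 0}, F ((Ξ q).1 : M) ≠ 0 := fun q hq => by
        refine hF0 _ ?_
        rw [hYΞ q hq.1]
        exact hq.2
      refine contMDiffOn_iff_contDiffOn.1 ?_
      refine (hΛ.comp (hΞs.mono (inter_subset_left.trans hsub)) fun q hq =>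
        ⟨h1 q hq, (hsub hq.1).2.2⟩).congr fun q hq => ?_
      simp only [Function.comp_apply, if_neg (h1 q hq)]
    · intro q hq
      have ht := (hsub hq).2.2
      by_cases hx : F ((Ξ q).1 : M) = 0
      · refine ⟨fun _ => q.1, rfl, ?_, fun s _ => ?_⟩
        · have h1 : K (Ξ q) = (Ξ q).1 := hKz _ hx _ ht
          simp only [h1, hYΞ q hq]
        · rw [← hYΞ q hq, hL.apply_eq_zero (Ξ q).1.2 hx]
          exact hasDerivAt_const _ _
      · have h1 := hdom _ hx _ ht
        refine ⟨fun s => Y (flow F ((Ξ q).1 : M) s), ?_, ?_, fun s hs => ?_⟩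
        · simp only [(hF.flow_zero hI _).2, hYΞ q hq]
        · simp only [if_neg hx]
          exact congrArg Y h1.2.symm
        · rw [if_neg hx] at hs
          exact hL.hasDerivAt hF (hF.mem_flowDomain_of_mem_uIcc (hF.flow_zero hI _).1 h1.1 hs)
            ((hsubN q hq).2 hx s hs)
    · intro ξ hξ
      refine c.not_hasFDerivWithinAt hL.contMDiffOn ((hKm t₀ ht₀).2.2 z hz) (hKz z hz t₀ ht₀) ?_
        (fun x hx => ?_) hξ
      · have h1 : Tendsto (fun q : EuclideanSpace ℝ (Fin m) × EuclideanSpace ℝ (Fin c.k) =>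
            (q.1, (q.2, t₀))) (𝓝 (Y z, c.U z)) (𝓝 (Y z, (c.U z, t₀))) :=
          ContinuousAt.tendsto (x := (Y z, c.U z)) (f := fun q => (q.1, (q.2, t₀))) (by fun_prop)
        have h2 := h1.eventually ((isOpen_ball (x := Y z) (ε := r)).prod
          (isOpen_ball (x := (c.U z, t₀)) (ε := r)) |>.mem_nhds ⟨mem_ball_self hr0, mem_ball_self hr0⟩)
        filter_upwards [self_mem_nhdsWithin, nhdsWithin_le_nhds h2] with q hq hq2
        exact ⟨hq2.1, ⟨hq.2, ht₀⟩, hq2.2⟩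
      · simp only [hΞ, c.param_coord z x hx]
  set e : V × ℝ → EuclideanSpace ℝ (Fin m) × (EuclideanSpace ℝ (Fin c.k) × ℝ) :=
    fun q => (Y q.1, (c.U q.1, q.2)) with he
  set O₁ : Set (V × ℝ) := (fun q : V × ℝ => (q.1 : M)) ⁻¹' c.O with hO₁
  have hO₁o : IsOpen O₁ := c.isOpen_O.preimage (by fun_prop)
  have hval : ContMDiff (I.prod 𝓘(ℝ, ℝ)) I ∞ (fun q : V × ℝ => (q.1 : M)) :=
    contMDiff_subtype_val.comp contMDiff_fst
  have hes : ContMDiffOn (I.prod 𝓘(ℝ, ℝ))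
      𝓘(ℝ, EuclideanSpace ℝ (Fin m) × (EuclideanSpace ℝ (Fin c.k) × ℝ)) ∞ e O₁ :=
    ((hL.contMDiffOn.comp hval.contMDiffOn fun q _ => q.1.2)).prodMk_space
      ((c.contMDiffOn_U.comp hval.contMDiffOn fun q hq => hq).prodMk_space contMDiffOn_snd)
  refine ⟨O₁ ∩ e ⁻¹' (ball (Y z) ρ ×ˢ ball (c.U z, t₀) ρ),
    hes.continuousOn.isOpen_inter_preimage hO₁o (isOpen_ball.prod isOpen_ball),
    ⟨c.mem_O, mem_ball_self hρ, mem_ball_self hρ⟩, L ∘ e, ?_, ?_⟩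
  · refine (contMDiffOn_iff_contDiffOn.2 hLs).comp (hes.mono fun q hq => hq.1.1) ?_
    rintro q ⟨⟨hq, hqe⟩, -, hqt⟩
    exact ⟨hqe.1, ⟨⟨(c.coord_mem _ hq).2, hqt⟩, ball_subset_ball hρr hqe.2⟩, hqe.2⟩
  · rintro q ⟨⟨hqA, hqt⟩, hq, hqe⟩
    have h1 : e q ∈ ball (Y z) ρ ×ˢ (C ∩ ball (c.U z, t₀) ρ) :=
      ⟨hqe.1, ⟨⟨(c.coord_mem _ hq).2, hqt⟩, ball_subset_ball hρr hqe.2⟩, hqe.2⟩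
    have h2 : Ξ (e q) = q := by
      simp only [hΞ, he, c.param_coord z q.1 hq]
    rw [Function.comp_apply, hLe _ h1 hqA]
    simp only [h2]
    exact if_neg (by rw [h2]; exact hF0 _ hqA)

/-- Shift functions of homotopies over the regular points extend smoothly over the zeros. -/
theorem IsLinearComponent.exists_extension (hL : IsLinearComponent F V A Y) (hA0 : A ≠ 0)
    {B : Matrix (Fin m) (Fin m) ℝ} (hB : B ≠ 0)
    (hA : ∀ y, A y = WithLp.toLp 2 (B.mulVec (WithLp.ofLp y))) (hF : IsSmoothField I F)
    (hI : IsBoundaryModel I) {K : V × ℝ → M} {Λ : V × ℝ → ℝ}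
    (hK : ContMDiffOn (I.prod 𝓘(ℝ, ℝ)) I ∞ K (univ ×ˢ Icc (0 : ℝ) 1))
    (hKm : ∀ t ∈ Icc (0 : ℝ) 1, (fun p : V => K (p, t)) ∈ orbitMaps F V)
    (hΛ : ContinuousOn Λ ({p : V | F p ≠ 0} ×ˢ Icc (0 : ℝ) 1))
    (hdom : ∀ p : V, F p ≠ 0 → ∀ t ∈ Icc (0 : ℝ) 1,
      ((p : M), Λ (p, t)) ∈ flowDomain F ∧ K (p, t) = flow F p (Λ (p, t)))
    (hQ : ∀ z : V, F z = 0 → ∀ t₀ ∈ Icc (0 : ℝ) 1,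
      ∀ᶠ q in 𝓝[univ ×ˢ Icc (0 : ℝ) 1] (z, t₀), F (q.1 : M) ≠ 0 →
        ∀ s ∈ uIcc 0 (Λ q), flow F (q.1 : M) s ∈ V) :
    ∃ L : V × ℝ → ℝ,
      ContMDiffOn (I.prod 𝓘(ℝ, ℝ)) 𝓘(ℝ, ℝ) ∞ L (univ ×ˢ Icc (0 : ℝ) 1) ∧
      ∀ p : V, F p ≠ 0 → ∀ t ∈ Icc (0 : ℝ) 1, L (p, t) = Λ (p, t) := by
  have hΛs : ContMDiffOn (I.prod 𝓘(ℝ, ℝ)) 𝓘(ℝ, ℝ) ∞ Λ ({p : V | F p ≠ 0} ×ˢ Icc (0 : ℝ) 1) :=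
    fun q hq => hF.contMDiffWithinAt_shift hI (g := fun q : V × ℝ => (q.1 : M)) (k := K)
      (contMDiff_subtype_val.comp contMDiff_fst).contMDiffAt.contMDiffWithinAt
      ((hK q ⟨mem_univ _, hq.2⟩).mono (prod_mono (subset_univ _) le_rfl)) (hΛ q hq)
      (hdom q.1 hq.1 q.2 hq.2).1 (fun y hy => (hdom y.1 hy.1 y.2 hy.2).2) hq hq.1
  -- The local extensions are known to agree with `Λ` on this set, which is dense. They are glued by
  -- taking limits along it.
  set D : Set (V × ℝ) := {p : V | A (Y p) ≠ 0} ×ˢ Icc (0 : ℝ) 1 with hD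
  have hF0 : ∀ p : V, A (Y p) ≠ 0 → F p ≠ 0 := fun p hp h => hp (hL.apply_eq_zero p.2 h)
  have hDR : D ⊆ {p : V | F p ≠ 0} ×ˢ Icc (0 : ℝ) 1 := prod_mono hF0 le_rfl
  have hcl : univ ×ˢ Icc (0 : ℝ) 1 ⊆ closure D := by
    rw [hD, closure_prod_eq, (hL.dense hA0).closure_eq]
    exact prod_mono le_rfl subset_closure
  have hR : IsOpen {p : V | F p ≠ 0} :=
    hF.isOpen_setOf_ne_zero.preimage continuous_subtype_val
  refine ⟨extendFrom D Λ, contMDiffOn_extendFrom (prod_mono (subset_univ _) le_rfl) hcl ?_,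
    fun p hp t ht => ?_⟩
  · rintro ⟨z, t₀⟩ ⟨-, ht₀⟩
    by_cases hz : F z = 0
    · exact hL.exists_local_extension hB hA hF hI hK hKm hΛs hdom hz ht₀ (hQ z hz t₀ ht₀)
    · refine ⟨{p : V | F p ≠ 0} ×ˢ univ, hR.prod isOpen_univ, ⟨hz, mem_univ _⟩, Λ,
        hΛs.mono fun q hq => ⟨hq.1.1, hq.2.2⟩, fun _ _ => rfl⟩
  · exact extendFrom_eq (hcl ⟨mem_univ _, ht⟩) ((hΛ (p, t) ⟨hp, ht⟩).mono hDR)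

end ShiftExtension

/-! ### Image of the shift map and path lifting -/

section LinearExtensions

open Metric Filter

variable {E : Type u} [NormedAddCommGroup E] [NormedSpace ℝ E]
  {H : Type v} [TopologicalSpace H] {I : ModelWithCorners ℝ E H}
  {M : Type w} [TopologicalSpace M] [ChartedSpace H M] [IsManifold I ∞ M] [T2Space M]
  [CompleteSpace E]
  {F : ∀ p : M, TangentSpace I p} {V : Opens M}

omit [ChartedSpace H M] [IsManifold I ∞ M] [T2Space M] [CompleteSpace E] [NormedAddCommGroup E]
  [NormedSpace ℝ E] [TopologicalSpace H] in
theorem eventually_forall_homotopy_mem {K : V × ℝ → M}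
    (hK : ContinuousOn K (univ ×ˢ Icc (0 : ℝ) 1)) {z : V}
    (hz : ∀ t ∈ Icc (0 : ℝ) 1, K (z, t) ∈ V) : ∀ᶠ p in 𝓝 z, ∀ t ∈ Icc (0 : ℝ) 1, K (p, t) ∈ V := by
  have h1 : ∀ᶠ p in 𝓝 z, ∀ t ∈ Icc (0 : ℝ) 1, t ∈ Icc (0 : ℝ) 1 → K (p, t) ∈ V := by
    refine isCompact_Icc.eventually_forall_of_forall_eventually fun t ht => ?_
    have h2 := (hK (z, t) ⟨mem_univ _, ht⟩).eventually (V.isOpen.mem_nhds (hz t ht))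
    filter_upwards [eventually_nhdsWithin_iff.1 h2] with q hq hqt using hq ⟨mem_univ _, hqt⟩
  exact h1.mono fun p hp t ht => hp t ht ht

theorem IsSmoothField.mem_orbit_of_mem_orbitMaps (hF : IsSmoothField I F) (hI : IsBoundaryModel I)
    {h : V → M} (hh : h ∈ orbitMaps F V) (p : V) : h p ∈ orbit F (p : M) :=
  hh.2.1 p p (hF.mem_orbit_self hI _)

/-- The homotopy is lifted from the shift function `0` over the regular points, and the final value
of the lift is extended over the zeros, where the maps fix every point and any time is right. -/
theorem IsLinearExtensionOn.orbitMapsId_subset (h : IsLinearExtensionOn.{u, v, w, x} F V)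
    (hF : IsSmoothField I F) (hI : IsBoundaryModel I) : orbitMapsId F V ⊆ shiftImage F V := by
  obtain ⟨m, B, A, Y, hB, hA0, hA, hL⟩ := h.exists_isLinearComponent
  rintro f ⟨K, hK, hKm, hK0, hK1⟩
  have h0I : (0 : ℝ) ∈ Icc (0 : ℝ) 1 := ⟨le_rfl, zero_le_one⟩
  have h1I : (1 : ℝ) ∈ Icc (0 : ℝ) 1 := ⟨zero_le_one, le_rfl⟩
  have hR : IsOpen {p : V | F p ≠ 0} := hF.isOpen_setOf_ne_zero.preimage continuous_subtype_val
  obtain ⟨Λ, hΛ, hΛK⟩ := hF.exists_lift hI hR (g := ((↑) : V → M)) (K := K) (α₀ := fun _ => 0)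
    (hK.mono (prod_mono (subset_univ _) le_rfl)) (fun x hx => hx)
    (fun x _ t ht => hF.mem_orbit_of_mem_orbitMaps hI (hKm t ht) x) continuousOn_const
    fun x _ => ⟨(hF.flow_zero hI _).1, (hK0 x).trans (hF.flow_zero hI _).2.symm⟩
  have hfm : f ∈ orbitMaps F V := by
    have := hKm 1 h1I
    simp only [hK1] at this
    exact this
  -- The given homotopy is only jointly continuous, so the extension is applied to the constant
  -- homotopy at its smooth end map `f`.
  obtain ⟨L, hLs, hLΛ⟩ := hL.exists_extension hA0 hB hA hF hI (K := fun q => f q.1)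
    (Λ := fun q => Λ (q.1, 1)) (hfm.1.comp contMDiff_fst).contMDiffOn (fun _ _ => hfm)
    (hΛ.comp (by fun_prop) fun q hq => ⟨hq.1, h1I⟩)
    (fun p hp t _ => by
      have h1 := (hΛK p hp).2 1 h1I
      rw [hK1] at h1
      exact h1)
    (fun z hz t₀ _ => by
      have h1 := eventually_forall_homotopy_mem hK (z := z) fun t ht => by
        have h2 : K (z, t) = z := hF.eq_of_mem_orbitMaps hI (hKm t ht) hz
        rw [h2]
        exact z.2
      have h2 := (continuous_fst.tendsto (z, t₀)).eventually h1
      filter_upwards [nhdsWithin_le_nhds h2] with q hq hq0 s hs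
      have hc : ContinuousOn (fun t => Λ (q.1, t)) (uIcc 0 1) := by
        rw [uIcc_of_le zero_le_one]
        exact hΛ.comp (by fun_prop) fun t ht => ⟨hq0, ht⟩
      rw [← (hΛK q.1 hq0).1] at hs
      -- Every time between `0` and `Λ (x, 1)` is some `Λ (x, t)`, so the orbit segment is traced by
      -- the homotopy, which stays in `V` near `z`.
      obtain ⟨t, ht, rfl⟩ := intermediate_value_uIcc hc hs
      rw [uIcc_of_le zero_le_one] at ht
      have h3 := ((hΛK q.1 hq0).2 t ht).2
      simp only
      rw [← h3]
      exact hq t ht)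
  have hLf : ∀ p : V, ((p : M), L (p, 1)) ∈ flowDomain F ∧ flow F (p : M) (L (p, 1)) = f p := by
    intro p
    by_cases hp : F p = 0
    · exact ⟨(hF.flow_of_eq_zero hp _).1, (hF.flow_of_eq_zero hp _).2.trans
        (hF.eq_of_mem_orbitMaps hI hfm hp).symm⟩
    · have h1 := (hΛK p hp).2 1 h1I
      rw [hLΛ p hp 1 h1I]
      exact ⟨h1.1, h1.2.symm.trans (hK1 p)⟩
  refine ⟨fun p => L (p, 1), ⟨?_, fun p => (hLf p).1⟩, funext fun p => (hLf p).2⟩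
  exact hLs.comp_contMDiff (contMDiff_id.prodMk contMDiff_const) fun p => ⟨mem_univ _, h1I⟩

theorem IsLinearExtensionOn.smoothPathLifting (h : IsLinearExtensionOn.{u, v, w, x} F V)
    (hF : IsSmoothField I F) (hI : IsBoundaryModel I) : SmoothPathLifting F V := by
  obtain ⟨m, B, A, Y, hB, hA0, hA, hL⟩ := h.exists_isLinearComponent
  refine ⟨hL.isNowhereDense hA0, fun K α₀ hK hα₀ hK0 hKS => ?_⟩
  have h0I : (0 : ℝ) ∈ Icc (0 : ℝ) 1 := ⟨le_rfl, zero_le_one⟩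
  have hKm : ∀ t ∈ Icc (0 : ℝ) 1, (fun p : V => K (p, t)) ∈ orbitMaps F V := fun t ht => by
    obtain ⟨α, hα, hαK⟩ := hKS t ht
    rw [← hαK]
    exact hF.shiftMap_mem_orbitMaps hI hα
  have hR : IsOpen {p : V | F p ≠ 0} := hF.isOpen_setOf_ne_zero.preimage continuous_subtype_val
  obtain ⟨Λ, hΛ, hΛK⟩ := hF.exists_lift hI hR (g := ((↑) : V → M)) (K := K) (α₀ := α₀)
    (hK.continuousOn.mono (prod_mono (subset_univ _) le_rfl)) (fun x hx => hx)
    (fun x _ t ht => hF.mem_orbit_of_mem_orbitMaps hI (hKm t ht) x) hα₀.1.continuous.continuousOn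
    fun x _ => ⟨hα₀.2 x, hK0 x⟩
  have hH : ContinuousOn (fun q : V × ℝ => flow F (q.1 : M) (q.2 * α₀ q.1))
      (univ ×ˢ Icc (0 : ℝ) 1) := by
    rintro ⟨p, t⟩ ⟨-, ht⟩
    have h1 : ContinuousAt (fun q : V × ℝ => ((q.1 : M), q.2 * α₀ q.1)) (p, t) := by
      have := hα₀.1.continuous
      fun_prop
    exact (ContinuousAt.comp (f := fun q : V × ℝ => ((q.1 : M), q.2 * α₀ q.1))
      (hF.contMDiffAt_flow hI
        (hF.mul_mem_flowDomain hI (hα₀.2 p) ht)).continuousAt h1).continuousWithinAt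
  obtain ⟨L, hLs, hLΛ⟩ := hL.exists_extension hA0 hB hA hF hI hK hKm hΛ (fun p hp => (hΛK p hp).2)
    (fun z hz t₀ _ => by
      have h1 := eventually_forall_homotopy_mem hK.continuousOn (z := z) fun t ht => by
        have h2 : K (z, t) = z := hF.eq_of_mem_orbitMaps hI (hKm t ht) hz
        rw [h2]
        exact z.2
      have h2 := eventually_forall_homotopy_mem hH (z := z) fun t ht => by
        simp only [(hF.flow_of_eq_zero hz _).2]
        exact z.2
      have h3 := (continuous_fst.tendsto (z, t₀)).eventually (h1.and h2)
      filter_upwards [nhdsWithin_le_nhds h3, self_mem_nhdsWithin] with q hq hqt hq0 s hs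
      have hsub : uIcc 0 q.2 ⊆ Icc 0 1 := by
        rw [uIcc_of_le hqt.2.1]
        exact Icc_subset_Icc_right hqt.2.2
      -- Times up to `α₀` are covered by the homotopy of shifts by `t α₀`, those from `α₀` to `Λ` by
      -- the given one. Both stay in `V` near `z`.
      rcases uIcc_subset_uIcc_union_uIcc (b := α₀ q.1) hs with hs | hs
      · have h4 : s ∈ uIcc (0 * α₀ q.1) (1 * α₀ q.1) := by rwa [zero_mul, one_mul]
        obtain ⟨t, ht, rfl⟩ := intermediate_value_uIcc (f := fun t => t * α₀ q.1) (by fun_prop) h4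
        rw [uIcc_of_le zero_le_one] at ht
        exact hq.2 t ht
      · have hc : ContinuousOn (fun t => Λ (q.1, t)) (uIcc 0 q.2) :=
          hΛ.comp (by fun_prop) fun t ht => ⟨hq0, hsub ht⟩
        rw [← (hΛK q.1 hq0).1] at hs
        obtain ⟨t, ht, rfl⟩ := intermediate_value_uIcc hc hs
        have h5 := ((hΛK q.1 hq0).2 t (hsub ht)).2
        simp only
        rw [← h5]
        exact hq.1 t (hsub ht))
  refine ⟨L, hLs, fun p hp => ⟨(hLΛ p hp 0 h0I).trans (hΛK p hp).1, fun t ht => ?_⟩⟩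
  rw [hLΛ p hp t ht]
  exact (hΛK p hp).2 t ht

end LinearExtensions

/-! ### Parameter rigidity -/

section Rigidity

open Metric Filter

variable {E : Type u} [NormedAddCommGroup E] [NormedSpace ℝ E]
  {H : Type v} [TopologicalSpace H] {I : ModelWithCorners ℝ E H}
  {M : Type w} [TopologicalSpace M] [ChartedSpace H M] [IsManifold I ∞ M]
  {F G : ∀ p : M, TangentSpace I p} {V : Opens M}

/-- The derivative of a smooth function along a smooth vector field is smooth. -/
theorem IsSmoothField.contMDiffOn_mfderiv_apply {W : Type*} [NormedAddCommGroup W] [NormedSpace ℝ W]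
    (hG : IsSmoothField I G) {Y : M → W} (hY : ContMDiffOn I 𝓘(ℝ, W) ∞ Y V) :
    ContMDiffOn I 𝓘(ℝ, W) ∞ (fun x => (mfderiv I 𝓘(ℝ, W) Y x (G x) : W)) V := by
  have h1 := hY.contMDiffOn_tangentMapWithin (m := ∞) (by simp) V.isOpen.uniqueMDiffOn
  have h2 := h1.comp (hG.smooth.contMDiffOn (s := (V : Set M))) fun x hx => hx
  have h3 := (contMDiff_snd_tangentBundle_modelSpace W 𝓘(ℝ, W) (n := ∞)).comp_contMDiffOn h2
  have h4 : ∀ x ∈ V, mfderiv I 𝓘(ℝ, W) Y x = mfderivWithin I 𝓘(ℝ, W) Y V x := fun x hx =>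
    (mfderivWithin_of_isOpen V.isOpen hx).symm
  exact h3.congr fun x hx => congrArg (fun T : E →L[ℝ] W => T (G x)) (h4 x hx)

variable [T2Space M] [CompleteSpace E]

/-- If the orbits of `G` are contained in orbits of `F`, then `G` vanishes at the zeros of `F`. -/
theorem IsSmoothField.eq_zero_of_orbit_subset (hF : IsSmoothField I F) (hG : IsSmoothField I G)
    (hI : IsBoundaryModel I) {z q : M} (h : orbit G z ⊆ orbit F q) (hz : F z = 0) : G z = 0 := by
  have hq : F q = 0 := by
    by_contra hq
    exact hF.ne_zero_of_mem_orbit hI hq (h (hG.mem_orbit_self hI z)) hz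
  have h1 : ∀ y ∈ orbit F q, y = q := by
    rintro _ ⟨t, -, rfl⟩
    exact (hF.flow_of_eq_zero hq t).2
  have hzq : z = q := h1 z (h (hG.mem_orbit_self hI z))
  have h0 := hG.flow_zero hI z
  obtain ⟨a, b, ha, hb, -, hd, -⟩ := hG.exists_Ioo_of_mem_flowDomain h0.1
  have h2 := hG.hasDerivAt_extChartAt_flow (p := z) h0.1 (by
    rw [h0.2]
    exact mem_extChartAt_source z)
  rw [h0.2, chartField_self] at h2
  refine HasDerivAt.unique (F := E) h2 ((hasDerivAt_const 0 (extChartAt I z z)).congr_of_eventuallyEq ?_)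
  filter_upwards [Ioo_mem_nhds ha hb] with t ht
  rw [(h1 _ (h ⟨t, hd t ht, rfl⟩)).trans hzq.symm]

/-- If the orbits of `G` are contained in orbits of `F`, then `G` is a multiple of `F` at regular
points of `F`. -/
theorem IsSmoothField.exists_smul_of_orbit_subset (hF : IsSmoothField I F) (hG : IsSmoothField I G)
    (hI : IsBoundaryModel I) {p q : M} (h : orbit G p ⊆ orbit F q) (hp : F p ≠ 0) :
    ∃ a : ℝ, G p = a • F p := by
  obtain ⟨W, hW, hpW, τ, hτ, hpl⟩ := hF.exists_plaque_time hI hp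
  have h0 := hG.flow_zero hI p
  obtain ⟨a, b, ha, hb, -, hd, -⟩ := hG.exists_Ioo_of_mem_flowDomain h0.1
  have hκ0 := hG.hasMFDerivAt_flow h0.1
  have hmem : flow G p ⁻¹' W ∩ Ioo a b ∈ 𝓝 (0 : ℝ) :=
    inter_mem (hκ0.continuousAt.preimage_mem_nhds (hW.mem_nhds (by rw [h0.2]; exact hpW)))
      (Ioo_mem_nhds ha hb)
  obtain ⟨ε, hε, hεs⟩ := Metric.mem_nhds_iff.1 hmem
  have hkey := hpl (ball 0 ε) (flow G p) q (convex_ball _ _).isPreconnected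
    (fun t ht => (hG.hasMFDerivAt_flow (hd t (hεs ht).2)).continuousAt.continuousWithinAt)
    (fun t ht => (hεs ht).1) (fun t ht => h ⟨t, hd t (hεs ht).2, rfl⟩) 0 (mem_ball_self hε)
  simp only [h0.2] at hkey
  -- The integral curve of `G` stays in one orbit of `F`, so for small `t` it is `flow F p (σ t)`.
  -- Differentiating at `0` gives `G p = σ' (0) F p`.
  set σ : ℝ → ℝ := fun t => τ p - τ (flow G p t) with hσ
  have hσ0 : σ 0 = 0 := by simp only [hσ, h0.2, sub_self]
  have hσd : DifferentiableAt ℝ σ 0 := by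
    refine (differentiableAt_const _).sub ?_
    refine MDifferentiableAt.differentiableAt ?_
    refine MDifferentiableAt.comp (I' := I) (g := τ) 0 ?_ hκ0.mdifferentiableAt
    rw [h0.2]
    exact (hτ.contMDiffAt (hW.mem_nhds hpW)).mdifferentiableAt (by simp)
  have hF0 := hF.flow_zero hI p
  have h2 := hF.hasDerivAt_extChartAt_flow (p := p) hF0.1 (by
    rw [hF0.2]
    exact mem_extChartAt_source p)
  have h3 := hG.hasDerivAt_extChartAt_flow (p := p) h0.1 (by
    rw [h0.2]
    exact mem_extChartAt_source p)
  rw [h0.2, chartField_self] at h3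
  rw [hF0.2, chartField_self] at h2
  have h4 := HasDerivAt.scomp_of_eq (F := E) (0 : ℝ) h2 hσd.hasDerivAt hσ0.symm
  refine ⟨deriv σ 0, HasDerivAt.unique (F := E) h3 (h4.congr_of_eventuallyEq ?_)⟩
  filter_upwards [ball_mem_nhds 0 hε] with t ht
  rw [Function.comp_apply, (hkey t ht).2]

omit [T2Space M] [CompleteSpace E] in
/-- A ratio of smooth vector fields is smooth at regular points of the denominator. -/
theorem IsSmoothField.contMDiffAt_ratio (hF : IsSmoothField I F) (hG : IsSmoothField I G) {a : M → ℝ}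
    (ha : ∀ p, F p ≠ 0 → G p = a p • F p) {p : M} (hp : F p ≠ 0) :
    ContMDiffAt I 𝓘(ℝ, ℝ) ∞ a p := by
  obtain ⟨l, hl⟩ := exists_apply_chartField_ne_zero hp
  have hs := (isOpen_extChartAt_source (I := I) p).mem_nhds (mem_extChartAt_source p)
  have hsm : ∀ {X : ∀ p : M, TangentSpace I p}, IsSmoothField I X →
      ContMDiffAt I 𝓘(ℝ, ℝ) ∞ (fun q => l (chartField X p (extChartAt I p q))) p := by
    intro X hX
    have h1 : ContMDiffOn I 𝓘(ℝ, E) ∞ (fun q => chartField X p (extChartAt I p q))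
        (chartAt H p).source :=
      (contMDiffOn_iff_contDiffOn.2 (hX.contDiffOn_chartField p)).comp contMDiffOn_extChartAt
        fun q hq => (extChartAt I p).map_source (by rwa [extChartAt_source])
    exact (l.contDiff.contMDiff _).comp p (h1.contMDiffAt (chart_source_mem_nhds H p))
  have hq := (contMDiffAt_iff_contDiffAt.2 ((contDiffAt_inv ℝ hl).of_le le_top)).comp p (hsm hF)
  refine ((hsm hG).mul hq).congr_of_eventuallyEq ?_
  filter_upwards [hs, (hsm hF).continuousAt.eventually_ne hl, hF.isOpen_setOf_ne_zero.mem_nhds hp]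
    with q hqs hq0 hqF
  have h1 : chartField G p (extChartAt I p q) = a q • chartField F p (extChartAt I p q) := by
    rw [chartField_extChartAt hqs, chartField_extChartAt hqs, ha q hqF]
    exact map_smul (tangentCoordChange I q p q) (a q) (F q)
  rw [Pi.mul_apply, Function.comp_apply, h1, map_smul, smul_eq_mul, mul_inv_cancel_right₀ hq0]

omit [T2Space M] [CompleteSpace E] in
/-- A ratio of smooth vector fields extends smoothly over linear zeros of the denominator. -/
theorem IsLinearComponent.exists_ratio {m : ℕ}
    {A : EuclideanSpace ℝ (Fin m) →L[ℝ] EuclideanSpace ℝ (Fin m)}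
    {Y : M → EuclideanSpace ℝ (Fin m)} (hL : IsLinearComponent F V A Y) (hA : A ≠ 0)
    (hF : IsSmoothField I F) (hG : IsSmoothField I G) {a : M → ℝ}
    (ha : ∀ p, F p ≠ 0 → G p = a p • F p) (ha0 : ∀ p, F p = 0 → G p = 0) {z : M} (hzV : z ∈ V)
    (hz : F z = 0) : ∃ O : Set M, IsOpen O ∧ z ∈ O ∧ ∃ g : M → ℝ, ContMDiffOn I 𝓘(ℝ, ℝ) ∞ g O ∧
      ∀ x ∈ {p | F p ≠ 0} ∩ O, g x = a x := by
  obtain ⟨c⟩ := hL.nonempty_chart z hzV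
  have h0 := c.coord_mem z c.mem_O
  obtain ⟨v, hv⟩ : ∃ v, A v ≠ 0 := by
    by_contra! h
    exact hA (ContinuousLinearMap.ext h)
  obtain ⟨ζ, hζ⟩ := SeparatingDual.exists_ne_zero (R := ℝ) hv
  set η := ζ.comp A with hη
  have hη0 : η ≠ 0 := fun h => hζ (by rw [← ContinuousLinearMap.comp_apply, ← hη, h]; rfl)
  -- `b = dY (G)` is smooth on all of `V` and equals `a A (Y)` at regular points; hence `ζ b = a η
  -- (Y)` there, and Hadamard's lemma divides by `η`.
  set b : M → EuclideanSpace ℝ (Fin m) :=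
    fun x => mfderiv I 𝓘(ℝ, EuclideanSpace ℝ (Fin m)) Y x (G x) with hb
  have hbs := hG.contMDiffOn_mfderiv_apply hL.contMDiffOn
  have hbF : ∀ x ∈ V, F x ≠ 0 → b x = a x • A (Y x) := fun x hx hxF => by
    rw [← hL.mfderiv_apply x hx, hb]
    simp only [ha x hxF]
    exact map_smul (mfderiv I 𝓘(ℝ, EuclideanSpace ℝ (Fin m)) Y x) (a x) (F x)
  have hb0 : ∀ x, F x = 0 → b x = 0 := fun x hxF => by
    simp only [hb, ha0 x hxF]
    exact map_zero _
  obtain ⟨ρ, hρ, hρr, g, hg, hfg⟩ := exists_hadamard_linear hη0 (y₀ := Y z)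
    (by rw [hη, ContinuousLinearMap.comp_apply, hL.apply_eq_zero hzV hz, map_zero]) c.r_pos c.convex
    c.uniqueDiffOn (f := fun q => ζ (b (c.Θ q)))
    (contMDiffOn_iff_contDiffOn.1 ((ζ.contDiff.contMDiff (n := ∞)).comp_contMDiffOn
      (hbs.comp c.contMDiffOn_Θ c.Θ_mem))) fun q hq hq0 => by
      by_cases hx : F (c.Θ q) = 0
      · rw [hb0 _ hx, map_zero]
      · rw [hbF _ (c.Θ_mem q hq) hx, map_smul, c.Y_Θ q hq, ← ContinuousLinearMap.comp_apply, ← hη,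
          hq0, smul_zero]
  set O : Set M := c.O ∩ Y ⁻¹' ball (Y z) ρ with hO
  have hOo : IsOpen O := (hL.contMDiffOn.continuousOn.mono c.O_subset).isOpen_inter_preimage
    c.isOpen_O isOpen_ball
  have hco : ∀ x ∈ O, (Y x, c.U x) ∈ ball (Y z) ρ ×ˢ c.C := fun x hx =>
    ⟨hx.2, (c.coord_mem x hx.1).2⟩
  have hgs : ContMDiffOn I 𝓘(ℝ, ℝ) ∞ (fun x => g (Y x, c.U x)) O := by
    refine (contMDiffOn_iff_contDiffOn.2 hg).comp (ContMDiffOn.prodMk_space ?_ ?_) hco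
    · exact hL.contMDiffOn.mono fun x hx => c.O_subset hx.1
    · exact c.contMDiffOn_U.mono fun x hx => hx.1
  refine ⟨O, hOo, ⟨c.mem_O, mem_ball_self hρ⟩, fun x => g (Y x, c.U x), hgs, fun x hx => ?_⟩
  have hxV := c.O_subset hx.2.1
  -- Division determines `a` only where `η (Y) ≠ 0`. At the remaining regular points both functions
  -- are continuous, and `S` is dense in `V`.
  set S : Set M := Subtype.val '' {x : V | η (Y x) ≠ 0} with hS
  have hxS : x ∈ closure S :=
    image_closure_subset_closure_image continuous_subtype_val
      ⟨⟨x, hxV⟩, hL.dense hη0 _, rfl⟩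
  have : (𝓝[S] x).NeBot := mem_closure_iff_nhdsWithin_neBot.1 hxS
  have hDO : {p | F p ≠ 0} ∩ O ∈ 𝓝 x := (hF.isOpen_setOf_ne_zero.inter hOo).mem_nhds hx
  refine tendsto_nhds_unique_of_eventuallyEq (l := 𝓝[S] x) (f := fun x => g (Y x, c.U x)) (g := a)
    ((hgs.contMDiffAt (hOo.mem_nhds hx.2)).continuousAt.tendsto.mono_left nhdsWithin_le_nhds)
    ((hF.contMDiffAt_ratio hG ha hx.1).continuousAt.tendsto.mono_left nhdsWithin_le_nhds) ?_
  filter_upwards [self_mem_nhdsWithin, nhdsWithin_le_nhds hDO]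
  rintro _ ⟨y, hy, rfl⟩ ⟨hyF, hyO⟩
  have h1 := hfg _ (hco _ hyO)
  simp only [c.Θ_coord _ hyO.1] at h1
  rw [hbF _ y.2 hyF, map_smul, ← ContinuousLinearMap.comp_apply, ← hη, smul_eq_mul, smul_eq_mul,
    mul_comm] at h1
  exact (mul_left_cancel₀ hy h1).symm

/-- A vector field all of whose zeros are linear is parameter rigid. -/
theorem IsSmoothField.parameterRigid (hF : IsSmoothField I F) (hI : IsBoundaryModel I)
    (h : ∀ z : M, F z = 0 → ∃ V : Opens M, z ∈ V ∧ IsLinearExtensionOn.{u, v, w, x} F V) :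
    ParameterRigid F := by
  intro G hG hGF
  have ha0 : ∀ p, F p = 0 → G p = 0 := fun p hp => by
    obtain ⟨q, hq⟩ := hGF p
    exact hF.eq_zero_of_orbit_subset hG hI hq hp
  have hex : ∀ p, ∃ a : ℝ, F p ≠ 0 → G p = a • F p := fun p => by
    by_cases hp : F p = 0
    · exact ⟨0, fun h => absurd hp h⟩
    · obtain ⟨q, hq⟩ := hGF p
      obtain ⟨a, ha⟩ := hF.exists_smul_of_orbit_subset hG hI hq hp
      exact ⟨a, fun _ => ha⟩
  choose a ha using hex
  set D : Set M := {p | F p ≠ 0} with hD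
  have hcl : univ ⊆ closure D := by
    intro z _
    by_cases hz : F z = 0
    · obtain ⟨V, hzV, hV⟩ := h z hz
      obtain ⟨m, B, A, Y, -, hA0, -, hL⟩ := hV.exists_isLinearComponent
      refine closure_mono ?_ (image_closure_subset_closure_image continuous_subtype_val
        ⟨⟨z, hzV⟩, hL.dense hA0 _, rfl⟩)
      rintro _ ⟨y, hy, rfl⟩ hy0
      exact hy (hL.apply_eq_zero y.2 hy0)
    · exact subset_closure hz
  have hsm : ContMDiffOn I 𝓘(ℝ, ℝ) ∞ (extendFrom D a) univ := by
    refine contMDiffOn_extendFrom (subset_univ _) hcl fun z _ => ?_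
    by_cases hz : F z = 0
    · obtain ⟨V, hzV, hV⟩ := h z hz
      obtain ⟨m, B, A, Y, -, hA0, -, hL⟩ := hV.exists_isLinearComponent
      obtain ⟨O, hO, hzO, g, hg, hga⟩ := hL.exists_ratio hA0 hF hG ha ha0 hzV hz
      exact ⟨O, hO, hzO, g, hg.mono inter_subset_left, hga⟩
    · exact ⟨D, hF.isOpen_setOf_ne_zero, hz, a, fun p hp =>
        (hF.contMDiffAt_ratio hG ha hp.1).contMDiffWithinAt, fun _ _ => rfl⟩
  refine ⟨extendFrom D a, contMDiffOn_univ.1 hsm, fun p => ?_⟩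
  by_cases hp : F p = 0
  · rw [ha0 p hp, hp, smul_zero]
  · rw [extendFrom_eq (subset_closure hp)
      (hF.contMDiffAt_ratio hG ha hp).continuousAt.continuousWithinAt]
    exact ha p hp

end Rigidity

end

/-! ### The corollary -/

theorem mainTheorem6
    {E : Type u} [NormedAddCommGroup E] [NormedSpace ℝ E] [FiniteDimensional ℝ E]
    {H : Type v} [TopologicalSpace H] (I : ModelWithCorners ℝ E H) (hI : IsBoundaryModel I)
    {M : Type w} [TopologicalSpace M] [ChartedSpace H M] [IsManifold I ∞ M] [T2Space M]
    (F : ∀ p : M, TangentSpace I p) (hF : IsSmoothField I F) :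
    (∀ V : Opens M, IsLinearExtensionOn.{u, v, w, x} F V →
      shiftImage F V = orbitMapsId F V ∧ SmoothPathLifting F V) ∧
    ((∀ z : M, F z = 0 → ∃ V : Opens M, z ∈ V ∧ IsLinearExtensionOn.{u, v, w, x} F V) →
      ParameterRigid F) := by
  have : CompleteSpace E := FiniteDimensional.complete ℝ E
  exact ⟨fun V hV => ⟨(hF.shiftImage_subset_orbitMapsId hI V).antisymm
    (hV.orbitMapsId_subset hF hI), hV.smoothPathLifting hF hI⟩, hF.parameterRigid hI⟩
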